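/- **Setting.** On $\mathbb{R}^{1+n}$, $n\ge 1$, with Cartesian coordinates $(t,x)=(t,x^1,\dots,x^n)$, let $g=-dt^2+(dx^1)^2+\dots+(dx^n)^2$ be the Minkowski metric and $\Box=-\partial_t^2+\partial_{x^1}^2+\dots+\partial_{x^n}^2$. For $P\in\mathbb{R}^{1+n}$ put $t_P=t-t(P)$, $r_P=|x-x(P)|$, $u_P=\tfrac12(t_P-r_P)$, $v_P=\tfrac12(t_P+r_P)$, $f_P=-u_Pv_P$ and $\mathcal D_P=\{f_P>0\}$. Let $\partial_{u_P}=\partial_t-\partial_{r_P}$ and $\partial_{v_P}=\partial_t+\partial_{r_P}$, where $\partial_{r_P}$ is the radial derivative about $x(P)$, and let $|\nabla\!\!\!\!/^P\phi|^2$ be the squared norm of the gradient of $\phi$ along the spheres on which $(u_P,v_P)$ is constant. A *generalized timelike cylinder* (GTC) is a set $\mathcal U\subseteq\mathbb{R}^{1+n}$ such that: $\partial\mathcal U$ is a smooth timelike hypersurface with $\mathcal U$ locally on one side of it; for every $\tau\in\mathbb{R}$ the slice $\{y\in\mathbb{R}^n:(\tau,y)\in\mathcal U\}$ is nonempty, bounded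 and open; and there is a smooth future-directed timelike vector field on $\bar{\mathcal U}$ that is tangent to $\partial\mathcal U$ along $\partial\mathcal U$. Let $\mathcal N$ be the outer-pointing unit normal of $\mathcal U$ with respect to $g$. All integrals are with respect to the volume measures induced by $g$. **Theorem.** There is a universal constant $c>0$, and for every $n\ge1$ there are constants $c_n,C,C'>0$ depending only on $n$, such that the following holds. Let $\mathcal U$ be a GTC in $\mathbb{R}^{1+n}$, let $P\in\mathbb{R}^{1+n}$ and $R>0$ satisfy $\bar{\mathcal U}\cap\mathcal D_P\subseteq\{r_P<R\}$, and let $\varepsilon,a,b>0$ satisfy $$a\ge n^2,\qquad \varepsilon\le c_n b,\qquad b\le cR^{-1}.$$ Then for every real-valued $\phi\in C^2(\mathcal U)\cap C^1(\bar{\mathcal U})$ with $\phi=0$ on $\partial\mathcal U\cap\mathcal D_P$, $$\frac1a\int_{\mathcal U\cap\mathcal D_P}\zeta f_P|\Box\phi|^2+C'\int_{\partial\mathcal U\cap\mathcal D_P}\zeta\,\big[(1-\varepsilon r_P)\mathcal N f_P+\varepsilon f_P\mathcal N r_P\big]\,|\mathcal N\phi|^2$$ $$\ge C\varepsilon\int_{\mathcal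 U\cap\mathcal D_P}\zeta\, r_P^{-1}\big(|u_P\partial_{u_P}\phi|^2+|v_P\partial_{v_P}\phi|^2+f_P|\nabla\!\!\!\!/^P\phi|^2\big)+Cba^2\int_{\mathcal U\cap\mathcal D_P}\zeta f_P^{-1/2}\phi^2,$$ where $$\zeta=\left\{\frac{f_P}{(1+\varepsilon u_P)(1-\varepsilon v_P)}\exp\left[\frac{2bf_P^{1/2}}{(1+\varepsilon u_P)^{1/2}(1-\varepsilon v_P)^{1/2}}\right]\right\}^{2a}.$$ The boundary integral and the two integrals on the right-hand side converge absolutely; the first integral on the left-hand side may be $+\infty$, in which case the inequality is trivially true. -/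

import Mathlib

open MeasureTheory Set Filter Topology
open scoped ContDiff

noncomputable section

namespace Mink

/-- Spacetime `ℝ^{1+n}`: coordinate `0` is the time `t`, coordinates `1, …, n` are `x¹, …, xⁿ`.
The Lebesgue measure on it is the volume measure of the Minkowski metric. -/
abbrev Spacetime (n : ℕ) : Type := EuclideanSpace ℝ (Fin (n + 1))

variable {n : ℕ}

/-- The time coordinate `t`. -/
def time (p : Spacetime n) : ℝ := p 0

/-- The spatial coordinates `x = (x¹, …, xⁿ)`. -/
def space (p : Spacetime n) : EuclideanSpace ℝ (Fin n) := WithLp.toLp 2 fun i => p i.succ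

/-- The Minkowski metric `g = -dt² + (dx¹)² + ⋯ + (dxⁿ)²`. -/
def metric (X Y : Spacetime n) : ℝ := -(X 0 * Y 0) + ∑ i : Fin n, X i.succ * Y i.succ

/-- The partial derivative of `h` with respect to the `k`-th Cartesian coordinate. -/
def pd (k : Fin (n + 1)) (h : Spacetime n → ℝ) (p : Spacetime n) : ℝ :=
  fderiv ℝ h p (EuclideanSpace.single k 1)

/-- The wave operator `□ = -∂_t² + ∂_{x¹}² + ⋯ + ∂_{xⁿ}²`. -/
def box (h : Spacetime n → ℝ) (p : Spacetime n) : ℝ :=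
  -pd 0 (pd 0 h) p + ∑ i : Fin n, pd i.succ (pd i.succ h) p

/-- The Minkowski gradient `∇^♯ h = (-∂_t h, ∂_{x¹} h, …, ∂_{xⁿ} h)`. -/
def grad (h : Spacetime n → ℝ) (p : Spacetime n) : Spacetime n :=
  WithLp.toLp 2 (Fin.cons (-pd 0 h p) fun i : Fin n => pd i.succ h p)

/-! ### Functions and vector fields adapted to a point `P` -/

/-- `t_P = t - t(P)`. -/
def tP (P p : Spacetime n) : ℝ := time p - time P

/-- `r_P = |x - x(P)|`. -/
def rP (P p : Spacetime n) : ℝ := ‖space p - space P‖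

/-- `u_P = (t_P - r_P) / 2`. -/
def uP (P p : Spacetime n) : ℝ := (tP P p - rP P p) / 2

/-- `v_P = (t_P + r_P) / 2`. -/
def vP (P p : Spacetime n) : ℝ := (tP P p + rP P p) / 2

/-- The hyperbolic function `f_P = -u_P v_P`. -/
def fP (P p : Spacetime n) : ℝ := -(uP P p * vP P p)

/-- `𝒟_P = {f_P > 0}`, the exterior of the null cone with vertex `P`. -/
def exterior (P : Spacetime n) : Set (Spacetime n) := {p | 0 < fP P p}

/-- The `i`-th component of the angular variable `ω = (x - x(P)) / r_P`. -/
def omega (P p : Spacetime n) (i : Fin n) : ℝ := (space p i - space P i) / rP P p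

/-- The radial derivative `∂_{r_P} h`, at points with `r_P ≠ 0`. -/
def dR (P : Spacetime n) (h : Spacetime n → ℝ) (p : Spacetime n) : ℝ :=
  ∑ i : Fin n, omega P p i * pd i.succ h p

/-- The null derivative `∂_{u_P} h = ∂_t h - ∂_{r_P} h`; here `t_P = u_P + v_P` and
`r_P = v_P - u_P`. -/
def dU (P : Spacetime n) (h : Spacetime n → ℝ) (p : Spacetime n) : ℝ := pd 0 h p - dR P h p

/-- The null derivative `∂_{v_P} h = ∂_t h + ∂_{r_P} h`. -/
def dV (P : Spacetime n) (h : Spacetime n → ℝ) (p : Spacetime n) : ℝ := pd 0 h p + dR P h p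

/-- The squared norm `g^{ab} ∇̸_a h ∇̸_b h` of the angular gradient of `h`, that is, of the
gradient of the restriction of `h` to the level sphere of `(u_P, v_P)` through `p`. That sphere
lies in a level set of `t`, has centre `x(P)` and unit normal `ω`, so this gradient is the
component of the spatial gradient of `h` that is orthogonal to `ω`. -/
def angGradSq (P : Spacetime n) (h : Spacetime n → ℝ) (p : Spacetime n) : ℝ :=
  ∑ i : Fin n, (pd i.succ h p - dR P h p * omega P p i) ^ 2

/-- The Carleman weight
`{ f_P / ((1 + ε u_P)(1 - ε v_P)) · exp [2 b f_P^{1/2} / ((1 + ε u_P)^{1/2} (1 - ε v_P)^{1/2})] }^{2a}`. -/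
def weight (P : Spacetime n) (a b ε : ℝ) (p : Spacetime n) : ℝ :=
  (fP P p / ((1 + ε * uP P p) * (1 - ε * vP P p)) *
    Real.exp (2 * b * √(fP P p) / (√(1 + ε * uP P p) * √(1 - ε * vP P p)))) ^ (2 * a)

/-! ### Domains with smooth boundary and their outer normal -/

/-- `ρ` is a smooth function with nonzero differential at `p`, and near `p` the set `U` is
`{ρ < 0}`. If this holds at a boundary point `p` of `U`, then near `p` the boundary of `U` is the
smooth hypersurface `{ρ = 0}`, and `U` lies on the side of it where `ρ` is negative. -/
structure IsDefiningFunctionAt (U : Set (Spacetime n)) (p : Spacetime n)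
    (ρ : Spacetime n → ℝ) : Prop where
  smooth : ContDiff ℝ ∞ ρ
  fderiv_ne_zero : fderiv ℝ ρ p ≠ 0
  eventually_mem_iff : ∀ᶠ q in 𝓝 p, q ∈ U ↔ ρ q < 0

/-- A defining function of `U` at `p` (arbitrary where there is none). -/
def definingFunction (U : Set (Spacetime n)) (p : Spacetime n) : Spacetime n → ℝ :=
  Classical.epsilon (IsDefiningFunctionAt U p)

/-- The outer unit normal `𝒩` of `U` with respect to `g` at a boundary point `p` at which the
boundary is timelike: the normalized Minkowski gradient of a defining function. It does not
depend on the defining function, by `exists_pos_fderiv_eq_smul` below. -/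
def normal (U : Set (Spacetime n)) (p : Spacetime n) : Spacetime n :=
  (√(metric (grad (definingFunction U p) p) (grad (definingFunction U p) p)))⁻¹ •
    grad (definingFunction U p) p

/-- The density, with respect to the Euclidean surface measure, of the volume measure that `g`
induces on a timelike boundary. The volume form of the boundary is the contraction of the volume
form of `g` with `𝒩`, so this density is the Euclidean inner product of `𝒩` with the Euclidean
outer unit normal `ν = (ν^t, ν^x)`. As `𝒩 = κ⁻¹ (-ν^t, ν^x)` with `κ = (|ν^x|² - (ν^t)²)^{1/2}`,
it is equal to `κ = |𝒩|⁻¹`, where `|·|` is the Euclidean norm. -/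
def areaDensity (U : Set (Spacetime n)) (p : Spacetime n) : ℝ := ‖normal U p‖⁻¹

/-- Integration over the part `S` of the boundary of `U` with respect to the volume measure
induced by `g`. -/
def boundaryIntegral (U S : Set (Spacetime n)) (h : Spacetime n → ℝ) : ℝ :=
  ∫ p in S, areaDensity U p * h p ∂μHE[n]

/-- Integrability over the part `S` of the boundary of `U` with respect to the volume measure
induced by `g`. -/
def BoundaryIntegrable (U S : Set (Spacetime n)) (h : Spacetime n → ℝ) : Prop :=
  IntegrableOn (fun p => areaDensity U p * h p) S μHE[n]

/-- Generalized timelike cylinders. -/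
structure IsGTC (U : Set (Spacetime n)) : Prop where
  /-- The boundary is a smooth hypersurface, with `U` on one side of it. -/
  smooth_boundary : ∀ p ∈ frontier U, ∃ ρ, IsDefiningFunctionAt U p ρ
  /-- The boundary is timelike: its conormal is spacelike. -/
  timelike_boundary : ∀ p ∈ frontier U, ∀ ρ, IsDefiningFunctionAt U p ρ →
    0 < metric (grad ρ p) (grad ρ p)
  slice_nonempty : ∀ τ : ℝ, {y | ∃ p ∈ U, time p = τ ∧ space p = y}.Nonempty
  slice_bounded : ∀ τ : ℝ, Bornology.IsBounded {y | ∃ p ∈ U, time p = τ ∧ space p = y}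
  slice_open : ∀ τ : ℝ, IsOpen {y | ∃ p ∈ U, time p = τ ∧ space p = y}
  /-- There is a smooth future-directed timelike vector field on the closure of `U`, tangent to
  the boundary. -/
  generator : ∃ Z : Spacetime n → Spacetime n, ContDiffOn ℝ ∞ Z (closure U) ∧
    (∀ p ∈ closure U, metric (Z p) (Z p) < 0 ∧ 0 < Z p 0) ∧
    ∀ p ∈ frontier U, metric (Z p) (normal U p) = 0

/-- The derivative `𝒩 h` at a boundary point of `U`, for a function `h` that is `C¹` on the
closure of `U`. -/
def normalDeriv (U : Set (Spacetime n)) (h : Spacetime n → ℝ) (p : Spacetime n) : ℝ :=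
  fderivWithin ℝ h (closure U) p (normal U p)

/-- The factor `(1 - ε r_P) 𝒩 f_P + ε f_P 𝒩 r_P` of the boundary term. -/
def boundaryFactor (U : Set (Spacetime n)) (P : Spacetime n) (ε : ℝ) (p : Spacetime n) : ℝ :=
  (1 - ε * rP P p) * fderiv ℝ (fP P) p (normal U p) +
    ε * fP P p * fderiv ℝ (rP P) p (normal U p)

/-- The first-order quantity `|u_P ∂_{u_P} h|² + |v_P ∂_{v_P} h|² + f_P g^{ab} ∇̸_a h ∇̸_b h`. -/
def firstOrder (P : Spacetime n) (h : Spacetime n → ℝ) (p : Spacetime n) : ℝ :=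
  |uP P p * dU P h p| ^ 2 + |vP P p * dV P h p| ^ 2 + fP P p * angGradSq P h p

theorem IsDefiningFunctionAt.eq_zero {U : Set (Spacetime n)} {p : Spacetime n}
    (hp : p ∈ frontier U) {ρ : Spacetime n → ℝ} (hρ : IsDefiningFunctionAt U p ρ) : ρ p = 0 := by
  have hc : ContinuousAt ρ p := hρ.smooth.continuous.continuousAt
  rcases lt_trichotomy (ρ p) 0 with h | h | h
  · have h1 : U ∈ 𝓝 p := by
      filter_upwards [hρ.eventually_mem_iff, hc.eventually_lt_const h] with q hq hq'
      exact hq.2 hq'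
    exact absurd (mem_interior_iff_mem_nhds.2 h1) hp.2
  · exact h
  · have h1 : Uᶜ ∈ 𝓝 p := by
      filter_upwards [hρ.eventually_mem_iff, hc.eventually_const_lt h] with q hq hq'
      exact fun hU => lt_asymm hq' (hq.1 hU)
    obtain ⟨q, hq, hq'⟩ := mem_closure_iff_nhds.1 hp.1 _ h1
    exact absurd hq' hq

theorem IsDefiningFunctionAt.fderiv_nonpos {U : Set (Spacetime n)} {p : Spacetime n}
    (hp : p ∈ frontier U) {ρ σ : Spacetime n → ℝ} (hρ : IsDefiningFunctionAt U p ρ)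
    (hσ : IsDefiningFunctionAt U p σ) (w : Spacetime n) (hw : fderiv ℝ ρ p w < 0) :
    fderiv ℝ σ p w ≤ 0 := by
  have hd : ∀ τ : Spacetime n → ℝ, IsDefiningFunctionAt U p τ →
      HasDerivAt (fun s : ℝ => τ (p + s • w)) (fderiv ℝ τ p w) 0 := by
    intro τ hτ
    have h1 : HasFDerivAt τ (fderiv ℝ τ p) p :=
      (hτ.smooth.differentiable (by simp) p).hasFDerivAt
    exact h1.hasLineDerivAt w
  have hl : Tendsto (fun s : ℝ => p + s • w) (𝓝[>] 0) (𝓝 p) := by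
    have h1 : ContinuousAt (fun s : ℝ => p + s • w) 0 := by fun_prop
    have h2 := h1.tendsto
    simp only [zero_smul, add_zero] at h2
    exact h2.mono_left nhdsWithin_le_nhds
  have h0 := (hd ρ hρ).hasDerivWithinAt (s := Ioi 0)
  have h1 := (hasDerivWithinAt_iff_tendsto_slope' (by simp)).1 h0
  have h2 := (hasDerivWithinAt_iff_tendsto_slope' (by simp)).1
    ((hd σ hσ).hasDerivWithinAt (s := Ioi 0))
  refine le_of_tendsto h2 ?_
  filter_upwards [h1.eventually_lt_const hw, hl.eventually hρ.eventually_mem_iff,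
    hl.eventually hσ.eventually_mem_iff, self_mem_nhdsWithin] with s hs hs1 hs2 hs3
  have hs3' : (0 : ℝ) < s := hs3
  simp only [slope_def_field, zero_smul, add_zero, sub_zero, hρ.eq_zero hp, hσ.eq_zero hp]
    at hs ⊢
  have h3 : ρ (p + s • w) < 0 := by
    by_contra h
    exact absurd hs (not_lt.2 (div_nonneg (not_lt.1 h) hs3'.le))
  exact div_nonpos_of_nonpos_of_nonneg (hs2.1 (hs1.2 h3)).le hs3'.le

/-- Differentials of two defining functions at a boundary point are positive multiples of each
other, so that `normal` is well defined. -/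
theorem exists_pos_fderiv_eq_smul {U : Set (Spacetime n)} {p : Spacetime n}
    (hp : p ∈ frontier U) {ρ σ : Spacetime n → ℝ} (hρ : IsDefiningFunctionAt U p ρ)
    (hσ : IsDefiningFunctionAt U p σ) : ∃ c : ℝ, 0 < c ∧ fderiv ℝ σ p = c • fderiv ℝ ρ p := by
  have key := IsDefiningFunctionAt.fderiv_nonpos hp hρ hσ
  obtain ⟨w, hw⟩ : ∃ w, fderiv ℝ ρ p w < 0 := by
    by_contra! h
    refine hρ.fderiv_ne_zero (ContinuousLinearMap.ext fun w => le_antisymm ?_ (h w))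
    have := h (-w)
    simp only [map_neg] at this
    simpa using this
  have hker : ∀ x, fderiv ℝ ρ p x = 0 → fderiv ℝ σ p x ≤ 0 := by
    intro x hx
    have h1 : Tendsto (fun δ : ℝ => fderiv ℝ σ p x + δ * fderiv ℝ σ p w) (𝓝[>] 0)
        (𝓝 (fderiv ℝ σ p x + 0 * fderiv ℝ σ p w)) := by
      refine Tendsto.mono_left ?_ nhdsWithin_le_nhds
      exact ContinuousAt.tendsto (f := fun δ : ℝ => fderiv ℝ σ p x + δ * fderiv ℝ σ p w)
        (by fun_prop)
    rw [zero_mul, add_zero] at h1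
    refine le_of_tendsto h1 ?_
    filter_upwards [self_mem_nhdsWithin] with δ hδ
    have h2 := key (x + δ • w) (by
      simp only [map_add, map_smul, hx, smul_eq_mul, zero_add]
      exact mul_neg_of_pos_of_neg hδ hw)
    simpa using h2
  have hker0 : ∀ x, fderiv ℝ ρ p x = 0 → fderiv ℝ σ p x = 0 := fun x hx =>
    le_antisymm (hker x hx) (by simpa using hker (-x) (by simp [hx]))
  have heq : fderiv ℝ σ p = (fderiv ℝ σ p w / fderiv ℝ ρ p w) • fderiv ℝ ρ p := by
    ext x
    have h1 := hker0 (x - (fderiv ℝ ρ p x / fderiv ℝ ρ p w) • w) (by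
      simp [div_mul_cancel₀ _ hw.ne])
    simp only [map_sub, map_smul, smul_eq_mul] at h1
    simp only [smul_apply, smul_eq_mul]
    rw [sub_eq_zero.1 h1]
    ring
  refine ⟨_, lt_of_le_of_ne (div_nonneg_of_nonpos (key w hw) hw.le) ?_, heq⟩
  intro h0
  rw [← h0, zero_smul] at heq
  exact hσ.fderiv_ne_zero heq

end Mink

end

/-! The proof is a conjugation and multiplier argument. Put D = (1 + εu)(1 - εv) = 1 - εr + ε²f, y =
√(f/D), E = √ζ and ψ = Eφ. Then dE = E G σ with σ = (1 - εr) df + εf dr = D² d(f/D) and G = a(1 +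
by)/(fD). The vector field S dual to σ (`multiplier`) is the multiplier of the estimate, and it is
also the field whose normal component is the factor in the boundary term. In terms of ψ the equation
reads □ψ = E□φ + 2G Sψ + (zeroth order), and pairing it with M = Sψ + qψ produces the square 2GM².
One half of this square absorbs E□φ, at the price of the term ζf|□φ|²/(4a).

Positivity of the first-order terms comes from ε. The deformation tensor of S is (1 - εr)/2 times
the metric plus an angular part with coefficient εf/r (`deformation_multiplier`); for ε = 0 the
field is conformal and nothing is gained. The choice of q leaves (εf/2r)(|∇̸ψ|² + ∂_uψ ∂_vψ). Since
f = -uv, the mixed product is -(ε/2r)(u∂_uψ)(v∂_vψ), which is a sum of squares up to a multiple of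
(Sψ)², and the latter is absorbed by the other half of 2GM². The exponential factor of the weight
gives ψ² a coefficient of size a²b/y (`zeroth_order_lower_bound`), which absorbs all remaining
errors because ε is small against b. The result is the pointwise inequality `pointwise_carleman` for
the divergence of a current J.

It remains to integrate. On ∂U the function φ vanishes, so dφ is a multiple of the conormal, and the
flux of J is exactly half of the boundary integrand (`areaDensity_mul_boundaryTerm`). On the null
cone of P no boundary term appears: E/f is bounded, hence J = O(f) (`Confined.jetCurrent_div_bdd`),
and cutoffs in f at scale 1/m contribute an error that tends to zero.

As φ is only C¹ up to ∂U, the divergence of J is only integrable on the regions kept by the cutoffs.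
`integral_divergence` is therefore proved for fields that are continuous up to the boundary. The
field is cut off in layers -2δ ≤ ρ ≤ -δ below a defining function ρ, and the limits of the layer
integrals are compared with surface integrals in charts that distort Hausdorff measures by a factor
C; partitions of unity and C → 1 remove the error. -/

noncomputable section

/-! ### Integrals over hyperplanes as limits of integrals over thin layers. -/

section Hyperplane

variable {V : Type*} [NormedAddCommGroup V] [InnerProductSpace ℝ V] [FiniteDimensional ℝ V]
  [MeasurableSpace V] [BorelSpace V]

/-- The orthogonal decomposition of `V` along a unit vector, based at a point. -/
def unitDecomposition (e : V) (he : ‖e‖ = 1) (p : V) : ℝ × (ℝ ∙ e)ᗮ ≃ᵐ V :=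
  ((LinearIsometryEquiv.toSpanUnitSingleton e he).toMeasurableEquiv.prodCongr
    (MeasurableEquiv.refl _)).trans ((ℝ ∙ e).measurableEquivProd p).symm

theorem unitDecomposition_apply (e : V) (he : ‖e‖ = 1) (p : V) (z : ℝ × (ℝ ∙ e)ᗮ) :
    unitDecomposition e he p z = p + z.1 • e + z.2 := by
  have : unitDecomposition e he p z = ((ℝ ∙ e).measurableEquivProd p).symm
      (LinearIsometryEquiv.toSpanUnitSingleton e he z.1, z.2) := rfl
  rw [this, Submodule.measurableEquivProd_symm_apply]
  simp [LinearIsometryEquiv.toSpanUnitSingleton_apply]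
  abel

theorem measurePreserving_unitDecomposition (e : V) (he : ‖e‖ = 1) (p : V) :
    MeasurePreserving (unitDecomposition e he p) := by
  have h1 := ((ℝ ∙ e).measurePreserving_measurableEquivProd p).symm
  rw [InnerProductSpace.euclideanHausdorffMeasure_eq_volume] at h1
  refine h1.comp (?_ : MeasurePreserving (Prod.map (LinearIsometryEquiv.toSpanUnitSingleton e he) id)
    volume volume)
  exact (LinearIsometryEquiv.measurePreserving _).prod (MeasurePreserving.id _)

theorem integral_eq_integral_unitDecomposition (e : V) (he : ‖e‖ = 1) (p : V) (g : V → ℝ) :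
    ∫ x, g x = ∫ z : ℝ × (ℝ ∙ e)ᗮ, g (p + z.1 • e + z.2) := by
  rw [← (measurePreserving_unitDecomposition e he p).integral_comp
    (unitDecomposition e he p).measurableEmbedding]
  simp_rw [unitDecomposition_apply]

theorem setIntegral_hyperplane (e : V) (he : ‖e‖ = 1) (p : V) {n : ℕ}
    (hn : Module.finrank ℝ V = n + 1) (g : V → ℝ) :
    ∫ x in {x | inner ℝ e (x - p) = 0}, g x ∂μHE[n] = ∫ y : (ℝ ∙ e)ᗮ, g (p + y) := by
  have hiso : Isometry (fun y : (ℝ ∙ e)ᗮ => p + (y : V)) :=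
    (isometry_add_left p).comp isometry_subtype_coe
  have hr : Set.range (fun y : (ℝ ∙ e)ᗮ => p + (y : V)) = {x | inner ℝ e (x - p) = 0} := by
    ext x
    simp only [Set.mem_range, Set.mem_ofPred_eq]
    constructor
    · rintro ⟨y, rfl⟩
      have := Submodule.mem_orthogonal_singleton_iff_inner_right.1 y.2
      simpa using this
    · intro h
      exact ⟨⟨x - p, Submodule.mem_orthogonal_singleton_iff_inner_right.2 h⟩, by simp⟩
  have hf : Module.finrank ℝ (ℝ ∙ e)ᗮ = n := by
    have h1 := (ℝ ∙ e).finrank_add_finrank_orthogonal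
    rw [finrank_span_singleton (by rintro rfl; simp at he), hn] at h1
    omega
  rw [← hr, ← hiso.map_euclideanHausdorffMeasure,
    hiso.isClosedEmbedding.measurableEmbedding.integral_map]
  have := InnerProductSpace.euclideanHausdorffMeasure_eq_volume (V := (ℝ ∙ e)ᗮ)
  rw [hf] at this
  rw [this]

omit [FiniteDimensional ℝ V] [MeasurableSpace V] [BorelSpace V] in
theorem norm_orthogonal_le (e p x : V) (y : (ℝ ∙ e)ᗮ) (s : ℝ) (hx : x = p + s • e + y) :
    ‖(y : V)‖ ≤ ‖x - p‖ := by
  have h0 := Submodule.mem_orthogonal_singleton_iff_inner_right.1 y.2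
  have h1 : x - p = s • e + (y : V) := by rw [hx]; abel
  rw [h1]
  have h2 : ‖s • e + (y : V)‖ * ‖s • e + (y : V)‖ = ‖s • e‖ * ‖s • e‖ + ‖(y : V)‖ * ‖(y : V)‖ :=
    norm_add_sq_eq_norm_sq_add_norm_sq_of_inner_eq_zero _ _ (by rw [real_inner_smul_left, h0, mul_zero])
  nlinarith [norm_nonneg (s • e + (y : V)), norm_nonneg (y : V), mul_self_nonneg ‖s • e‖]

/-- Fubini along e and the substitution s ↦ δs turn the layer integral into ∫ κ(s) F(p + δs e + y),
which is continuous in δ up to δ = 0, where it factorizes. -/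
theorem tendsto_integral_hyperplane (e : V) (he : ‖e‖ = 1) (p : V) {n : ℕ}
    (hn : Module.finrank ℝ V = n + 1) {κ : ℝ → ℝ} (hκ : Continuous κ) (hκs : HasCompactSupport κ)
    {F : V → ℝ} (hF : Continuous F) (hFs : HasCompactSupport F) :
    Tendsto (fun δ : ℝ => ∫ x, δ⁻¹ * κ (inner ℝ e (x - p) / δ) * F x) (𝓝[>] 0)
      (𝓝 ((∫ s, κ s) * ∫ x in {x | inner ℝ e (x - p) = 0}, F x ∂μHE[n])) := by
  obtain ⟨R, hR⟩ := hFs.isCompact.isBounded.subset_closedBall p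
  have hF0 : ∀ (y : (ℝ ∙ e)ᗮ) (s : ℝ), y ∉ Metric.closedBall (0 : (ℝ ∙ e)ᗮ) R →
      F (p + s • e + y) = 0 := by
    intro y s hy
    by_contra h
    have h1 := hR (subset_tsupport _ h)
    rw [mem_closedBall_iff_norm] at h1
    apply hy
    rw [mem_closedBall_zero_iff]
    exact (norm_orthogonal_le e p _ y s rfl).trans h1
  have hinner : ∀ (s : ℝ) (y : (ℝ ∙ e)ᗮ), inner ℝ e (p + s • e + (y : V) - p) = s := by
    intro s y
    have h0 := Submodule.mem_orthogonal_singleton_iff_inner_right.1 y.2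
    have : p + s • e + (y : V) - p = s • e + y := by abel
    rw [this, inner_add_right, h0, real_inner_smul_right, real_inner_self_eq_norm_sq, he]
    simp
  set K : Set (ℝ × (ℝ ∙ e)ᗮ) := tsupport κ ×ˢ Metric.closedBall 0 R with hK
  have hKc : IsCompact K := hκs.isCompact.prod (isCompact_closedBall _ _)
  let Φ : ℝ → ℝ := fun δ => ∫ z in K, κ z.1 * F (p + (δ * z.1) • e + z.2)
  have hΦ : Continuous Φ := by
    apply continuous_parametric_integral_of_continuous (f := fun δ (z : ℝ × (ℝ ∙ e)ᗮ) =>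
      κ z.1 * F (p + (δ * z.1) • e + z.2)) _ hKc
    simp only [Function.uncurry_def]
    fun_prop
  have hΦ' : ∀ δ, Φ δ = ∫ z : ℝ × (ℝ ∙ e)ᗮ, κ z.1 * F (p + (δ * z.1) • e + z.2) := by
    intro δ
    apply setIntegral_eq_integral_of_forall_compl_eq_zero
    rintro ⟨s, y⟩ hz
    simp only [hK, Set.mem_prod, not_and_or] at hz
    rcases hz with hz | hz
    · simp [image_eq_zero_of_notMem_tsupport hz]
    · simp [hF0 y _ hz]
  have hcs : ∀ δ, HasCompactSupport (fun z : ℝ × (ℝ ∙ e)ᗮ => κ z.1 * F (p + (δ * z.1) • e + z.2)) := by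
    intro δ
    refine HasCompactSupport.intro hKc ?_
    rintro ⟨s, y⟩ hz
    simp only [hK, Set.mem_prod, not_and_or] at hz
    rcases hz with hz | hz
    · simp [image_eq_zero_of_notMem_tsupport hz]
    · simp [hF0 y _ hz]
  have h0 : Φ 0 = (∫ s, κ s) * ∫ x in {x | inner ℝ e (x - p) = 0}, F x ∂μHE[n] := by
    rw [hΦ', setIntegral_hyperplane e he p hn]
    simp only [zero_mul, zero_smul, add_zero]
    exact integral_prod_mul κ (fun y : (ℝ ∙ e)ᗮ => F (p + y))
  have hpos : ∀ δ : ℝ, 0 < δ → ∫ x, δ⁻¹ * κ (inner ℝ e (x - p) / δ) * F x = Φ δ := by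
    intro δ hδ
    rw [integral_eq_integral_unitDecomposition e he p, hΦ']
    simp_rw [hinner]
    rw [Measure.volume_eq_prod, integral_prod_symm, integral_prod_symm]
    · congr 1
      ext y
      have := Measure.integral_comp_div (fun s => δ⁻¹ * κ s * F (p + (δ * s) • e + y)) δ
      have h2 : ∀ x : ℝ, δ * (x / δ) = x := fun x => by field_simp
      simp_rw [h2] at this
      rw [this, abs_of_pos hδ, smul_eq_mul, ← integral_const_mul]
      congr 1
      ext s
      field_simp
    · exact Continuous.integrable_of_hasCompactSupport (by fun_prop) (hcs δ)
    · apply Continuous.integrable_of_hasCompactSupport (by fun_prop)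
      have h1 : IsCompact ((fun s => δ * s) '' tsupport κ) := hκs.isCompact.image (by fun_prop)
      refine HasCompactSupport.intro (h1.prod (isCompact_closedBall (0 : (ℝ ∙ e)ᗮ) R)) ?_
      rintro ⟨s, y⟩ hz
      simp only [Set.mem_prod, not_and_or] at hz
      rcases hz with hz | hz
      · have : s / δ ∉ tsupport κ := fun h => hz ⟨s / δ, h, by field_simp⟩
        simp [image_eq_zero_of_notMem_tsupport this]
      · simp [hF0 y _ hz]
  rw [← h0]
  refine (hΦ.tendsto 0 |>.mono_left nhdsWithin_le_nhds).congr' ?_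
  filter_upwards [self_mem_nhdsWithin] with δ hδ using (hpos δ hδ).symm

end Hyperplane

/-! ### Hausdorff measures and integrals under nearly isometric maps. -/

section Comparison

/-- Integrals against mutually comparable measures are close. -/
theorem abs_integral_sub_le_of_measure_le {α : Type*} [MeasurableSpace α] {μ ν : Measure α}
    {C : NNReal} (hC : 1 ≤ C) (h1 : μ ≤ C • ν) (h2 : ν ≤ C • μ) {F : α → ℝ}
    (hF : Integrable F ν) :
    |∫ x, F x ∂μ - ∫ x, F x ∂ν| ≤ (C - 1) * ∫ x, |F x| ∂ν := by
  have hFμ : Integrable F μ := (hF.smul_measure_nnreal).mono_measure h1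
  -- The comparison of measures passes to integrals of nonnegative functions only. Positive and
  -- negative parts are treated separately, and their errors add up to a multiple of ∫ |F|.
  have key : ∀ G : α → ℝ, (∀ x, 0 ≤ G x) → Integrable G ν → Integrable G μ →
      |∫ x, G x ∂μ - ∫ x, G x ∂ν| ≤ (C - 1) * ∫ x, G x ∂ν := by
    intro G h0 hG hG'
    have a1 : ∫ x, G x ∂μ ≤ C * ∫ x, G x ∂ν := by
      have := integral_mono_measure h1 (Eventually.of_forall h0) hG.smul_measure_nnreal
      rwa [integral_smul_nnreal_measure] at this
    have a2 : ∫ x, G x ∂ν ≤ C * ∫ x, G x ∂μ := by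
      have := integral_mono_measure h2 (Eventually.of_forall h0) hG'.smul_measure_nnreal
      rwa [integral_smul_nnreal_measure] at this
    have a3 : 0 ≤ ∫ x, G x ∂ν := integral_nonneg h0
    have a4 : 0 ≤ ∫ x, G x ∂μ := integral_nonneg h0
    have hC' : (1 : ℝ) ≤ C := by exact_mod_cast hC
    rw [abs_le]
    constructor <;> nlinarith
  have p1 := key (fun x => max (F x) 0) (fun x => le_max_right _ _) hF.pos_part hFμ.pos_part
  have p2 := key (fun x => max (-F x) 0) (fun x => le_max_right _ _) hF.neg_part hFμ.neg_part
  have d1 : ∀ x, F x = max (F x) 0 - max (-F x) 0 := fun x => (posPart_sub_negPart (F x)).symm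
  have d2 : ∀ x, |F x| = max (F x) 0 + max (-F x) 0 := fun x => (posPart_add_negPart (F x)).symm
  have e1 : ∫ x, F x ∂μ = ∫ x, max (F x) 0 ∂μ - ∫ x, max (-F x) 0 ∂μ := by
    rw [← integral_sub hFμ.pos_part hFμ.neg_part]; exact integral_congr_ae (Eventually.of_forall d1)
  have e2 : ∫ x, F x ∂ν = ∫ x, max (F x) 0 ∂ν - ∫ x, max (-F x) 0 ∂ν := by
    rw [← integral_sub hF.pos_part hF.neg_part]; exact integral_congr_ae (Eventually.of_forall d1)
  have e3 : ∫ x, |F x| ∂ν = ∫ x, max (F x) 0 ∂ν + ∫ x, max (-F x) 0 ∂ν := by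
    rw [← integral_add hF.pos_part hF.neg_part]; exact integral_congr_ae (Eventually.of_forall d2)
  rw [e1, e2, e3]
  rw [abs_le] at p1 p2 ⊢
  constructor <;> linarith [p1.1, p1.2, p2.1, p2.2]

variable {X Y : Type*} [EMetricSpace X] [MeasurableSpace X] [BorelSpace X]
  [EMetricSpace Y] [MeasurableSpace Y] [BorelSpace Y]

theorem LipschitzOnWith.euclideanHausdorffMeasure_image_le {K : NNReal} {f : X → Y} {s : Set X}
    (h : LipschitzOnWith K f s) (d : ℕ) : μHE[d] (f '' s) ≤ (K ^ d : NNReal) • μHE[d] s := by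
  simp_rw [Measure.euclideanHausdorffMeasure_def, Measure.smul_apply]
  rw [smul_comm]
  gcongr
  have := h.hausdorffMeasure_image_le (d := d) (by positivity)
  simpa [ENNReal.smul_def] using this

theorem euclideanHausdorffMeasure_le_image {K : NNReal} {f : X → Y} {s : Set X}
    (h : AntilipschitzWith K (s.domRestrict f)) (d : ℕ) :
    μHE[d] s ≤ (K ^ d : NNReal) • μHE[d] (f '' s) := by
  simp_rw [Measure.euclideanHausdorffMeasure_def, Measure.smul_apply]
  rw [smul_comm]
  gcongr
  have := h.le_hausdorffMeasure_image (d := d) (by positivity) univ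
  rw [image_univ, Set.range_domRestrict] at this
  rw [← (isometry_subtype_coe (s := s)).hausdorffMeasure_image (Or.inl (by positivity))] at this
  simpa [ENNReal.smul_def] using this

end Comparison

end

noncomputable section

section ComparisonMap

variable {X Y : Type*} [EMetricSpace X] [MeasurableSpace X] [BorelSpace X]
  [EMetricSpace Y] [MeasurableSpace Y] [BorelSpace Y]

theorem map_restrict_euclideanHausdorffMeasure_le {K : NNReal} {f : X → Y} (hf : Measurable f)
    {s : Set X} (h : AntilipschitzWith K (s.domRestrict f)) (d : ℕ) :
    (μHE[d].restrict s).map f ≤ (K ^ d : NNReal) • μHE[d].restrict (f '' s) := by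
  refine Measure.le_iff.2 fun B hB => ?_
  rw [Measure.map_apply hf hB, Measure.restrict_apply (hf hB), Measure.smul_apply,
    Measure.restrict_apply hB]
  have h1 : AntilipschitzWith K ((f ⁻¹' B ∩ s).domRestrict f) := fun x y =>
    h ⟨x, x.2.2⟩ ⟨y, y.2.2⟩
  refine (euclideanHausdorffMeasure_le_image h1 d).trans ?_
  gcongr
  rintro _ ⟨x, hx, rfl⟩
  exact ⟨hx.1, mem_image_of_mem f hx.2⟩

theorem restrict_image_euclideanHausdorffMeasure_le {K : NNReal} {f : X → Y} (hf : Measurable f)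
    {s : Set X} (h : LipschitzOnWith K f s) (d : ℕ) :
    μHE[d].restrict (f '' s) ≤ (K ^ d : NNReal) • (μHE[d].restrict s).map f := by
  refine Measure.le_iff.2 fun B hB => ?_
  rw [Measure.smul_apply, Measure.map_apply hf hB, Measure.restrict_apply (hf hB),
    Measure.restrict_apply hB]
  refine le_trans (measure_mono ?_) ((h.mono inter_subset_right).euclideanHausdorffMeasure_image_le d)
  rintro _ ⟨hx, x, hx', rfl⟩
  exact ⟨x, ⟨hx, hx'⟩, rfl⟩

end ComparisonMap

/-! ### Charts that flatten a regular level set and are nearly isometric at the base point. -/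

section Chart

variable {V : Type*} [NormedAddCommGroup V] [InnerProductSpace ℝ V] [FiniteDimensional ℝ V]
  [MeasurableSpace V] [BorelSpace V]

/-- A chart that flattens the level set of `ρ` through `p`. -/
def flatten (ρ : V → ℝ) (e p : V) (x : V) : V := x + (ρ x - inner ℝ e (x - p)) • e

omit [FiniteDimensional ℝ V] [MeasurableSpace V] [BorelSpace V] in
theorem inner_flatten (ρ : V → ℝ) {e : V} (he : ‖e‖ = 1) (p x : V) :
    inner ℝ e (flatten ρ e p x - p) = ρ x := by
  have : flatten ρ e p x - p = (x - p) + (ρ x - inner ℝ e (x - p)) • e := by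
    unfold flatten; abel
  rw [this, inner_add_right, real_inner_smul_right, real_inner_self_eq_norm_sq, he]
  ring

-- The correction ρ(x) - ⟨e, x - p⟩ has zero differential at p, so the chart has the identity as
-- strict derivative there. This is what brings its bi-Lipschitz constants close to 1.
omit [FiniteDimensional ℝ V] [MeasurableSpace V] [BorelSpace V] in
theorem hasStrictFDerivAt_flatten {ρ : V → ℝ} {e p : V}
    (h : HasStrictFDerivAt ρ (innerSL ℝ e) p) :
    HasStrictFDerivAt (flatten ρ e p) (ContinuousLinearEquiv.refl ℝ V : V →L[ℝ] V) p := by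
  have h1 : HasStrictFDerivAt (fun x => inner ℝ e (x - p)) (innerSL ℝ e) p := by
    have := (innerSL ℝ e).hasStrictFDerivAt.comp p ((hasStrictFDerivAt_id p).sub_const p)
    simpa [Function.comp_def] using this
  have h2 : HasStrictFDerivAt (flatten ρ e p) _ p :=
    (hasStrictFDerivAt_id p).add ((h.sub h1).smul_const e)
  convert h2 using 1
  ext x
  simp

/-- Near a point of a regular level set, a flattening chart distorts Hausdorff measures by at most
a prescribed factor. -/
theorem exists_flatten_chart [Nontrivial V] {ρ : V → ℝ} {e p : V} (hρ : Continuous ρ)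
    (h : HasStrictFDerivAt ρ (innerSL ℝ e) p) {C : NNReal} (hC : 1 < C) (N : ℕ) :
    ∃ Ψ : OpenPartialHomeomorph V V, p ∈ Ψ.source ∧ (∀ x, Ψ x = flatten ρ e p x) ∧
      Continuous Ψ ∧ ∀ d ≤ N, ∀ s ⊆ Ψ.source,
        (μHE[d].restrict s).map Ψ ≤ C • μHE[d].restrict (Ψ '' s) ∧
        μHE[d].restrict (Ψ '' s) ≤ C • (μHE[d].restrict s).map Ψ := by
  have hn1 : ‖((ContinuousLinearEquiv.refl ℝ V).symm : V →L[ℝ] V)‖₊ = 1 := by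
    have : ((ContinuousLinearEquiv.refl ℝ V).symm : V →L[ℝ] V) = ContinuousLinearMap.id ℝ V := rfl
    rw [this]
    ext
    simp
  have hn2 : ‖(ContinuousLinearEquiv.refl ℝ V : V →L[ℝ] V)‖₊ = 1 := hn1
  -- A map within c of the identity is Lipschitz with constant 1 + c and antilipschitz with constant
  -- (1 - c)⁻¹. The d-dimensional measure changes by at most the d-th power of these, so a single c
  -- serves all d ≤ N.
  obtain ⟨c, hc0, hc1, hcL, hcA⟩ : ∃ c : NNReal, 0 < c ∧ c < 1 ∧ (1 + c) ^ N ≤ C ∧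
      ((1 - c)⁻¹) ^ N ≤ C := by
    have t1 : ∀ᶠ x : ℝ in 𝓝 0, (1 + x) ^ N < (C : ℝ) := by
      have : ContinuousAt (fun x : ℝ => (1 + x) ^ N) 0 := by fun_prop
      apply this.eventually_lt_const
      simpa using hC
    have t2 : ∀ᶠ x : ℝ in 𝓝 0, ((1 - x)⁻¹) ^ N < (C : ℝ) := by
      have : ContinuousAt (fun x : ℝ => ((1 - x)⁻¹) ^ N) 0 := by
        refine ContinuousAt.pow (ContinuousAt.inv₀ (by fun_prop) (by simp)) N
      apply this.eventually_lt_const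
      simpa using hC
    obtain ⟨x, ⟨hx1, hx2⟩, hx0, hx3⟩ := (((t1.and t2).filter_mono nhdsWithin_le_nhds).and
      (Ioo_mem_nhdsGT (zero_lt_one' ℝ))).exists
    lift x to NNReal using hx0.le
    refine ⟨x, by exact_mod_cast hx0, by exact_mod_cast hx3, ?_, ?_⟩
    · rw [← NNReal.coe_le_coe]; push_cast; exact hx1.le
    · rw [← NNReal.coe_le_coe]; push_cast
      rw [NNReal.coe_sub (by exact_mod_cast hx3.le)]
      exact hx2.le
  obtain ⟨s, hs, hap⟩ := (hasStrictFDerivAt_flatten h).approximates_deriv_on_nhds (c := c) (Or.inr hc0)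
  obtain ⟨W, hWs, hWo, hpW⟩ := mem_nhds_iff.1 hs
  have hap' := hap.mono_set hWs
  have hcond : Subsingleton V ∨
      c < ‖((ContinuousLinearEquiv.refl ℝ V).symm : V →L[ℝ] V)‖₊⁻¹ := by
    right; rw [hn1]; simpa using hc1
  have hcont : Continuous (flatten ρ e p) := by unfold flatten; fun_prop
  have hA := hap'.antilipschitz hcond
  have hL := hap'.lipschitz
  rw [hn1] at hA
  rw [hn2] at hL
  refine ⟨hap'.toOpenPartialHomeomorph _ W hcond hWo, hpW, fun x => rfl, hcont, ?_⟩
  intro d hd t ht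
  have hcA' : ((1⁻¹ - c)⁻¹) ^ d ≤ C := by
    refine le_trans (pow_le_pow_right₀ ?_ hd) (by simpa using hcA)
    rw [one_le_inv₀ (by simpa using hc1)]
    simp
  have hcL' : (1 + c) ^ d ≤ C := le_trans (pow_le_pow_right₀ (by simp) hd) hcL
  constructor
  · refine (map_restrict_euclideanHausdorffMeasure_le (f := flatten ρ e p) hcont.measurable
      (s := t) (K := (1⁻¹ - c)⁻¹) (fun x y => hA ⟨x, ht x.2⟩ ⟨y, ht y.2⟩) d).trans ?_
    refine Measure.le_iff.2 fun B hB => ?_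
    simp only [Measure.smul_apply]
    gcongr
    rfl
  · refine (restrict_image_euclideanHausdorffMeasure_le (f := flatten ρ e p) hcont.measurable
      (s := t) (K := 1 + c) (fun x hx y hy => hL ⟨x, ht hx⟩ ⟨y, ht hy⟩) d).trans ?_
    refine Measure.le_iff.2 fun B hB => ?_
    simp only [Measure.smul_apply]
    gcongr
    rfl

theorem integrableOn_hyperplane (e : V) (he : ‖e‖ = 1) (p : V) {n : ℕ}
    (hn : Module.finrank ℝ V = n + 1) {g : V → ℝ} (hg : Continuous g) (hgs : HasCompactSupport g) :
    IntegrableOn g {x | inner ℝ e (x - p) = 0} μHE[n] := by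
  have hiso : Isometry (fun y : (ℝ ∙ e)ᗮ => p + (y : V)) :=
    (isometry_add_left p).comp isometry_subtype_coe
  have hr : Set.range (fun y : (ℝ ∙ e)ᗮ => p + (y : V)) = {x | inner ℝ e (x - p) = 0} := by
    ext x
    simp only [Set.mem_range, Set.mem_ofPred_eq]
    constructor
    · rintro ⟨y, rfl⟩
      have := Submodule.mem_orthogonal_singleton_iff_inner_right.1 y.2
      simpa using this
    · intro h
      exact ⟨⟨x - p, Submodule.mem_orthogonal_singleton_iff_inner_right.2 h⟩, by simp⟩
  have hf : Module.finrank ℝ (ℝ ∙ e)ᗮ = n := by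
    have h1 := (ℝ ∙ e).finrank_add_finrank_orthogonal
    rw [finrank_span_singleton (by rintro rfl; simp at he), hn] at h1
    omega
  rw [IntegrableOn, ← hr, ← hiso.map_euclideanHausdorffMeasure,
    hiso.isClosedEmbedding.measurableEmbedding.integrable_map_iff]
  have := InnerProductSpace.euclideanHausdorffMeasure_eq_volume (V := (ℝ ∙ e)ᗮ)
  rw [hf] at this
  rw [this]
  exact (hg.comp hiso.continuous).integrable_of_hasCompactSupport
    (hgs.comp_isClosedEmbedding hiso.isClosedEmbedding)

/-- A continuous function with compact support in the source of a chart, transported by it. -/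
theorem exists_transport {V : Type*} [TopologicalSpace V] [T2Space V]
    (Ψ : OpenPartialHomeomorph V V) {F : V → ℝ} (hF : Continuous F)
    (hFs : HasCompactSupport F) (hsub : tsupport F ⊆ Ψ.source) :
    ∃ G : V → ℝ, Continuous G ∧ HasCompactSupport G ∧ (∀ x ∈ Ψ.source, G (Ψ x) = F x) ∧
      ∀ y ∉ Ψ.target, G y = 0 := by
  classical
  let G : V → ℝ := fun y => if y ∈ Ψ.target then F (Ψ.symm y) else 0
  have hK : IsCompact (Ψ '' tsupport F) :=
    hFs.isCompact.image_of_continuousOn (Ψ.continuousOn.mono hsub)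
  have hG0 : ∀ y ∉ Ψ '' tsupport F, G y = 0 := by
    intro y hy
    by_cases hyt : y ∈ Ψ.target
    · simp only [G, hyt, if_true]
      apply image_eq_zero_of_notMem_tsupport
      intro h
      exact hy ⟨_, h, Ψ.right_inv hyt⟩
    · simp [G, hyt]
  refine ⟨G, ?_, HasCompactSupport.intro hK hG0, ?_, ?_⟩
  · rw [continuous_iff_continuousAt]
    intro y
    by_cases hy : y ∈ Ψ.target
    · have : ContinuousAt (fun y => F (Ψ.symm y)) y :=
        hF.continuousAt.comp (Ψ.symm.continuousAt hy)
      refine this.congr ?_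
      filter_upwards [Ψ.open_target.mem_nhds hy] with z hz
      simp [G, hz]
    · have hy' : y ∉ Ψ '' tsupport F := by
        rintro ⟨x, hx, rfl⟩
        exact hy (Ψ.map_source (hsub hx))
      refine (continuousAt_const (y := (0 : ℝ))).congr ?_
      filter_upwards [hK.isClosed.isOpen_compl.mem_nhds hy'] with z hz
      exact (hG0 z hz).symm
  · intro x hx
    simp [G, Ψ.map_source hx, Ψ.left_inv hx]
  · intro y hy
    simp [G, hy]


/-- Comparison of integrals over a level set with limits of integrals over thin layers. -/
theorem chart_estimate {n : ℕ} (hn : Module.finrank ℝ V = n + 1) {ρ : V → ℝ} {e p : V}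
    (he : ‖e‖ = 1) (hρ : Continuous ρ) (Ψ : OpenPartialHomeomorph V V)
    (hΨ : ∀ x, Ψ x = flatten ρ e p x) (hΨc : Continuous Ψ) {C : NNReal} (hC : 1 ≤ C)
    (hm : ∀ d ≤ n + 1, ∀ s ⊆ Ψ.source,
        (μHE[d].restrict s).map Ψ ≤ C • μHE[d].restrict (Ψ '' s) ∧
        μHE[d].restrict (Ψ '' s) ≤ C • (μHE[d].restrict s).map Ψ)
    {F : V → ℝ} (hF : Continuous F) (hFs : HasCompactSupport F) (hsub : tsupport F ⊆ Ψ.source) :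
    IntegrableOn F {x ∈ Ψ.source | ρ x = 0} μHE[n] ∧
    ∀ κ : ℝ → ℝ, Continuous κ → HasCompactSupport κ → (∀ s, 0 ≤ κ s) → ∫ s, κ s = 1 → ∀ ℓ : ℝ,
      Tendsto (fun δ : ℝ => ∫ x, δ⁻¹ * κ (ρ x / δ) * F x) (𝓝[>] 0) (𝓝 ℓ) →
      |ℓ - ∫ x in {x ∈ Ψ.source | ρ x = 0}, F x ∂μHE[n]| ≤
        2 * (C - 1) * C * ∫ x in {x ∈ Ψ.source | ρ x = 0}, |F x| ∂μHE[n] := by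
  obtain ⟨G, hG, hGs, hGF, hG0⟩ := exists_transport Ψ hF hFs hsub
  set S := {x ∈ Ψ.source | ρ x = 0} with hS
  have hSm : MeasurableSet S :=
    Ψ.open_source.measurableSet.inter (hρ.measurable (measurableSet_singleton 0))
  have hin : ∀ x, inner ℝ e (Ψ x - p) = ρ x := fun x => by rw [hΨ, inner_flatten ρ he]
  set Pl : Set V := {x | inner ℝ e (x - p) = 0} with hPl
  have hSi : Ψ '' S = Ψ.target ∩ Pl := by
    ext y
    constructor
    · rintro ⟨x, hx, rfl⟩
      exact ⟨Ψ.map_source hx.1, (hin x).trans hx.2⟩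
    · rintro ⟨hy, hy'⟩
      refine ⟨Ψ.symm y, ⟨Ψ.map_target hy, ?_⟩, Ψ.right_inv hy⟩
      rw [← hin, Ψ.right_inv hy]
      exact hy'
  obtain ⟨m1, m2⟩ := hm n (by omega) S (fun x hx => hx.1)
  obtain ⟨m3, m4⟩ := hm (n + 1) le_rfl Ψ.source subset_rfl
  rw [Ψ.image_source_eq_target] at m3 m4
  rw [hSi] at m1 m2
  have hvol : (μHE[n + 1] : Measure V) = volume := by
    rw [← hn]; exact InnerProductSpace.euclideanHausdorffMeasure_eq_volume
  rw [hvol] at m3 m4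
  have hGi : IntegrableOn G Pl μHE[n] := integrableOn_hyperplane e he p hn hG hGs
  have hGi2 : IntegrableOn G (Ψ.target ∩ Pl) μHE[n] := hGi.mono_set inter_subset_right
  have hGi1 : Integrable G ((μHE[n].restrict S).map Ψ) := (hGi2.smul_measure_nnreal).mono_measure m1
  have hind : ∀ g : ℝ → ℝ, g 0 = 0 →
      ∫ y in Ψ.target ∩ Pl, g (G y) ∂μHE[n] = ∫ y in Pl, g (G y) ∂μHE[n] := by
    intro g hg
    symm
    apply setIntegral_eq_of_subset_of_forall_sdiff_eq_zero
      (isClosed_eq (by fun_prop) continuous_const).measurableSet inter_subset_right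
    intro y hy
    rw [hG0 y (fun h => hy.2 ⟨h, hy.1⟩), hg]
  have hFS : ∀ g : ℝ → ℝ, Continuous g →
      ∫ x in S, g (F x) ∂μHE[n] = ∫ y, g (G y) ∂((μHE[n].restrict S).map Ψ) := by
    intro g hg
    rw [integral_map (f := fun y => g (G y)) hΨc.aemeasurable
      (hg.comp hG).aestronglyMeasurable]
    refine setIntegral_congr_fun hSm fun x hx => ?_
    simp only [hGF x hx.1]
  constructor
  · have := (integrable_map_measure hGi1.1 hΨc.aemeasurable).1 hGi1
    refine (integrable_congr ?_).1 this
    filter_upwards [ae_restrict_mem hSm] with x hx using hGF x hx.1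
  intro κ hκ hκs hκ0 hκ1 ℓ hℓ
  set I := ∫ y in Pl, G y ∂μHE[n]
  set I' := ∫ y in Pl, |G y| ∂μHE[n]
  -- The layer integral of F is the flat layer integral of the transported function G against the
  -- push-forward of Lebesgue measure. That measure is within a factor C of Lebesgue measure, and
  -- the relative error survives the limit δ → 0. Next, `b2` makes the same comparison for the
  -- surface measures, and `b4` replaces ∫ |G| by ∫ |F|.
  have b1 : |ℓ - I| ≤ (C - 1) * I' := by
    have t1 := tendsto_integral_hyperplane e he p hn hκ hκs hG hGs
    have t2 := tendsto_integral_hyperplane e he p hn hκ hκs hG.abs (hGs.comp_left abs_zero)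
    rw [hκ1, one_mul] at t1 t2
    refine le_of_tendsto_of_tendsto (hℓ.sub t1).abs (t2.const_mul _) ?_
    filter_upwards [self_mem_nhdsWithin] with δ hδ
    have hδ' : (0 : ℝ) < δ := hδ
    have hc : Continuous fun y => δ⁻¹ * κ (inner ℝ e (y - p) / δ) * G y := by fun_prop
    have hint : Integrable (fun y => δ⁻¹ * κ (inner ℝ e (y - p) / δ) * G y) :=
      hc.integrable_of_hasCompactSupport hGs.mul_left
    have e1 := abs_integral_sub_le_of_measure_le hC m3 m4 (hint.integrableOn (s := Ψ.target))
    have e2 : ∫ y in Ψ.target, δ⁻¹ * κ (inner ℝ e (y - p) / δ) * G y =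
        ∫ y, δ⁻¹ * κ (inner ℝ e (y - p) / δ) * G y := by
      apply setIntegral_eq_integral_of_forall_compl_eq_zero
      intro y hy
      rw [hG0 y hy, mul_zero]
    have e3 : ∫ y in Ψ.target, |δ⁻¹ * κ (inner ℝ e (y - p) / δ) * G y| =
        ∫ y, δ⁻¹ * κ (inner ℝ e (y - p) / δ) * |G y| := by
      rw [setIntegral_eq_integral_of_forall_compl_eq_zero]
      · refine integral_congr_ae (Eventually.of_forall fun y => ?_)
        simp only
        rw [abs_mul, abs_of_nonneg (mul_nonneg (inv_nonneg.2 hδ'.le) (hκ0 _))]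
      · intro y hy
        rw [hG0 y hy, mul_zero, abs_zero]
    have e4 : ∫ y, δ⁻¹ * κ (inner ℝ e (y - p) / δ) * G y ∂((volume.restrict Ψ.source).map Ψ) =
        ∫ x, δ⁻¹ * κ (ρ x / δ) * F x := by
      rw [integral_map hΨc.aemeasurable hc.aestronglyMeasurable]
      simp_rw [hin]
      rw [← setIntegral_eq_integral_of_forall_compl_eq_zero (s := Ψ.source)
        (f := fun x => δ⁻¹ * κ (ρ x / δ) * F x)]
      · refine setIntegral_congr_fun Ψ.open_source.measurableSet fun x hx => ?_
        simp only [hGF x hx]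
      · intro x hx
        rw [image_eq_zero_of_notMem_tsupport (fun h => hx (hsub h)), mul_zero]
    rw [e2, e3, e4] at e1
    exact e1
  have b2 := abs_integral_sub_le_of_measure_le hC m1 m2 hGi2
  rw [← hFS (fun x => x) continuous_id, hind (fun x => x) rfl,
    hind (fun x => |x|) abs_zero] at b2
  have b3 := abs_integral_sub_le_of_measure_le hC m2 m1 hGi1.abs
  simp only [abs_abs] at b3
  rw [← hFS (fun x => |x|) continuous_abs, hind (fun x => |x|) abs_zero] at b3
  have hC' : (1 : ℝ) ≤ C := by exact_mod_cast hC
  have b4 : I' ≤ C * ∫ x in S, |F x| ∂μHE[n] := by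
    have := (abs_le.1 b3).2
    linarith
  have b5 : (C - 1) * I' ≤ (C - 1) * (C * ∫ x in S, |F x| ∂μHE[n]) :=
    mul_le_mul_of_nonneg_left b4 (by linarith)
  calc |ℓ - ∫ x in S, F x ∂μHE[n]| = |(ℓ - I) - (∫ x in S, F x ∂μHE[n] - I)| := by congr 1; ring
    _ ≤ |ℓ - I| + |∫ x in S, F x ∂μHE[n] - I| := abs_sub _ _
    _ ≤ (C - 1) * I' + (C - 1) * I' := add_le_add b1 b2
    _ ≤ _ := by linarith

end Chart

end

/-! ### Defining functions, Euclidean flux, and a fixed cutoff function. -/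

noncomputable section

namespace Mink

variable {n : ℕ}

/-- If a zero p of ρ were outside the closure of U, then ρ would be nonnegative near p and have a
local minimum there, against dρ ≠ 0. -/
theorem IsDefiningFunctionAt.mem_frontier {U : Set (Spacetime n)} {p : Spacetime n}
    {ρ : Spacetime n → ℝ} (h : IsDefiningFunctionAt U p ρ) (h0 : ρ p = 0) : p ∈ frontier U := by
  rw [frontier_eq_closure_inter_closure]
  constructor
  · by_contra hc
    apply h.fderiv_ne_zero
    apply IsLocalMin.fderiv_eq_zero
    filter_upwards [h.eventually_mem_iff, isClosed_closure.isOpen_compl.mem_nhds hc] with q hq hq'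
    rw [h0]
    by_contra hlt
    exact hq' (subset_closure (hq.2 (not_le.1 hlt)))
  · apply subset_closure
    intro hp
    exact absurd (h.eventually_mem_iff.self_of_nhds.1 hp) (by simp [h0])

theorem IsDefiningFunctionAt.eventually {U : Set (Spacetime n)} {p : Spacetime n}
    {ρ : Spacetime n → ℝ} (h : IsDefiningFunctionAt U p ρ) :
    ∀ᶠ q in 𝓝 p, IsDefiningFunctionAt U q ρ := by
  have hc : Continuous (fderiv ℝ ρ) := h.smooth.continuous_fderiv (by simp)
  filter_upwards [h.eventually_mem_iff.eventually_nhds,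
    hc.continuousAt.eventually_ne h.fderiv_ne_zero] with q h1 h2
  exact ⟨h.smooth, h2, h1⟩

theorem IsDefiningFunctionAt.eventually_frontier {U : Set (Spacetime n)} {p : Spacetime n}
    {ρ : Spacetime n → ℝ} (h : IsDefiningFunctionAt U p ρ) :
    ∀ᶠ q in 𝓝 p, q ∈ frontier U ↔ ρ q = 0 := by
  filter_upwards [h.eventually] with q hq
  exact ⟨fun h' => hq.eq_zero h', hq.mem_frontier⟩

theorem IsDefiningFunctionAt.smul {U : Set (Spacetime n)} {p : Spacetime n}
    {ρ : Spacetime n → ℝ} (h : IsDefiningFunctionAt U p ρ) {c : ℝ} (hc : 0 < c) :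
    IsDefiningFunctionAt U p (fun q => c * ρ q) := by
  refine ⟨contDiff_const.mul h.smooth, ?_, ?_⟩
  · rw [fderiv_const_mul (h.smooth.differentiable (by simp) p)]
    exact smul_ne_zero hc.ne' h.fderiv_ne_zero
  · filter_upwards [h.eventually_mem_iff] with q hq
    rw [hq]
    constructor
    · exact fun h => mul_neg_of_pos_of_neg hc h
    · intro h
      by_contra h'
      exact absurd h (not_lt.2 (mul_nonneg hc.le (not_lt.1 h')))

theorem definingFunction_spec {U : Set (Spacetime n)} {p : Spacetime n}
    (h : ∃ ρ, IsDefiningFunctionAt U p ρ) : IsDefiningFunctionAt U p (definingFunction U p) :=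
  Classical.epsilon_spec h

/-- The divergence of a vector field. -/
def divergence (J : Spacetime n → Spacetime n) (p : Spacetime n) : ℝ :=
  ∑ k, pd k (fun q => J q k) p

/-- The Euclidean outward normal component of a vector field at a boundary point. -/
def flux (U : Set (Spacetime n)) (J : Spacetime n → Spacetime n) (p : Spacetime n) : ℝ :=
  fderiv ℝ (definingFunction U p) p (J p) / ‖fderiv ℝ (definingFunction U p) p‖

/-- The differentials of two defining functions are positive multiples of each other, and the
quotient is homogeneous of degree zero. This frees the flux from the pointwise choice made in
`definingFunction`. -/
theorem flux_eq {U : Set (Spacetime n)} {p : Spacetime n} (hp : p ∈ frontier U)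
    {ρ : Spacetime n → ℝ} (h : IsDefiningFunctionAt U p ρ) (J : Spacetime n → Spacetime n) :
    flux U J p = fderiv ℝ ρ p (J p) / ‖fderiv ℝ ρ p‖ := by
  obtain ⟨c, hc, hcc⟩ := exists_pos_fderiv_eq_smul hp h (definingFunction_spec ⟨ρ, h⟩)
  rw [flux, hcc, norm_smul, Real.norm_of_nonneg hc.le]
  simp only [smul_apply, smul_eq_mul]
  rw [mul_div_mul_left _ _ hc.ne']

theorem integral_pd_eq_zero {h : Spacetime n → ℝ} (hh : ContDiff ℝ 1 h) (hs : HasCompactSupport h)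
    (k : Fin (n + 1)) : ∫ p, pd k h p = 0 := by
  have hc : Continuous (fun p => fderiv ℝ h p (EuclideanSpace.single k 1)) :=
    (hh.continuous_fderiv (by simp)).clm_apply continuous_const
  have hi : Integrable (fun p => fderiv ℝ h p (EuclideanSpace.single k 1)) :=
    hc.integrable_of_hasCompactSupport (hs.fderiv_apply ℝ _)
  have := integral_mul_fderiv_eq_neg_fderiv_mul_of_integrable (μ := volume)
    (f := fun _ : Spacetime n => (1 : ℝ)) (g := h) (v := EuclideanSpace.single k 1)
    (by simp) (by simpa using hi)
    (by simpa using hh.continuous.integrable_of_hasCompactSupport hs)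
    (fun x _ => differentiableAt_const _) (fun x _ => hh.differentiable (by simp) x)
  simpa [pd] using this

theorem pd_mul {f g : Spacetime n → ℝ} {p : Spacetime n} (hf : DifferentiableAt ℝ f p)
    (hg : DifferentiableAt ℝ g p) (k : Fin (n + 1)) :
    pd k (fun q => f q * g q) p = pd k f p * g p + f p * pd k g p := by
  simp only [pd]
  rw [fderiv_fun_mul hf hg]
  simp
  ring

theorem sum_pd_mul (f : Spacetime n → ℝ) (p v : Spacetime n) :
    ∑ k, pd k f p * v k = fderiv ℝ f p v := by
  have h1 : v = ∑ k, v k • EuclideanSpace.single k (1 : ℝ) := by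
    ext i
    simp [Pi.single_apply]
  conv_rhs => rw [h1]
  simp only [map_sum, map_smul, smul_eq_mul, pd]
  exact Finset.sum_congr rfl fun k _ => mul_comm _ _

theorem divergence_smul {χ : Spacetime n → ℝ} {J : Spacetime n → Spacetime n} {p : Spacetime n}
    (hχ : DifferentiableAt ℝ χ p) (hJ : DifferentiableAt ℝ J p) :
    divergence (fun q => χ q • J q) p = fderiv ℝ χ p (J p) + χ p * divergence J p := by
  simp only [divergence, PiLp.smul_apply, smul_eq_mul]
  rw [← sum_pd_mul, Finset.mul_sum, ← Finset.sum_add_distrib]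
  refine Finset.sum_congr rfl fun k _ => ?_
  exact pd_mul hχ (differentiableAt_euclidean.1 hJ k) k

theorem divergence_eq_zero {J : Spacetime n → Spacetime n} {p : Spacetime n}
    (hp : p ∉ tsupport J) : divergence J p = 0 := by
  have h1 : J =ᶠ[𝓝 p] 0 := notMem_tsupport_iff_eventuallyEq.1 hp
  refine Finset.sum_eq_zero fun k _ => ?_
  have : (fun q => J q k) =ᶠ[𝓝 p] fun _ => 0 := by
    filter_upwards [h1] with q hq
    simp [hq]
  simp [pd, this.fderiv_eq]

/-- The divergence of a compactly supported vector field has vanishing integral over an open set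
whose boundary does not meet the support. -/
theorem setIntegral_divergence_eq_zero {U : Set (Spacetime n)} (hU : IsOpen U)
    {J : Spacetime n → Spacetime n} (hJ : ContDiffOn ℝ 1 J U) (hs : HasCompactSupport J)
    (hd : Disjoint (tsupport J) (frontier U)) : ∫ p in U, divergence J p = 0 := by
  -- Extension by zero off U is C¹ on the whole space because the support of J avoids the boundary.
  -- Each partial derivative then integrates to zero.
  have key : ∀ k, ContDiff ℝ 1 (U.indicator fun q => J q k) ∧
      HasCompactSupport (U.indicator fun q => J q k) ∧
      ∀ p, pd k (U.indicator fun q => J q k) p = U.indicator (pd k fun q => J q k) p := by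
    intro k
    have hsub : tsupport (U.indicator fun q => J q k) ⊆ closure U ∩ tsupport J := by
      refine subset_inter (closure_mono ?_) (closure_mono ?_)
      · exact support_indicator_subset
      · intro q hq
        simp only [Function.mem_support, ne_eq, indicator_apply_eq_zero, Classical.not_imp] at hq ⊢
        intro h
        exact hq.2 (by simp [h])
    have hsub' : tsupport (U.indicator fun q => J q k) ⊆ U := by
      intro q hq
      by_contra hqU
      have := hsub hq
      refine disjoint_left.1 hd this.2 ?_
      rw [hU.frontier_eq]
      exact ⟨this.1, hqU⟩
    have heq : ∀ q ∈ U, (U.indicator fun q => J q k) =ᶠ[𝓝 q] fun q => J q k := by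
      intro q hq
      filter_upwards [hU.mem_nhds hq] with z hz
      simp [hz]
    refine ⟨contDiff_iff_contDiffAt.2 fun q => ?_, ?_, ?_⟩
    · by_cases hq : q ∈ tsupport (U.indicator fun q => J q k)
      swap
      · exact contDiffAt_const.congr_of_eventuallyEq (notMem_tsupport_iff_eventuallyEq.1 hq)
      have := (hJ.contDiffAt (hU.mem_nhds (hsub' hq)))
      have h2 := contDiffAt_euclidean.1 this k
      exact h2.congr_of_eventuallyEq (heq q (hsub' hq))
    · exact HasCompactSupport.of_support_subset_isCompact (K := tsupport J) hs
        ((subset_tsupport _).trans (hsub.trans inter_subset_right))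
    · intro q
      by_cases hq : q ∈ U
      · simp [hq, pd, (heq q hq).fderiv_eq]
      · have h1 : q ∉ tsupport (U.indicator fun q => J q k) := fun h => hq (hsub' h)
        have h2 := notMem_tsupport_iff_eventuallyEq.1 h1
        simp [hq, pd, h2.fderiv_eq]
  have h1 : ∀ p, U.indicator (divergence J) p =
      ∑ k, pd k (U.indicator fun q => J q k) p := by
    intro p
    simp_rw [(key _).2.2]
    by_cases hp : p ∈ U <;> simp [hp, divergence]
  rw [← integral_indicator hU.measurableSet]
  simp_rw [h1]
  rw [integral_finsetSum]
  · exact Finset.sum_eq_zero fun k _ => integral_pd_eq_zero (key k).1 (key k).2.1 k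
  · intro k _
    exact Continuous.integrable_of_hasCompactSupport
      (((key k).1.continuous_fderiv (by simp)).clm_apply continuous_const)
      ((key k).2.1.fderiv_apply ℝ _)

/-- A smooth nondecreasing function equal to `0` on `(-∞, 1]` and to `1` on `[2, ∞)`. -/
def cutoff (s : ℝ) : ℝ := Real.smoothTransition (s - 1)

theorem contDiff_cutoff : ContDiff ℝ ∞ cutoff :=
  Real.smoothTransition.contDiff.comp (contDiff_id.sub contDiff_const)

theorem cutoff_nonneg (s : ℝ) : 0 ≤ cutoff s := Real.smoothTransition.nonneg _

theorem cutoff_le_one (s : ℝ) : cutoff s ≤ 1 := Real.smoothTransition.le_one _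

theorem cutoff_of_le {s : ℝ} (h : s ≤ 1) : cutoff s = 0 :=
  Real.smoothTransition.zero_of_nonpos (by linarith)

theorem cutoff_of_ge {s : ℝ} (h : 2 ≤ s) : cutoff s = 1 :=
  Real.smoothTransition.one_of_one_le (by linarith)

theorem hasDerivAt_cutoff (s : ℝ) : HasDerivAt cutoff (deriv cutoff s) s :=
  (contDiff_cutoff.differentiable (by simp) s).hasDerivAt

theorem continuous_deriv_cutoff : Continuous (deriv cutoff) :=
  contDiff_cutoff.continuous_deriv (by simp)

theorem deriv_cutoff_nonneg (s : ℝ) : 0 ≤ deriv cutoff s := by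
  apply Monotone.deriv_nonneg
  intro x y h
  exact Real.smoothTransition.monotone (by linarith)

theorem deriv_cutoff_eq_zero {s : ℝ} (h : s ∉ Icc (1 : ℝ) 2) : deriv cutoff s = 0 := by
  rw [mem_Icc, not_and_or, not_le, not_le] at h
  rcases h with h | h
  · have : cutoff =ᶠ[𝓝 s] fun _ => 0 := by
      filter_upwards [Iio_mem_nhds h] with x hx using cutoff_of_le (le_of_lt hx)
    simp [this.deriv_eq]
  · have : cutoff =ᶠ[𝓝 s] fun _ => 1 := by
      filter_upwards [Ioi_mem_nhds h] with x hx using cutoff_of_ge (le_of_lt hx)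
    simp [this.deriv_eq]

theorem hasCompactSupport_deriv_cutoff : HasCompactSupport (deriv cutoff) :=
  HasCompactSupport.intro (isCompact_Icc (a := (1 : ℝ)) (b := 2)) fun _ h => deriv_cutoff_eq_zero h

theorem integral_deriv_cutoff : ∫ s, deriv cutoff s = 1 := by
  have := integral_of_hasDerivAt_of_tendsto (f := cutoff) (m := 0) (n := 1) hasDerivAt_cutoff
    (continuous_deriv_cutoff.integrable_of_hasCompactSupport hasCompactSupport_deriv_cutoff)
    (tendsto_const_nhds.congr' (by
      filter_upwards [Iic_mem_atBot (1 : ℝ)] with x hx using (cutoff_of_le hx).symm))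
    (tendsto_const_nhds.congr' (by
      filter_upwards [Ici_mem_atTop (2 : ℝ)] with x hx using (cutoff_of_ge hx).symm))
  simpa using this

end Mink

end

/-! ### The divergence theorem for fields continuous up to a smooth boundary. -/

noncomputable section

namespace Mink

variable {n : ℕ}

theorem finrank_spacetime : Module.finrank ℝ (Spacetime n) = n + 1 := by simp

/-- Near a boundary point, surface integrals are compared with limits of integrals over thin
layers inside the domain. -/
theorem exists_boundary_chart {U : Set (Spacetime n)} {p : Spacetime n}
    (hp : ∃ ρ, IsDefiningFunctionAt U p ρ) {C : NNReal} (hC : 1 < C) :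
    ∃ W, IsOpen W ∧ p ∈ W ∧ ∃ ρ : Spacetime n → ℝ, (∀ q ∈ W, IsDefiningFunctionAt U q ρ ∧
      (q ∈ U ↔ ρ q < 0) ∧ (q ∈ frontier U ↔ ρ q = 0) ∧
      (C : ℝ)⁻¹ ≤ ‖fderiv ℝ ρ q‖ ∧ ‖fderiv ℝ ρ q‖ ≤ C) ∧
      ∀ F : Spacetime n → ℝ, Continuous F → HasCompactSupport F → tsupport F ⊆ W →
        IntegrableOn F (frontier U) μHE[n] ∧
        ∀ ℓ : ℝ, Tendsto (fun δ : ℝ => ∫ x, δ⁻¹ * deriv cutoff (-(ρ x / δ)) * F x) (𝓝[>] 0) (𝓝 ℓ) →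
          |ℓ - ∫ x in frontier U, F x ∂μHE[n]| ≤
            2 * (C - 1) * C * ∫ x in frontier U, |F x| ∂μHE[n] := by
  obtain ⟨ρ₀, hρ₀⟩ := hp
  have hpos : 0 < ‖fderiv ℝ ρ₀ p‖ := norm_pos_iff.2 hρ₀.fderiv_ne_zero
  -- With |dρ| = 1 at p the differential is the inner product with a unit vector, as the flattening
  -- chart requires, and |dρ| stays in [1/C, C] nearby.
  have hρ := hρ₀.smul (inv_pos.2 hpos)
  set ρ : Spacetime n → ℝ := fun q => ‖fderiv ℝ ρ₀ p‖⁻¹ * ρ₀ q with hρdef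
  have hn1 : ‖fderiv ℝ ρ p‖ = 1 := by
    rw [hρdef, fderiv_const_mul (hρ₀.smooth.differentiable (by simp) p), norm_smul, norm_inv,
      norm_norm, inv_mul_cancel₀ hpos.ne']
  set e : Spacetime n := (InnerProductSpace.toDual ℝ (Spacetime n)).symm (fderiv ℝ ρ p) with he_def
  have he : ‖e‖ = 1 := by rw [he_def, LinearIsometryEquiv.norm_map, hn1]
  have hst : HasStrictFDerivAt ρ (innerSL ℝ e) p := by
    have h1 := hρ.smooth.contDiffAt.hasStrictFDerivAt (x := p) (by simp)
    have h2 : innerSL ℝ e = fderiv ℝ ρ p := by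
      ext x
      simp [he_def]
    rw [h2]
    exact h1
  have hρc : Continuous ρ := hρ.smooth.continuous
  obtain ⟨Ψ, hpΨ, hΨ, hΨc, hm⟩ := exists_flatten_chart hρc hst hC (n + 1)
  have hC1 : (1 : ℝ) < C := by exact_mod_cast hC
  have hfc : Continuous fun q => ‖fderiv ℝ ρ q‖ := (hρ.smooth.continuous_fderiv (by simp)).norm
  have hev : ∀ᶠ q in 𝓝 p, IsDefiningFunctionAt U q ρ ∧
      (q ∈ U ↔ ρ q < 0) ∧ (q ∈ frontier U ↔ ρ q = 0) ∧
      (C : ℝ)⁻¹ ≤ ‖fderiv ℝ ρ q‖ ∧ ‖fderiv ℝ ρ q‖ ≤ C := by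
    have a1 : ∀ᶠ q in 𝓝 p, (C : ℝ)⁻¹ < ‖fderiv ℝ ρ q‖ :=
      hfc.continuousAt.eventually_const_lt (by simp only [hn1]; exact inv_lt_one_of_one_lt₀ hC1)
    have a2 : ∀ᶠ q in 𝓝 p, ‖fderiv ℝ ρ q‖ < C :=
      hfc.continuousAt.eventually_lt_const (by simpa only [hn1] using hC1)
    filter_upwards [hρ.eventually, hρ.eventually_mem_iff, hρ.eventually_frontier, a1, a2]
      with q h1 h2 h3 h4 h5 using ⟨h1, h2, h3, h4.le, h5.le⟩
  obtain ⟨W, hW, hWo, hpW⟩ := eventually_nhds_iff.1 hev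
  refine ⟨W ∩ Ψ.source, hWo.inter Ψ.open_source, ⟨hpW, hpΨ⟩, ρ, fun q hq => hW q hq.1, ?_⟩
  intro F hF hFs hsub
  obtain ⟨h1, h2⟩ := chart_estimate finrank_spacetime he hρc Ψ hΨ hΨc hC.le hm hF hFs
    (hsub.trans inter_subset_right)
  have hset : ∀ q, F q ≠ 0 → (q ∈ frontier U ↔ q ∈ {x ∈ Ψ.source | ρ x = 0}) := by
    intro q hq
    have hqW := hsub (subset_tsupport _ hq)
    rw [(hW q hqW.1).2.2.1]
    simp [hqW.2]
  have hSm : MeasurableSet {x ∈ Ψ.source | ρ x = 0} :=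
    Ψ.open_source.measurableSet.inter (hρc.measurable (measurableSet_singleton 0))
  have hfm : MeasurableSet (frontier U) := isClosed_frontier.measurableSet
  classical
  have hind : (frontier U).indicator F = {x ∈ Ψ.source | ρ x = 0}.indicator F := by
    ext q
    by_cases hq : F q = 0
    · simp [indicator_apply, hq]
    · simp only [indicator_apply, hset q hq]
  have hind' : (frontier U).indicator (fun x => |F x|) =
      {x ∈ Ψ.source | ρ x = 0}.indicator (fun x => |F x|) := by
    ext q
    by_cases hq : F q = 0
    · simp [indicator_apply, hq]
    · simp only [indicator_apply, hset q hq]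
  have e1 : ∫ x in frontier U, F x ∂μHE[n] = ∫ x in {x ∈ Ψ.source | ρ x = 0}, F x ∂μHE[n] := by
    rw [← integral_indicator hfm, ← integral_indicator hSm, hind]
  have e2 : ∫ x in frontier U, |F x| ∂μHE[n] = ∫ x in {x ∈ Ψ.source | ρ x = 0}, |F x| ∂μHE[n] := by
    rw [← integral_indicator hfm, ← integral_indicator hSm, hind']
  constructor
  · rw [← integrable_indicator_iff hfm, hind, integrable_indicator_iff hSm]
    exact h1
  intro ℓ hℓ
  rw [e1, e2]
  -- The profile is reflected because U is {ρ < 0}: the layer -2δ ≤ ρ ≤ -δ lies inside U.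
  refine h2 (fun s => deriv cutoff (-s)) (continuous_deriv_cutoff.comp continuous_neg)
    (hasCompactSupport_deriv_cutoff.comp_homeomorph (Homeomorph.neg ℝ))
    (fun s => deriv_cutoff_nonneg _) ?_ ℓ hℓ
  rw [integral_neg_eq_self (fun s => deriv cutoff s), integral_deriv_cutoff]

/-- The surface measure of a bounded piece of the boundary is finite. -/
theorem measure_frontier_inter_lt_top {U : Set (Spacetime n)}
    (hb : ∀ p ∈ frontier U, ∃ ρ, IsDefiningFunctionAt U p ρ) {K : Set (Spacetime n)}
    (hK : IsCompact K) : μHE[n] (frontier U ∩ K) < ⊤ := by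
  refine (hK.inter_left isClosed_frontier).measure_lt_top_of_nhdsWithin fun p hp => ?_
  obtain ⟨W, hWo, hpW, ρ, -, hF⟩ := exists_boundary_chart (hb p hp.1)
    (C := 2) (by norm_num)
  obtain ⟨χ, hχ1, hχ2, hχ3⟩ := exists_contDiff_tsupport_subset (n := 1) (hWo.mem_nhds hpW)
  have hint := (hF χ hχ3.1.continuous hχ2 hχ1).1
  have hpχ : ∀ᶠ q in 𝓝 p, 1 / 2 < χ q := by
    apply hχ3.1.continuous.continuousAt.eventually_const_lt
    rw [hχ3.2.2]; norm_num
  -- The bump χ is integrable on the boundary by the chart, so Markov's inequality bounds the area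
  -- where it exceeds 1/2.
  refine ⟨frontier U ∩ {q | 1 / 2 < χ q}, ?_, ?_⟩
  · exact inter_mem (mem_of_superset self_mem_nhdsWithin inter_subset_left)
      (mem_nhdsWithin_of_mem_nhds hpχ)
  · have := hint.measure_norm_ge_lt_top (ε := 1 / 2) (by norm_num)
    rw [Measure.restrict_apply' isClosed_frontier.measurableSet] at this
    refine lt_of_le_of_lt (measure_mono ?_) this
    rintro q ⟨hq1, hq2⟩
    exact ⟨le_trans (le_of_lt hq2 : 1 / 2 ≤ χ q) (le_abs_self _), hq1⟩

theorem tsupport_smul_vector_subset (χ : Spacetime n → ℝ) (J : Spacetime n → Spacetime n) :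
    tsupport (fun q => χ q • J q) ⊆ tsupport χ ∩ tsupport J := by
  refine subset_inter (closure_mono ?_) (closure_mono ?_)
  · exact fun q hq h => hq (by simp [h])
  · exact fun q hq h => hq (by simp [h])

theorem hasCompactSupport_smul_vector (χ : Spacetime n → ℝ) {J : Spacetime n → Spacetime n}
    (hJ : HasCompactSupport J) : HasCompactSupport fun q => χ q • J q :=
  hJ.mono fun q hq h => hq (by simp [h])

theorem integrableOn_divergence_smul {U : Set (Spacetime n)} (hU : IsOpen U)
    {J : Spacetime n → Spacetime n} (hJ : Continuous J) (hJs : HasCompactSupport J)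
    (hJd : ContDiffOn ℝ 1 J U) (hint : IntegrableOn (divergence J) U) {χ : Spacetime n → ℝ}
    (hχ : ContDiff ℝ 1 χ) (h0 : ∀ q, 0 ≤ χ q) (h1 : ∀ q, χ q ≤ 1) :
    IntegrableOn (divergence fun q => χ q • J q) U := by
  have hc : Continuous fun q => fderiv ℝ χ q (J q) := (hχ.continuous_fderiv (by simp)).clm_apply hJ
  have i1 : Integrable fun q => fderiv ℝ χ q (J q) :=
    hc.integrable_of_hasCompactSupport (hJs.mono (fun q hq h => hq (by simp [h])))
  have i2 : IntegrableOn (fun q => χ q * divergence J q) U :=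
    hint.bdd_mul (c := 1) hχ.continuous.aestronglyMeasurable
      (Eventually.of_forall fun q => by rw [Real.norm_of_nonneg (h0 q)]; exact h1 q)
  refine (i1.integrableOn.add i2).congr ?_
  filter_upwards [ae_restrict_mem hU.measurableSet] with q hq
  exact (divergence_smul (hχ.differentiable (by simp) q)
    ((hJd.contDiffAt (hU.mem_nhds hq)).differentiableAt (by simp))).symm

/-- The divergence theorem near a boundary point, up to a small relative error. -/
theorem abs_divergence_sub_flux_le {U W : Set (Spacetime n)} (hU : IsOpen U)
    {ρ : Spacetime n → ℝ} {C : NNReal} (hC : 1 < C) (hρs : ContDiff ℝ ∞ ρ)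
    (hW : ∀ q ∈ W, IsDefiningFunctionAt U q ρ ∧
      (q ∈ U ↔ ρ q < 0) ∧ (q ∈ frontier U ↔ ρ q = 0) ∧
      (C : ℝ)⁻¹ ≤ ‖fderiv ℝ ρ q‖ ∧ ‖fderiv ℝ ρ q‖ ≤ C)
    (hF : ∀ F : Spacetime n → ℝ, Continuous F → HasCompactSupport F → tsupport F ⊆ W →
        IntegrableOn F (frontier U) μHE[n] ∧
        ∀ ℓ : ℝ, Tendsto (fun δ : ℝ => ∫ x, δ⁻¹ * deriv cutoff (-(ρ x / δ)) * F x) (𝓝[>] 0) (𝓝 ℓ) →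
          |ℓ - ∫ x in frontier U, F x ∂μHE[n]| ≤
            2 * (C - 1) * C * ∫ x in frontier U, |F x| ∂μHE[n])
    {J : Spacetime n → Spacetime n} (hJ : Continuous J) (hJs : HasCompactSupport J)
    (hJd : ContDiffOn ℝ 1 J U) (hint : IntegrableOn (divergence J) U) (hJW : tsupport J ⊆ W) :
    IntegrableOn (flux U J) (frontier U) μHE[n] ∧
    IntegrableOn (fun q => ‖J q‖) (frontier U) μHE[n] ∧
    |(∫ q in U, divergence J q) - ∫ q in frontier U, flux U J q ∂μHE[n]| ≤
      3 * (C - 1) * C ^ 2 * ∫ q in frontier U, ‖J q‖ ∂μHE[n] := by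
  have hC1 : (1 : ℝ) < C := by exact_mod_cast hC
  have hC0 : (0 : ℝ) < C := by linarith
  have hfm : MeasurableSet (frontier U) := isClosed_frontier.measurableSet
  set F : Spacetime n → ℝ := fun q => fderiv ℝ ρ q (J q) with hFdef
  have hρd : Continuous (fderiv ℝ ρ) := hρs.continuous_fderiv (by simp)
  have hFc : Continuous F := hρd.clm_apply hJ
  have hFsupp : Function.support F ⊆ Function.support J := fun q hq h => hq (by simp [hFdef, h])
  have hFs : HasCompactSupport F := hJs.mono hFsupp
  have hFt : tsupport F ⊆ W := (closure_mono hFsupp).trans hJW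
  obtain ⟨i1, hlim⟩ := hF F hFc hFs hFt
  have hJn : Function.support (fun q => ‖J q‖) ⊆ Function.support J :=
    fun q hq h => hq (by simp [h])
  obtain ⟨i2, -⟩ := hF (fun q => ‖J q‖) hJ.norm hJs.norm ((closure_mono hJn).trans hJW)
  have hJW0 : ∀ q ∉ W, J q = 0 := fun q hq => image_eq_zero_of_notMem_tsupport fun h => hq (hJW h)
  have hflux : ∀ q ∈ frontier U, flux U J q = F q * ‖fderiv ℝ ρ q‖⁻¹ := by
    intro q hq
    by_cases hqW : q ∈ W
    · rw [flux_eq hq (hW q hqW).1, div_eq_mul_inv]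
    · simp [flux, hFdef, hJW0 q hqW]
  have hbound : ∀ q, |F q * ‖fderiv ℝ ρ q‖⁻¹| ≤ ‖J q‖ := by
    intro q
    rw [abs_mul, abs_inv, abs_norm, ← div_eq_mul_inv]
    apply div_le_of_le_mul₀ (norm_nonneg _) (norm_nonneg _)
    rw [mul_comm]
    exact (fderiv ℝ ρ q).le_opNorm (J q)
  have i3 : IntegrableOn (fun q => F q * ‖fderiv ℝ ρ q‖⁻¹) (frontier U) μHE[n] :=
    Integrable.mono' i2 (hFc.measurable.mul hρd.norm.measurable.inv).aestronglyMeasurable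
      (Eventually.of_forall hbound)
  have i4 : IntegrableOn (flux U J) (frontier U) μHE[n] :=
    i3.congr_fun (fun q hq => (hflux q hq).symm) hfm
  refine ⟨i4, i2, ?_⟩
  have hFn : ∀ q, |F q| ≤ C * ‖J q‖ := by
    intro q
    by_cases hqW : q ∈ W
    · exact ((fderiv ℝ ρ q).le_opNorm (J q)).trans
        (mul_le_mul_of_nonneg_right (hW q hqW).2.2.2.2 (norm_nonneg _))
    · simp [hFdef, hJW0 q hqW]
  have b1 : ∫ q in frontier U, |F q| ∂μHE[n] ≤ C * ∫ q in frontier U, ‖J q‖ ∂μHE[n] := by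
    rw [← integral_const_mul]
    exact integral_mono i1.abs (i2.const_mul _) hFn
  -- The function F = dρ(J) differs from the flux only by the factor |dρ|, which lies in [1/C, C].
  have b2 : |∫ q in frontier U, F q ∂μHE[n] - ∫ q in frontier U, flux U J q ∂μHE[n]| ≤
      (C - 1) * ∫ q in frontier U, |F q| ∂μHE[n] := by
    rw [← integral_sub i1 i4, ← integral_const_mul]
    refine (abs_integral_le_integral_abs).trans
      (setIntegral_mono_on (i1.sub i4).abs (i1.abs.const_mul _) hfm fun q hq => ?_)
    rw [hflux q hq]
    by_cases hqW : q ∈ W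
    · obtain ⟨-, -, -, h1, h2⟩ := hW q hqW
      have hp : 0 < ‖fderiv ℝ ρ q‖ := lt_of_lt_of_le (inv_pos.2 hC0) h1
      have h3 : ‖fderiv ℝ ρ q‖⁻¹ ≤ C := inv_le_of_inv_le₀ hC0 h1
      have h4 : (C : ℝ)⁻¹ ≤ ‖fderiv ℝ ρ q‖⁻¹ := inv_anti₀ hp h2
      have h5 : 1 - (C : ℝ)⁻¹ ≤ C - 1 := by
        have := mul_inv_cancel₀ hC0.ne'
        nlinarith [inv_pos.2 hC0]
      have h6 : F q - F q * ‖fderiv ℝ ρ q‖⁻¹ = (1 - ‖fderiv ℝ ρ q‖⁻¹) * F q := by ring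
      rw [h6, abs_mul]
      refine mul_le_mul_of_nonneg_right (abs_le.2 ⟨by linarith, by linarith⟩) (abs_nonneg _)
    · simp [hFdef, hJW0 q hqW]
  have b3 : |(∫ q in U, divergence J q) - ∫ q in frontier U, F q ∂μHE[n]| ≤
      2 * (C - 1) * C * ∫ q in frontier U, |F q| ∂μHE[n] := by
    apply hlim
    -- The field θ_δ J vanishes for ρ > -δ, hence near the boundary, and its divergence integrates
    -- to zero. This equates ∫ θ_δ div J with the layer integral of F, and the former tends to ∫ div
    -- J by dominated convergence; only integrability of div J is used.
    let θ : ℝ → Spacetime n → ℝ := fun δ q => cutoff (-(ρ q / δ))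
    have hθ : ∀ δ, ContDiff ℝ 1 (θ δ) := fun δ =>
      (contDiff_cutoff.of_le (by simp)).comp ((hρs.of_le (by simp)).div_const _).neg
    have hθd : ∀ δ q v, fderiv ℝ (θ δ) q v =
        -(δ⁻¹ * deriv cutoff (-(ρ q / δ)) * fderiv ℝ ρ q v) := by
      intro δ q v
      have h1 : HasFDerivAt (fun q => -(ρ q / δ)) (-(δ⁻¹ • fderiv ℝ ρ q)) q := by
        have := ((hρs.differentiable (by simp) q).hasFDerivAt.const_mul δ⁻¹).neg
        simpa [div_eq_inv_mul, Pi.neg_def] using this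
      have h2 : HasFDerivAt (θ δ) _ q := (hasDerivAt_cutoff _).comp_hasFDerivAt q h1
      rw [h2.fderiv]
      simp
      ring
    have key : ∀ δ : ℝ, 0 < δ → ∫ q in U, θ δ q * divergence J q =
        ∫ x, δ⁻¹ * deriv cutoff (-(ρ x / δ)) * F x := by
      intro δ hδ
      have hdisj : Disjoint (tsupport fun q => θ δ q • J q) (frontier U) := by
        rw [disjoint_left]
        intro q hq hqf
        have hqW : q ∈ W := hJW (tsupport_smul_vector_subset (θ δ) J hq).2
        have hcl : tsupport (θ δ) ⊆ {q | ρ q ≤ -δ} := by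
          refine closure_minimal ?_ (isClosed_le hρs.continuous continuous_const)
          intro z hz
          by_contra hlt
          apply hz
          apply cutoff_of_le
          rw [neg_le, le_div_iff₀ hδ]
          have : -δ < ρ z := not_le.1 hlt
          linarith
        have h1 : ρ q ≤ -δ := hcl (tsupport_smul_vector_subset (θ δ) J hq).1
        have h2 := (hW q hqW).2.2.1.1 hqf
        linarith
      have hdj : ContDiffOn ℝ 1 (fun q => θ δ q • J q) U := (hθ δ).contDiffOn.smul hJd
      have hcs : HasCompactSupport fun q => θ δ q • J q := hasCompactSupport_smul_vector _ hJs
      have z := setIntegral_divergence_eq_zero hU hdj hcs hdisj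
      have c1 : Continuous fun q => δ⁻¹ * deriv cutoff (-(ρ q / δ)) * F q := by
        have := continuous_deriv_cutoff
        have := hρs.continuous
        fun_prop
      have j1 : Integrable fun q => δ⁻¹ * deriv cutoff (-(ρ q / δ)) * F q :=
        c1.integrable_of_hasCompactSupport hFs.mul_left
      have j2 : IntegrableOn (fun q => θ δ q * divergence J q) U :=
        hint.bdd_mul (c := 1) (hθ δ).continuous.aestronglyMeasurable
          (Eventually.of_forall fun q => by
            rw [Real.norm_of_nonneg (cutoff_nonneg _)]; exact cutoff_le_one _)
      have e1 : ∫ q in U, divergence (fun q => θ δ q • J q) q =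
          ∫ q in U, (θ δ q * divergence J q - δ⁻¹ * deriv cutoff (-(ρ q / δ)) * F q) := by
        refine setIntegral_congr_fun hU.measurableSet fun q hq => ?_
        rw [divergence_smul ((hθ δ).differentiable (by simp) q)
          ((hJd.contDiffAt (hU.mem_nhds hq)).differentiableAt (by simp)), hθd]
        ring
      rw [e1, integral_sub j2 j1.integrableOn, sub_eq_zero] at z
      rw [z]
      apply setIntegral_eq_integral_of_forall_compl_eq_zero
      intro q hq
      by_cases hqW : q ∈ W
      · have h1 : 0 ≤ ρ q := by
          by_contra h
          exact hq ((hW q hqW).2.1.2 (not_le.1 h))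
        rw [deriv_cutoff_eq_zero (by
          rw [mem_Icc, not_and_or, not_le]
          left
          have := div_nonneg h1 hδ.le
          linarith)]
        ring
      · simp [hFdef, hJW0 q hqW]
    have lim : Tendsto (fun δ => ∫ q in U, θ δ q * divergence J q) (𝓝[>] 0)
        (𝓝 (∫ q in U, divergence J q)) := by
      refine tendsto_integral_filter_of_dominated_convergence (fun q => ‖divergence J q‖) ?_ ?_
        hint.norm ?_
      · exact Eventually.of_forall fun δ => (hθ δ).continuous.aestronglyMeasurable.mul hint.1
      · refine Eventually.of_forall fun δ => Eventually.of_forall fun q => ?_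
        rw [norm_mul, Real.norm_of_nonneg (cutoff_nonneg _)]
        exact mul_le_of_le_one_left (norm_nonneg _) (cutoff_le_one _)
      · filter_upwards [ae_restrict_mem hU.measurableSet] with q hq
        by_cases hqJ : q ∈ tsupport J
        · have hneg : ρ q < 0 := (hW q (hJW hqJ)).2.1.1 hq
          refine tendsto_const_nhds.congr' ?_
          filter_upwards [Ioo_mem_nhdsGT (show (0 : ℝ) < -ρ q / 2 by linarith)] with δ hδ
          have : θ δ q = 1 := by
            apply cutoff_of_ge
            rw [← neg_div, le_div_iff₀ hδ.1]
            linarith [hδ.2]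
          rw [this, one_mul]
        · simp [divergence_eq_zero hqJ]
    refine lim.congr' ?_
    filter_upwards [self_mem_nhdsWithin] with δ hδ using key δ hδ
  have hI : 0 ≤ ∫ q in frontier U, |F q| ∂μHE[n] := integral_nonneg fun q => abs_nonneg _
  have hI2 : 0 ≤ ∫ q in frontier U, ‖J q‖ ∂μHE[n] := integral_nonneg fun q => norm_nonneg _
  have b4 := abs_sub_le (∫ q in U, divergence J q) (∫ q in frontier U, F q ∂μHE[n])
    (∫ q in frontier U, flux U J q ∂μHE[n])
  have b5 : 2 * (C - 1) * C + (C - 1) ≤ 3 * ((C : ℝ) - 1) * C := by nlinarith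
  calc _ ≤ (2 * (C - 1) * C + (C - 1)) * ∫ q in frontier U, |F q| ∂μHE[n] := by linarith
    _ ≤ 3 * ((C : ℝ) - 1) * C * ∫ q in frontier U, |F q| ∂μHE[n] :=
      mul_le_mul_of_nonneg_right b5 hI
    _ ≤ 3 * ((C : ℝ) - 1) * C * (C * ∫ q in frontier U, ‖J q‖ ∂μHE[n]) :=
      mul_le_mul_of_nonneg_left b1 (mul_nonneg (by linarith) hC0.le)
    _ = _ := by ring

theorem flux_zero {U : Set (Spacetime n)} {J : Spacetime n → Spacetime n} {p : Spacetime n}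
    (h : J p = 0) : flux U J p = 0 := by simp [flux, h]

theorem exists_local_flux_estimate {U : Set (Spacetime n)} (hU : IsOpen U)
    (hb : ∀ p ∈ frontier U, ∃ ρ, IsDefiningFunctionAt U p ρ) {C : NNReal} (hC : 1 < C)
    (p : Spacetime n) : ∃ W, IsOpen W ∧ p ∈ W ∧
    ∀ J : Spacetime n → Spacetime n, Continuous J → HasCompactSupport J → ContDiffOn ℝ 1 J U →
      IntegrableOn (divergence J) U → tsupport J ⊆ W →
      IntegrableOn (flux U J) (frontier U) μHE[n] ∧
      IntegrableOn (fun q => ‖J q‖) (frontier U) μHE[n] ∧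
      |(∫ q in U, divergence J q) - ∫ q in frontier U, flux U J q ∂μHE[n]| ≤
        3 * (C - 1) * C ^ 2 * ∫ q in frontier U, ‖J q‖ ∂μHE[n] := by
  by_cases hp : p ∈ frontier U
  · obtain ⟨W, hWo, hpW, ρ, hW, hF⟩ := exists_boundary_chart (hb p hp) hC
    exact ⟨W, hWo, hpW, fun J hJ hJs hJd hint hJW =>
      abs_divergence_sub_flux_le hU hC (hW p hpW).1.smooth hW hF hJ hJs hJd hint hJW⟩
  · refine ⟨(frontier U)ᶜ, isClosed_frontier.isOpen_compl, hp, fun J hJ hJs hJd hint hJW => ?_⟩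
    have hJ0 : ∀ q ∈ frontier U, J q = 0 := fun q hq =>
      image_eq_zero_of_notMem_tsupport fun h => hJW h hq
    have hfm : MeasurableSet (frontier U) := isClosed_frontier.measurableSet
    have e1 : EqOn (flux U J) (fun _ => 0) (frontier U) := fun q hq => flux_zero (hJ0 q hq)
    have e2 : EqOn (fun q => ‖J q‖) (fun _ => 0) (frontier U) := fun q hq => by simp [hJ0 q hq]
    refine ⟨integrableOn_zero.congr_fun e1.symm hfm, integrableOn_zero.congr_fun e2.symm hfm, ?_⟩
    rw [setIntegral_congr_fun hfm e1, setIntegral_congr_fun hfm e2,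
      setIntegral_divergence_eq_zero hU hJd hJs (disjoint_left.2 hJW)]
    simp

/-- The divergence theorem for a vector field that is continuous up to the smooth boundary and
has an integrable divergence. -/
theorem integral_divergence_of_continuous {U : Set (Spacetime n)} (hU : IsOpen U)
    (hb : ∀ p ∈ frontier U, ∃ ρ, IsDefiningFunctionAt U p ρ)
    {J : Spacetime n → Spacetime n} (hJ : Continuous J) (hJs : HasCompactSupport J)
    (hJd : ContDiffOn ℝ 1 J U) (hint : IntegrableOn (divergence J) U) :
    ∫ q in U, divergence J q = ∫ q in frontier U, flux U J q ∂μHE[n] := by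
  have hfm : MeasurableSet (frontier U) := isClosed_frontier.measurableSet
  have key : ∀ C : NNReal, 1 < C →
      |(∫ q in U, divergence J q) - ∫ q in frontier U, flux U J q ∂μHE[n]| ≤
        3 * (C - 1) * C ^ 2 * ∫ q in frontier U, ‖J q‖ ∂μHE[n] := by
    intro C hC
    choose W hWo hpW hW using exists_local_flux_estimate hU hb hC
    obtain ⟨T, -, hT⟩ := hJs.isCompact.elim_nhds_subcover W (fun q _ => (hWo q).mem_nhds (hpW q))
    obtain ⟨χ, hχ⟩ := SmoothPartitionOfUnity.exists_isSubordinate (modelWithCornersSelf ℝ (Spacetime n))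
      (isClosed_tsupport J) (fun i : T => W i) (fun i => hWo i) (by
        intro q hq
        have := hT hq
        simpa using this)
    have hχd : ∀ i, ContDiff ℝ 1 (χ i) := fun i => ((χ i).contMDiff.contDiff).of_le (by simp)
    let Ji : T → Spacetime n → Spacetime n := fun i q => χ i q • J q
    have hsum : ∀ q, J q = ∑ i, Ji i q := by
      intro q
      by_cases hq : q ∈ tsupport J
      · have := χ.sum_eq_one hq
        rw [finsum_eq_sum_of_fintype] at this
        rw [← Finset.sum_smul, this, one_smul]
      · simp [Ji, image_eq_zero_of_notMem_tsupport hq]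
    -- As the partition functions are nonnegative, the norms add without loss. The relative errors
    -- of the pieces therefore sum to a bound that does not depend on the number of charts.
    have hsumn : ∀ q, ‖J q‖ = ∑ i, ‖Ji i q‖ := by
      intro q
      simp_rw [Ji, norm_smul, Real.norm_of_nonneg (χ.nonneg _ _)]
      by_cases hq : q ∈ tsupport J
      · have := χ.sum_eq_one hq
        rw [finsum_eq_sum_of_fintype] at this
        rw [← Finset.sum_mul, this, one_mul]
      · simp [image_eq_zero_of_notMem_tsupport hq]
    have hdi : ∀ i, IntegrableOn (divergence (Ji i)) U := fun i =>
      integrableOn_divergence_smul hU hJ hJs hJd hint (hχd i) (fun q => χ.nonneg i q)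
        (fun q => χ.le_one i q)
    have hloc := fun i : T => hW i (Ji i) ((hχd i).continuous.smul hJ)
      (hasCompactSupport_smul_vector _ hJs)
      ((hχd i).contDiffOn.smul hJd) (hdi i) ((tsupport_smul_vector_subset _ _).trans (inter_subset_left.trans (hχ i)))
    have s1 : ∫ q in U, divergence J q = ∑ i, ∫ q in U, divergence (Ji i) q := by
      rw [← integral_finsetSum _ fun i _ => hdi i]
      refine setIntegral_congr_fun hU.measurableSet fun q hq => ?_
      simp only [divergence]
      rw [Finset.sum_comm]
      refine Finset.sum_congr rfl fun k _ => ?_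
      have : (fun q => J q k) = fun q => ∑ i, Ji i q k := by
        ext q
        rw [hsum q]
        simp
      rw [this]
      simp only [pd]
      rw [fderiv_fun_sum]
      · simp
      · intro i _
        have hd := (((hχd i).contDiffOn.smul hJd).contDiffAt (hU.mem_nhds hq)).differentiableAt
          (by simp)
        exact differentiableAt_euclidean.1 hd k
    have s2 : ∫ q in frontier U, flux U J q ∂μHE[n] =
        ∑ i, ∫ q in frontier U, flux U (Ji i) q ∂μHE[n] := by
      rw [← integral_finsetSum _ fun i _ => (hloc i).1]
      refine setIntegral_congr_fun hfm fun q _ => ?_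
      simp only [flux]
      rw [hsum q, map_sum, Finset.sum_div]
    have s3 : ∫ q in frontier U, ‖J q‖ ∂μHE[n] =
        ∑ i, ∫ q in frontier U, ‖Ji i q‖ ∂μHE[n] := by
      rw [← integral_finsetSum _ fun i _ => (hloc i).2.1]
      exact setIntegral_congr_fun hfm fun q _ => hsumn q
    rw [s1, s2, s3, ← Finset.sum_sub_distrib, Finset.mul_sum]
    exact (Finset.abs_sum_le_sum_abs _ _).trans (Finset.sum_le_sum fun i _ => (hloc i).2.2)
  -- The two sides of the divergence theorem do not depend on C, so letting C decrease to 1 gives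
  -- equality.
  have hlim : Tendsto (fun x : ℝ => 3 * (x - 1) * x ^ 2 * ∫ q in frontier U, ‖J q‖ ∂μHE[n])
      (𝓝[>] 1) (𝓝 0) := by
    have : ContinuousAt (fun x : ℝ => 3 * (x - 1) * x ^ 2 *
      ∫ q in frontier U, ‖J q‖ ∂μHE[n]) 1 := by fun_prop
    have h := this.tendsto
    simp only [sub_self, mul_zero, zero_mul] at h
    exact h.mono_left nhdsWithin_le_nhds
  have h0 : |(∫ q in U, divergence J q) - ∫ q in frontier U, flux U J q ∂μHE[n]| ≤ 0 := by
    refine ge_of_tendsto hlim ?_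
    filter_upwards [self_mem_nhdsWithin] with x hx
    have hx' : (1 : ℝ) < x := hx
    have := key ⟨x, by linarith⟩ hx'
    exact this
  exact sub_eq_zero.1 (abs_nonpos_iff.1 h0)

end Mink

end

/-! ### Divergence theorem on the closure, partial derivatives, and the energy identity. -/

noncomputable section

namespace Mink

variable {n : ℕ}

/-- The divergence theorem for a vector field that is continuous on the closure of a domain with
smooth boundary, vanishes off a compact set, and has an integrable divergence. -/
theorem integral_divergence {U : Set (Spacetime n)} (hU : IsOpen U)
    (hb : ∀ p ∈ frontier U, ∃ ρ, IsDefiningFunctionAt U p ρ)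
    {J : Spacetime n → Spacetime n} (hJ : ContinuousOn J (closure U)) {K : Set (Spacetime n)}
    (hK : IsCompact K) (hJK : ∀ p ∈ closure U, p ∉ K → J p = 0)
    (hJd : ContDiffOn ℝ 1 J U) (hint : IntegrableOn (divergence J) U) :
    ∫ q in U, divergence J q = ∫ q in frontier U, flux U J q ∂μHE[n] := by
  obtain ⟨g, hg⟩ := ContinuousMap.exists_restrict_eq isClosed_closure
    (⟨(closure U).domRestrict J, hJ.domRestrict⟩ : C(closure U, Spacetime n))
  have hg' : ∀ p ∈ closure U, g p = J p := fun p hp => congrArg (fun h => h ⟨p, hp⟩) hg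
  obtain ⟨R, hR⟩ := hK.isBounded.subset_closedBall 0
  -- Continuity of χ and of the Tietze extension g is enough: the new field agrees with J on the
  -- closure of U, so its differentiability in U is inherited.
  let χ : Spacetime n → ℝ := fun p => 1 - cutoff (‖p‖ - R)
  have hχc : Continuous χ := by
    have := contDiff_cutoff.continuous
    fun_prop
  let J' : Spacetime n → Spacetime n := fun p => χ p • g p
  have hJJ : ∀ p ∈ closure U, J' p = J p := by
    intro p hp
    by_cases hpK : p ∈ K
    · have h1 := hR hpK
      rw [mem_closedBall_zero_iff] at h1
      simp only [J', χ, hg' p hp]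
      rw [cutoff_of_le (by linarith)]
      simp
    · simp [J', hg' p hp, hJK p hp hpK]
  have hloc : ∀ p ∈ U, J' =ᶠ[𝓝 p] J := fun p hp => by
    filter_upwards [hU.mem_nhds hp] with q hq using hJJ q (subset_closure hq)
  have hdiv : ∀ p ∈ U, divergence J' p = divergence J p := by
    intro p hp
    refine Finset.sum_congr rfl fun k _ => ?_
    simp only [pd]
    rw [Filter.EventuallyEq.fderiv_eq]
    filter_upwards [hloc p hp] with q hq
    rw [hq]
  have hJ's : HasCompactSupport J' := by
    refine HasCompactSupport.intro (isCompact_closedBall (0 : Spacetime n) (R + 2)) fun p hp => ?_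
    rw [mem_closedBall_zero_iff, not_le] at hp
    simp only [J', χ]
    rw [cutoff_of_ge (by linarith)]
    simp
  have := integral_divergence_of_continuous (J := J') hU hb (hχc.smul g.continuous) hJ's
    (hJd.congr fun p hp => hJJ p (subset_closure hp))
    (hint.congr_fun (fun p hp => (hdiv p hp).symm) hU.measurableSet)
  rw [← setIntegral_congr_fun hU.measurableSet hdiv, this]
  refine setIntegral_congr_fun isClosed_frontier.measurableSet fun p hp => ?_
  simp only [flux]
  rw [← hJJ p (frontier_subset_closure hp)]

/-! ### Partial derivatives -/

/-- The diagonal entries of the Minkowski metric. -/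
def sg (k : Fin (n + 1)) : ℝ := if k = 0 then -1 else 1

@[simp] theorem sg_zero : sg (0 : Fin (n + 1)) = -1 := by simp [sg]

@[simp] theorem sg_succ (i : Fin n) : sg i.succ = 1 := by simp [sg]

theorem sg_mul_self (k : Fin (n + 1)) : sg k * sg k = 1 := by
  unfold sg; split_ifs <;> norm_num

theorem box_eq_sum (h : Spacetime n → ℝ) (p : Spacetime n) :
    box h p = ∑ k, sg k * pd k (pd k h) p := by
  simp [box, Fin.sum_univ_succ]

theorem metric_eq_sum (X Y : Spacetime n) : metric X Y = ∑ k, sg k * (X k * Y k) := by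
  simp [metric, Fin.sum_univ_succ]

theorem pd_add {f g : Spacetime n → ℝ} {p : Spacetime n} (hf : DifferentiableAt ℝ f p)
    (hg : DifferentiableAt ℝ g p) (k : Fin (n + 1)) :
    pd k (fun q => f q + g q) p = pd k f p + pd k g p := by
  simp [pd, fderiv_fun_add hf hg]

theorem pd_sub {f g : Spacetime n → ℝ} {p : Spacetime n} (hf : DifferentiableAt ℝ f p)
    (hg : DifferentiableAt ℝ g p) (k : Fin (n + 1)) :
    pd k (fun q => f q - g q) p = pd k f p - pd k g p := by
  simp [pd, fderiv_fun_sub hf hg]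

theorem pd_const_mul {f : Spacetime n → ℝ} {p : Spacetime n} (hf : DifferentiableAt ℝ f p)
    (c : ℝ) (k : Fin (n + 1)) : pd k (fun q => c * f q) p = c * pd k f p := by
  simp [pd, fderiv_const_mul hf]

theorem pd_sum {ι : Type*} {s : Finset ι} {f : ι → Spacetime n → ℝ} {p : Spacetime n}
    (hf : ∀ i ∈ s, DifferentiableAt ℝ (f i) p) (k : Fin (n + 1)) :
    pd k (fun q => ∑ i ∈ s, f i q) p = ∑ i ∈ s, pd k (f i) p := by
  simp [pd, fderiv_fun_sum hf]

theorem pd_congr {f g : Spacetime n → ℝ} {p : Spacetime n} (h : f =ᶠ[𝓝 p] g) (k : Fin (n + 1)) :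
    pd k f p = pd k g p := by
  simp [pd, h.fderiv_eq]

theorem contDiffAt_pd {h : Spacetime n → ℝ} {p : Spacetime n} (hh : ContDiffAt ℝ 2 h p)
    (k : Fin (n + 1)) : ContDiffAt ℝ 1 (pd k h) p :=
  (hh.fderiv_right (m := 1) (by norm_num)).clm_apply contDiffAt_const

theorem differentiableAt_pd {h : Spacetime n → ℝ} {p : Spacetime n} (hh : ContDiffAt ℝ 2 h p)
    (k : Fin (n + 1)) : DifferentiableAt ℝ (pd k h) p :=
  (contDiffAt_pd hh k).differentiableAt (by simp)

theorem pd_pd_comm {h : Spacetime n → ℝ} {p : Spacetime n} (hh : ContDiffAt ℝ 2 h p)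
    (j k : Fin (n + 1)) : pd j (pd k h) p = pd k (pd j h) p := by
  have hd : DifferentiableAt ℝ (fderiv ℝ h) p :=
    (hh.fderiv_right (m := 1) (by norm_num)).differentiableAt (by simp)
  have e : ∀ j k : Fin (n + 1), pd j (pd k h) p = fderiv ℝ (fderiv ℝ h) p
      (EuclideanSpace.single j 1) (EuclideanSpace.single k 1) := by
    intro j k
    have : HasFDerivAt (pd k h) _ p := hd.hasFDerivAt.clm_apply (hasFDerivAt_const _ p)
    rw [pd, this.fderiv]
    simp
  rw [e, e]
  exact hh.isSymmSndFDerivAt (by simp) _ _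

/-- The energy current of `ψ` for the multiplier `S ψ + q ψ`, with a zeroth order correction. -/
def energyCurrent (S : Spacetime n → Spacetime n) (q B ψ : Spacetime n → ℝ) (p : Spacetime n) :
    Spacetime n := WithLp.toLp 2 fun k =>
  sg k * pd k ψ p * ((∑ j, S p j * pd j ψ p) + q p * ψ p) -
    1 / 2 * (S p k * ∑ j, sg j * (pd j ψ p * pd j ψ p)) -
    1 / 2 * (ψ p * ψ p * (sg k * pd k q p)) + B p * (ψ p * ψ p) * S p k

/-- The energy identity for the multiplier Sψ + qψ, with the divergence of Bψ²S added. The function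
B is a free parameter, used later to complete a square. -/
theorem divergence_energyCurrent {S : Spacetime n → Spacetime n} {q B ψ : Spacetime n → ℝ}
    {p : Spacetime n} (hψ : ContDiffAt ℝ 2 ψ p) (hq : ContDiffAt ℝ 2 q p)
    (hS : ∀ k, DifferentiableAt ℝ (fun x => S x k) p) (hB : DifferentiableAt ℝ B p) :
    divergence (energyCurrent S q B ψ) p =
      box ψ p * ((∑ j, S p j * pd j ψ p) + q p * ψ p) +
      (∑ k, ∑ j, sg k * pd k ψ p * pd j ψ p * pd k (fun x => S x j) p) -
      (1 / 2 * divergence S p - q p) * (∑ j, sg j * (pd j ψ p * pd j ψ p)) -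
      1 / 2 * box q p * (ψ p * ψ p) +
      ((∑ k, S p k * pd k B p) + B p * divergence S p) * (ψ p * ψ p) +
      2 * B p * ψ p * ∑ j, S p j * pd j ψ p := by
  have hψ0 : DifferentiableAt ℝ ψ p := hψ.differentiableAt (by simp)
  have hq0 : DifferentiableAt ℝ q p := hq.differentiableAt (by simp)
  have hψ1 : ∀ k, DifferentiableAt ℝ (pd k ψ) p := differentiableAt_pd hψ
  have hq1 : ∀ k, DifferentiableAt ℝ (pd k q) p := differentiableAt_pd hq
  have term : ∀ k, pd k (fun x => energyCurrent S q B ψ x k) p =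
      sg k * pd k (pd k ψ) p * ((∑ j, S p j * pd j ψ p) + q p * ψ p) +
      sg k * pd k ψ p * ((∑ j, (pd k (fun x => S x j) p * pd j ψ p + S p j * pd k (pd j ψ) p)) +
        (pd k q p * ψ p + q p * pd k ψ p)) -
      1 / 2 * (pd k (fun x => S x k) p * (∑ j, sg j * (pd j ψ p * pd j ψ p)) +
        S p k * ∑ j, sg j * (pd k (pd j ψ) p * pd j ψ p + pd j ψ p * pd k (pd j ψ) p)) -
      1 / 2 * ((pd k ψ p * ψ p + ψ p * pd k ψ p) * (sg k * pd k q p) +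
        ψ p * ψ p * (sg k * pd k (pd k q) p)) +
      ((pd k B p * (ψ p * ψ p) + B p * (pd k ψ p * ψ p + ψ p * pd k ψ p)) * S p k +
        B p * (ψ p * ψ p) * pd k (fun x => S x k) p) := by
    intro k
    simp only [energyCurrent]
    rw [pd_add (by fun_prop) (by fun_prop), pd_sub (by fun_prop) (by fun_prop),
      pd_sub (by fun_prop) (by fun_prop), pd_mul (by fun_prop) (by fun_prop),
      pd_const_mul (by fun_prop), pd_add (by fun_prop) (by fun_prop),
      pd_sum (fun i _ => by fun_prop), pd_mul hq0 hψ0,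
      pd_const_mul (by fun_prop), pd_mul (hS k) (by fun_prop), pd_sum (fun i _ => by fun_prop),
      pd_const_mul (by fun_prop), pd_mul (by fun_prop) (by fun_prop), pd_mul hψ0 hψ0,
      pd_const_mul (by fun_prop), pd_mul (by fun_prop) (hS k), pd_mul hB (by fun_prop),
      pd_mul hψ0 hψ0]
    have e1 : ∀ j, pd k (fun x => S x j * pd j ψ x) p =
      pd k (fun x => S x j) p * pd j ψ p + S p j * pd k (pd j ψ) p :=
      fun j => pd_mul (hS j) (hψ1 j) k
    have e2 : ∀ j, pd k (fun x => sg j * (pd j ψ x * pd j ψ x)) p =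
      sg j * (pd k (pd j ψ) p * pd j ψ p + pd j ψ p * pd k (pd j ψ) p) := by
      intro j
      rw [pd_const_mul (by fun_prop), pd_mul (hψ1 j) (hψ1 j)]
    simp_rw [e1, e2]
  -- By symmetry of the Hessian, the second derivatives from differentiating Sψ cancel those from
  -- differentiating |∇ψ|², so only □ψ remains.
  have swap : ∑ k, sg k * pd k ψ p * ∑ j, S p j * pd k (pd j ψ) p =
      ∑ k, S p k * ∑ j, sg j * (pd j ψ p * pd k (pd j ψ) p) := by
    simp_rw [Finset.mul_sum]
    rw [Finset.sum_comm]
    refine Finset.sum_congr rfl fun k _ => Finset.sum_congr rfl fun j _ => ?_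
    rw [pd_pd_comm hψ j k]
    ring
  rw [divergence]
  simp_rw [term]
  rw [box_eq_sum, box_eq_sum, divergence]
  set Q := ∑ j, sg j * (pd j ψ p * pd j ψ p) with hQ
  set T := ∑ j, S p j * pd j ψ p with hT
  have r1 : ∀ k, sg k * pd k (pd k ψ) p * (T + q p * ψ p) +
      sg k * pd k ψ p * ((∑ j, (pd k (fun x => S x j) p * pd j ψ p + S p j * pd k (pd j ψ) p)) +
        (pd k q p * ψ p + q p * pd k ψ p)) -
      1 / 2 * (pd k (fun x => S x k) p * Q +
        S p k * ∑ j, sg j * (pd k (pd j ψ) p * pd j ψ p + pd j ψ p * pd k (pd j ψ) p)) -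
      1 / 2 * ((pd k ψ p * ψ p + ψ p * pd k ψ p) * (sg k * pd k q p) +
        ψ p * ψ p * (sg k * pd k (pd k q) p)) +
      ((pd k B p * (ψ p * ψ p) + B p * (pd k ψ p * ψ p + ψ p * pd k ψ p)) * S p k +
        B p * (ψ p * ψ p) * pd k (fun x => S x k) p) =
      (T + q p * ψ p) * (sg k * pd k (pd k ψ) p) +
      (∑ j, sg k * pd k ψ p * pd j ψ p * pd k (fun x => S x j) p) +
      (sg k * pd k ψ p * ∑ j, S p j * pd k (pd j ψ) p) -
      (S p k * ∑ j, sg j * (pd j ψ p * pd k (pd j ψ) p)) +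
      q p * (sg k * (pd k ψ p * pd k ψ p)) -
      (1 / 2 * Q) * pd k (fun x => S x k) p -
      (1 / 2 * (ψ p * ψ p)) * (sg k * pd k (pd k q) p) +
      (ψ p * ψ p) * (S p k * pd k B p) + (B p * (ψ p * ψ p)) * pd k (fun x => S x k) p +
      (2 * B p * ψ p) * (S p k * pd k ψ p) := by
    intro k
    have a1 : ∑ j, sg j * (pd k (pd j ψ) p * pd j ψ p + pd j ψ p * pd k (pd j ψ) p) =
        2 * ∑ j, sg j * (pd j ψ p * pd k (pd j ψ) p) := by
      rw [Finset.mul_sum]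
      exact Finset.sum_congr rfl fun j _ => by ring
    have a2 : ∑ j, sg k * pd k ψ p * pd j ψ p * pd k (fun x => S x j) p =
        sg k * pd k ψ p * ∑ j, pd k (fun x => S x j) p * pd j ψ p := by
      rw [Finset.mul_sum]
      exact Finset.sum_congr rfl fun j _ => by ring
    rw [a1, a2, Finset.sum_add_distrib]
    ring
  simp_rw [r1]
  simp only [Finset.sum_add_distrib, Finset.sum_sub_distrib, ← Finset.mul_sum]
  simp only [Finset.mul_sum] at swap ⊢
  rw [swap]
  simp only [← Finset.mul_sum, ← hQ, ← hT]
  ring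

end Mink

end

/-! ### Product rule for □ and the calculus of t_P, r_P and f_P. -/

noncomputable section

namespace Mink

variable {n : ℕ}

theorem two_le_infty : (2 : WithTop ℕ∞) ≤ ∞ := by
  exact WithTop.coe_le_coe.2 (le_top : (2 : ℕ∞) ≤ ⊤)

theorem box_mul {f g : Spacetime n → ℝ} {p : Spacetime n} (hf : ContDiffAt ℝ 2 f p)
    (hg : ContDiffAt ℝ 2 g p) : box (fun x => f x * g x) p =
      f p * box g p + 2 * ∑ k, sg k * (pd k f p * pd k g p) + g p * box f p := by
  have hf0 : ∀ᶠ x in 𝓝 p, DifferentiableAt ℝ f x :=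
    (hf.eventually (by simp)).mono fun x hx => hx.differentiableAt (by simp)
  have hg0 : ∀ᶠ x in 𝓝 p, DifferentiableAt ℝ g x :=
    (hg.eventually (by simp)).mono fun x hx => hx.differentiableAt (by simp)
  have hf1 := differentiableAt_pd hf
  have hg1 := differentiableAt_pd hg
  have hfp := hf0.self_of_nhds
  have hgp := hg0.self_of_nhds
  have h : ∀ k, pd k (pd k fun x => f x * g x) p =
      pd k (pd k f) p * g p + 2 * (pd k f p * pd k g p) + f p * pd k (pd k g) p := by
    intro k
    have e : (pd k fun x => f x * g x) =ᶠ[𝓝 p] fun x => pd k f x * g x + f x * pd k g x := by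
      filter_upwards [hf0, hg0] with x h1 h2 using pd_mul h1 h2 k
    rw [pd_congr e, pd_add (by fun_prop) (by fun_prop), pd_mul (hf1 k) hgp, pd_mul hfp (hg1 k)]
    ring
  rw [box_eq_sum, box_eq_sum, box_eq_sum, Finset.mul_sum, Finset.mul_sum, Finset.mul_sum,
    ← Finset.sum_add_distrib, ← Finset.sum_add_distrib]
  refine Finset.sum_congr rfl fun k _ => ?_
  rw [h]
  ring

theorem pd_apply (k j : Fin (n + 1)) (p : Spacetime n) :
    pd k (fun q => q j) p = if j = k then 1 else 0 := by
  have : HasFDerivAt (fun q : Spacetime n => q j) (EuclideanSpace.proj j : Spacetime n →L[ℝ] ℝ) p :=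
    (EuclideanSpace.proj j : Spacetime n →L[ℝ] ℝ).hasFDerivAt
  rw [pd, this.fderiv]
  simp

theorem contDiff_apply_coord (j : Fin (n + 1)) : ContDiff ℝ ∞ (fun q : Spacetime n => q j) :=
  (EuclideanSpace.proj j : Spacetime n →L[ℝ] ℝ).contDiff

theorem pd_const (k : Fin (n + 1)) (c : ℝ) (p : Spacetime n) : pd k (fun _ => c) p = 0 := by
  simp [pd]

/-- The spatial coordinates relative to `P`. -/
def xP (P p : Spacetime n) (i : Fin n) : ℝ := p i.succ - P i.succ

theorem rP_sq (P p : Spacetime n) : rP P p ^ 2 = ∑ i, xP P p i * xP P p i := by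
  rw [rP, EuclideanSpace.norm_sq_eq]
  refine Finset.sum_congr rfl fun i _ => ?_
  simp [space, xP, sq]

theorem fP_eq (P p : Spacetime n) : fP P p = (rP P p ^ 2 - tP P p ^ 2) / 4 := by
  simp only [fP, uP, vP]; ring

theorem rP_nonneg (P p : Spacetime n) : 0 ≤ rP P p := norm_nonneg _

theorem abs_tP_lt {P p : Spacetime n} (h : 0 < fP P p) : |tP P p| < rP P p := by
  rw [fP_eq] at h
  exact abs_lt_of_sq_lt_sq (by linarith) (rP_nonneg _ _)

theorem rP_pos {P p : Spacetime n} (h : 0 < fP P p) : 0 < rP P p :=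
  lt_of_le_of_lt (abs_nonneg _) (abs_tP_lt h)

theorem fP_le (P p : Spacetime n) : fP P p ≤ rP P p ^ 2 / 4 := by
  rw [fP_eq]; nlinarith [sq_nonneg (tP P p)]

theorem omega_eq (P p : Spacetime n) (i : Fin n) : omega P p i = xP P p i / rP P p := rfl

theorem contDiff_tP (P : Spacetime n) : ContDiff ℝ ∞ (tP P) :=
  (contDiff_apply_coord 0).sub contDiff_const

theorem contDiff_xP (P : Spacetime n) (i : Fin n) : ContDiff ℝ ∞ (fun p => xP P p i) :=
  (contDiff_apply_coord i.succ).sub contDiff_const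

theorem contDiff_rP_sq (P : Spacetime n) : ContDiff ℝ ∞ (fun p => rP P p ^ 2) := by
  simp_rw [rP_sq]
  exact ContDiff.sum fun i _ => (contDiff_xP P i).mul (contDiff_xP P i)

theorem contDiff_fP (P : Spacetime n) : ContDiff ℝ ∞ (fP P) := by
  have : fP P = fun p => (rP P p ^ 2 - tP P p ^ 2) / 4 := funext fun p => fP_eq P p
  rw [this]
  exact ((contDiff_rP_sq P).sub ((contDiff_tP P).pow 2)).div_const _

theorem contDiffAt_rP {P p : Spacetime n} (h : 0 < rP P p) : ContDiffAt ℝ ∞ (rP P) p := by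
  have h1 : (rP P) = fun p => √(rP P p ^ 2) :=
    funext fun q => (Real.sqrt_sq (rP_nonneg P q)).symm
  rw [h1]
  exact (contDiff_rP_sq P).contDiffAt.sqrt (by positivity)

theorem continuous_rP (P : Spacetime n) : Continuous (rP P) := by
  have h1 : (rP P) = fun p => √(rP P p ^ 2) :=
    funext fun q => (Real.sqrt_sq (rP_nonneg P q)).symm
  rw [h1]
  exact (contDiff_rP_sq P).continuous.sqrt

theorem pd_tP_zero (P p : Spacetime n) : pd 0 (tP P) p = 1 := by
  have := pd_sub (k := 0) ((contDiff_apply_coord (n := n) 0).differentiable (by simp) p)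
    (differentiableAt_const (P 0))
  rw [pd_apply, pd_const] at this
  simp only [↓reduceIte, sub_zero] at this
  exact this

theorem pd_tP_succ (P p : Spacetime n) (i : Fin n) : pd i.succ (tP P) p = 0 := by
  have := pd_sub (k := i.succ) ((contDiff_apply_coord (n := n) 0).differentiable (by simp) p)
    (differentiableAt_const (P 0))
  rw [pd_apply, pd_const] at this
  simp only [(Fin.succ_ne_zero i).symm, ↓reduceIte, sub_zero] at this
  exact this

theorem pd_xP_zero (P p : Spacetime n) (i : Fin n) : pd 0 (fun q => xP P q i) p = 0 := by
  have := pd_sub (k := 0) ((contDiff_apply_coord (n := n) i.succ).differentiable (by simp) p)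
    (differentiableAt_const (P i.succ))
  rw [pd_apply, pd_const] at this
  simpa [xP, Fin.succ_ne_zero i] using this

theorem pd_xP_succ (P p : Spacetime n) (i j : Fin n) :
    pd j.succ (fun q => xP P q i) p = if i = j then 1 else 0 := by
  have := pd_sub (k := j.succ) ((contDiff_apply_coord (n := n) i.succ).differentiable (by simp) p)
    (differentiableAt_const (P i.succ))
  rw [pd_apply, pd_const] at this
  simpa [xP] using this

theorem pd_rP_sq_zero (P p : Spacetime n) : pd 0 (fun q => rP P q ^ 2) p = 0 := by
  simp_rw [rP_sq]
  have hd : ∀ i, DifferentiableAt ℝ (fun q => xP P q i) p := fun i =>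
    (contDiff_xP P i).differentiable (by simp) p
  rw [pd_sum fun i _ => by fun_prop]
  exact Finset.sum_eq_zero fun i _ => by rw [pd_mul (hd i) (hd i), pd_xP_zero]; ring

theorem pd_rP_sq_succ (P p : Spacetime n) (j : Fin n) :
    pd j.succ (fun q => rP P q ^ 2) p = 2 * xP P p j := by
  simp_rw [rP_sq]
  have hd : ∀ i, DifferentiableAt ℝ (fun q => xP P q i) p := fun i =>
    (contDiff_xP P i).differentiable (by simp) p
  rw [pd_sum fun i _ => by fun_prop]
  have : ∀ i, pd j.succ (fun q => xP P q i * xP P q i) p = if i = j then 2 * xP P p i else 0 := by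
    intro i
    rw [pd_mul (hd i) (hd i), pd_xP_succ]
    split_ifs <;> ring
  simp_rw [this]
  simp

theorem pd_fP_aux (P p : Spacetime n) (k : Fin (n + 1)) :
    pd k (fP P) p = (pd k (fun q => rP P q ^ 2) p - 2 * tP P p * pd k (tP P) p) / 4 := by
  have : fP P = fun p => (1 / 4) * (rP P p ^ 2 - tP P p * tP P p) :=
    funext fun p => by rw [fP_eq]; ring
  have h1 : DifferentiableAt ℝ (fun q => rP P q ^ 2) p := (contDiff_rP_sq P).differentiable (by simp) p
  have h2 : DifferentiableAt ℝ (tP P) p := (contDiff_tP P).differentiable (by simp) p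
  rw [this, pd_const_mul (by fun_prop), pd_sub h1 (by fun_prop), pd_mul h2 h2]
  ring

theorem pd_fP_zero (P p : Spacetime n) : pd 0 (fP P) p = -(tP P p / 2) := by
  rw [pd_fP_aux, pd_rP_sq_zero, pd_tP_zero]; ring

theorem pd_fP_succ (P p : Spacetime n) (i : Fin n) : pd i.succ (fP P) p = xP P p i / 2 := by
  rw [pd_fP_aux, pd_rP_sq_succ, pd_tP_succ]; ring

theorem pd_rP_sq_eq {P p : Spacetime n} (h : 0 < rP P p) (k : Fin (n + 1)) :
    pd k (fun q => rP P q ^ 2) p = 2 * rP P p * pd k (rP P) p := by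
  have hd : DifferentiableAt ℝ (rP P) p := (contDiffAt_rP h).differentiableAt (by simp)
  simp_rw [sq]
  rw [pd_mul hd hd]
  ring

theorem pd_rP_zero {P p : Spacetime n} (h : 0 < rP P p) : pd 0 (rP P) p = 0 := by
  have := pd_rP_sq_eq h 0
  rw [pd_rP_sq_zero] at this
  have h2 : (2 * rP P p) ≠ 0 := by positivity
  exact (mul_eq_zero.1 this.symm).resolve_left h2

theorem pd_rP_succ {P p : Spacetime n} (h : 0 < rP P p) (i : Fin n) :
    pd i.succ (rP P) p = omega P p i := by
  have := pd_rP_sq_eq h i.succ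
  rw [pd_rP_sq_succ] at this
  rw [omega_eq]
  field_simp
  linarith

theorem sum_omega_sq {P p : Spacetime n} (h : 0 < rP P p) :
    ∑ i, omega P p i * omega P p i = 1 := by
  simp_rw [omega_eq]
  have : ∀ i, xP P p i / rP P p * (xP P p i / rP P p) = xP P p i * xP P p i / rP P p ^ 2 := by
    intro i; field_simp
  simp_rw [this]
  rw [← Finset.sum_div, ← rP_sq]
  field_simp

theorem xP_eq {P p : Spacetime n} (h : 0 < rP P p) (i : Fin n) :
    xP P p i = rP P p * omega P p i := by
  rw [omega_eq]; field_simp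

theorem inner_pd_fP_fP (P p : Spacetime n) : ∑ k, sg k * (pd k (fP P) p * pd k (fP P) p) = fP P p := by
  rw [Fin.sum_univ_succ]
  simp_rw [pd_fP_zero, pd_fP_succ, sg_zero, sg_succ]
  have : ∀ i, 1 * (xP P p i / 2 * (xP P p i / 2)) = xP P p i * xP P p i / 4 := fun i => by ring
  simp_rw [this]
  rw [← Finset.sum_div, ← rP_sq, fP_eq]
  ring

theorem inner_pd_fP_rP {P p : Spacetime n} (h : 0 < rP P p) :
    ∑ k, sg k * (pd k (fP P) p * pd k (rP P) p) = rP P p / 2 := by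
  rw [Fin.sum_univ_succ]
  simp_rw [pd_fP_zero, pd_fP_succ, sg_zero, sg_succ, pd_rP_zero h, pd_rP_succ h, xP_eq h]
  have : ∀ i, 1 * (rP P p * omega P p i / 2 * omega P p i) =
    rP P p / 2 * (omega P p i * omega P p i) := fun i => by ring
  simp_rw [this]
  rw [← Finset.mul_sum, sum_omega_sq h]
  ring

theorem inner_pd_rP_rP {P p : Spacetime n} (h : 0 < rP P p) :
    ∑ k, sg k * (pd k (rP P) p * pd k (rP P) p) = 1 := by
  rw [Fin.sum_univ_succ]
  simp_rw [sg_zero, sg_succ, pd_rP_zero h, pd_rP_succ h, one_mul]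
  rw [sum_omega_sq h]
  ring

theorem eventually_rP_pos {P p : Spacetime n} (h : 0 < rP P p) : ∀ᶠ q in 𝓝 p, 0 < rP P q :=
  (continuous_rP P).continuousAt.eventually_const_lt h

theorem box_rP_sq (P p : Spacetime n) : box (fun q => rP P q ^ 2) p = 2 * n := by
  have e0 : pd 0 (fun q => rP P q ^ 2) = fun _ => 0 := funext fun q => pd_rP_sq_zero P q
  have ei : ∀ i : Fin n, pd i.succ (fun q => rP P q ^ 2) = fun q => 2 * xP P q i :=
    fun i => funext fun q => pd_rP_sq_succ P q i
  have e2 : ∀ i : Fin n, pd i.succ (fun q => 2 * xP P q i) p = 2 := by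
    intro i
    rw [pd_const_mul ((contDiff_xP P i).differentiable (by simp) p), pd_xP_succ]
    simp
  simp [box, e0, ei, pd_const, e2]
  ring

theorem box_fP (P p : Spacetime n) : box (fP P) p = (n + 1) / 2 := by
  have e0 : pd 0 (fP P) = fun q => (-1 / 2) * tP P q := funext fun q => by rw [pd_fP_zero]; ring
  have ei : ∀ i : Fin n, pd i.succ (fP P) = fun q => (1 / 2) * xP P q i :=
    fun i => funext fun q => by rw [pd_fP_succ]; ring
  have e1 : pd 0 (fun q => (-1 / 2) * tP P q) p = -1 / 2 := by
    rw [pd_const_mul ((contDiff_tP P).differentiable (by simp) p), pd_tP_zero]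
    ring
  have e2 : ∀ i : Fin n, pd i.succ (fun q => (1 / 2) * xP P q i) p = 1 / 2 := by
    intro i
    rw [pd_const_mul ((contDiff_xP P i).differentiable (by simp) p), pd_xP_succ]
    simp
  simp only [box, e0, ei, e1, e2]
  simp
  ring

/-- The product rule for □ applied to r², with □(r²) = 2n and g(∇r, ∇r) = 1. -/
theorem box_rP {P p : Spacetime n} (h : 0 < rP P p) : box (rP P) p = (n - 1) / rP P p := by
  have h2 : ContDiffAt ℝ 2 (rP P) p := (contDiffAt_rP h).of_le two_le_infty
  have h1 := box_mul h2 h2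
  have h3 := box_rP_sq P p
  simp_rw [sq] at h3
  rw [h3, inner_pd_rP_rP h] at h1
  field_simp
  linarith

theorem contDiffAt_fP_div_rP {P p : Spacetime n} (h : 0 < rP P p) :
    ContDiffAt ℝ ∞ (fun q => fP P q / rP P q) p :=
  (contDiff_fP P).contDiffAt.div (contDiffAt_rP h) h.ne'

theorem pd_fP_div_rP {P p : Spacetime n} (h : 0 < rP P p) (k : Fin (n + 1)) :
    pd k (fun q => fP P q / rP P q) p =
      pd k (fP P) p / rP P p - fP P p / rP P p ^ 2 * pd k (rP P) p := by
  have hr : DifferentiableAt ℝ (rP P) p := (contDiffAt_rP h).differentiableAt (by simp)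
  have hq : DifferentiableAt ℝ (fun q => fP P q / rP P q) p :=
    (contDiffAt_fP_div_rP h).differentiableAt (by simp)
  have e : fP P =ᶠ[𝓝 p] fun q => rP P q * (fP P q / rP P q) := by
    filter_upwards [eventually_rP_pos h] with q hq
    field_simp
  have h1 := pd_congr e k
  rw [pd_mul hr hq] at h1
  rw [h1]
  field_simp
  ring

theorem box_congr {f g : Spacetime n → ℝ} {p : Spacetime n} (h : f =ᶠ[𝓝 p] g) :
    box f p = box g p := by
  have : ∀ k, pd k f =ᶠ[𝓝 p] pd k g := fun k => by
    filter_upwards [h.eventually_nhds] with q hq using pd_congr hq k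
  rw [box_eq_sum, box_eq_sum]
  exact Finset.sum_congr rfl fun k _ => by rw [pd_congr (this k)]

/-- The product rule for □ applied to f = r · (f/r), solved for □(f/r). -/
theorem box_fP_div_rP {P p : Spacetime n} (h : 0 < rP P p) :
    box (fun q => fP P q / rP P q) p =
      (n - 1) / (2 * rP P p) + (3 - n) * fP P p / rP P p ^ 3 := by
  have hr : ContDiffAt ℝ 2 (rP P) p := (contDiffAt_rP h).of_le two_le_infty
  have hq : ContDiffAt ℝ 2 (fun q => fP P q / rP P q) p :=
    (contDiffAt_fP_div_rP h).of_le two_le_infty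
  have e : fP P =ᶠ[𝓝 p] fun q => rP P q * (fP P q / rP P q) := by
    filter_upwards [eventually_rP_pos h] with q hq
    field_simp
  have h1 := box_congr e
  have h2 : ∑ k, sg k * (pd k (rP P) p * pd k (fun q => fP P q / rP P q) p) =
      1 / 2 - fP P p / rP P p ^ 2 := by
    have : ∀ k, sg k * (pd k (rP P) p * pd k (fun q => fP P q / rP P q) p) =
        (rP P p)⁻¹ * (sg k * (pd k (fP P) p * pd k (rP P) p)) -
        fP P p / rP P p ^ 2 * (sg k * (pd k (rP P) p * pd k (rP P) p)) := by
      intro k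
      rw [pd_fP_div_rP h]
      ring
    simp_rw [this]
    rw [Finset.sum_sub_distrib, ← Finset.mul_sum, ← Finset.mul_sum, inner_pd_fP_rP h,
      inner_pd_rP_rP h]
    field_simp
  rw [box_mul hr hq, h2, box_rP h, box_fP] at h1
  field_simp at h1 ⊢
  linarith

end Mink

end

noncomputable section

namespace Mink

variable {n : ℕ}

/-! ### Coefficient functions of the Carleman estimate, as functions of `(r, f)` -/

/-- The product `(1 + ε u) (1 - ε v)`. -/
def cD (ε r f : ℝ) : ℝ := 1 - ε * r + ε ^ 2 * f

/-- The square root of the warped hyperbolic function. -/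
def cY (ε r f : ℝ) : ℝ := √(f / cD ε r f)

/-- The correction to the zeroth order part of the multiplier. -/
def cW (ε r f : ℝ) : ℝ := ε * f / (2 * r)

/-- The proportionality factor between the differential of the exponent and the multiplier. -/
def cG (a b ε r f : ℝ) : ℝ := a * (1 + b * cY ε r f) / (f * cD ε r f)

/-- The coefficient of the zeroth order part of the current. -/
def cB (a b ε r f : ℝ) : ℝ :=
  (a ^ 2 * (1 / cY ε r f ^ 2 + 2 * b / cY ε r f + b ^ 2) / 2 - a * b / (4 * cY ε r f) -
    cW ε r f * (a * (1 + b * cY ε r f) / cY ε r f ^ 2)) / cD ε r f ^ 2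

/-- The square root of the Carleman weight. -/
def cE (a b ε r f : ℝ) : ℝ := Real.exp (a * (Real.log (f / cD ε r f) + 2 * b * cY ε r f))

section Curves

variable {a b ε r f r' f' s : ℝ} {R F : ℝ → ℝ}

theorem cY_pos (hf : 0 < f) (hD : 0 < cD ε r f) : 0 < cY ε r f :=
  Real.sqrt_pos.2 (div_pos hf hD)

theorem cY_sq (hf : 0 < f) (hD : 0 < cD ε r f) : cY ε r f ^ 2 = f / cD ε r f :=
  Real.sq_sqrt (div_pos hf hD).le

theorem hasDerivAt_cD (hR : HasDerivAt R r' s) (hF : HasDerivAt F f' s) :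
    HasDerivAt (fun x => cD ε (R x) (F x)) (-(ε * r') + ε ^ 2 * f') s := by
  have := ((hasDerivAt_const s (1 : ℝ)).sub (hR.const_mul ε)).add (hF.const_mul (ε ^ 2))
  refine this.congr_deriv ?_
  ring

theorem hasDerivAt_div_cD (hR : HasDerivAt R r' s) (hF : HasDerivAt F f' s) (hRs : R s = r)
    (hFs : F s = f) (hD : 0 < cD ε r f) :
    HasDerivAt (fun x => F x / cD ε (R x) (F x))
      (((1 - ε * r) * f' + ε * f * r') / cD ε r f ^ 2) s := by
  have h1 := hF.fun_div (hasDerivAt_cD (ε := ε) hR hF) (by rw [hRs, hFs]; exact hD.ne')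
  rw [hRs, hFs] at h1
  refine h1.congr_deriv ?_
  unfold cD
  ring

theorem hasDerivAt_cY (hR : HasDerivAt R r' s) (hF : HasDerivAt F f' s) (hRs : R s = r)
    (hFs : F s = f) (hf : 0 < f) (hD : 0 < cD ε r f) :
    HasDerivAt (fun x => cY ε (R x) (F x))
      (((1 - ε * r) * f' + ε * f * r') / cD ε r f ^ 2 / (2 * cY ε r f)) s := by
  have h1 := (hasDerivAt_div_cD hR hF hRs hFs hD).sqrt
    (by rw [hRs, hFs]; exact (div_pos hf hD).ne')
  rw [hRs, hFs] at h1
  exact h1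

/-- This is dE = E G σ along an arbitrary curve, with σ = (1 - εr) df + εf dr. It holds since E
depends only on f/D and σ = D² d(f/D); the multiplier is chosen as the dual of σ for this reason. -/
theorem hasDerivAt_cE (hR : HasDerivAt R r' s) (hF : HasDerivAt F f' s) (hRs : R s = r)
    (hFs : F s = f) (hf : 0 < f) (hD : 0 < cD ε r f) :
    HasDerivAt (fun x => cE a b ε (R x) (F x))
      (cE a b ε r f * cG a b ε r f * ((1 - ε * r) * f' + ε * f * r')) s := by
  have h1 := hasDerivAt_div_cD hR hF hRs hFs hD
  have h2 := hasDerivAt_cY hR hF hRs hFs hf hD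
  have h3 := (((h1.log (by rw [hRs, hFs]; exact (div_pos hf hD).ne')).add
    (h2.const_mul (2 * b))).const_mul a).exp
  simp only [Pi.add_apply, hRs, hFs] at h3
  refine h3.congr_deriv ?_
  have hy := cY_pos hf hD
  have hy2 := cY_sq hf hD
  rw [mul_assoc (cE a b ε r f), ← cE]
  congr 1
  unfold cG
  rw [← hy2]
  have hfD : f = cY ε r f ^ 2 * cD ε r f := by rw [hy2]; field_simp
  generalize ((1 - ε * r) * f' + ε * f * r') = σ
  generalize cY ε r f = y at *
  generalize cD ε r f = D at *
  rw [hfD]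
  field_simp

/-- The derivatives of `(r, f)` along the multiplier field. -/
structure IsFlow (ε r f r' f' : ℝ) : Prop where
  dr : r' = r * (1 - ε * r) / 2 + ε * f
  df : f' = f * (1 - ε * r / 2)

theorem IsFlow.sigma (h : IsFlow ε r f r' f') :
    (1 - ε * r) * f' + ε * f * r' = f * cD ε r f := by
  rw [h.dr, h.df, cD]; ring

theorem IsFlow.hasDerivAt_cD (h : IsFlow ε r f r' f') (hR : HasDerivAt R r' s)
    (hF : HasDerivAt F f' s) :
    HasDerivAt (fun x => cD ε (R x) (F x)) (-(ε * r * cD ε r f / 2)) s := by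
  refine (Mink.hasDerivAt_cD (ε := ε) hR hF).congr_deriv ?_
  rw [h.dr, h.df, cD]; ring

/-- The multiplier acts on f/D as a scaling field: σ(S) = fD gives S(f/D) = f/D, hence Sy = y/2.
This keeps the derivatives of G and B along S explicit. -/
theorem IsFlow.hasDerivAt_cY (h : IsFlow ε r f r' f') (hR : HasDerivAt R r' s)
    (hF : HasDerivAt F f' s) (hRs : R s = r) (hFs : F s = f) (hf : 0 < f) (hD : 0 < cD ε r f) :
    HasDerivAt (fun x => cY ε (R x) (F x)) (cY ε r f / 2) s := by
  refine (Mink.hasDerivAt_cY hR hF hRs hFs hf hD).congr_deriv ?_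
  rw [h.sigma]
  have hy := cY_pos hf hD
  have hy2 := cY_sq hf hD
  field_simp
  rw [hy2]
  field_simp

theorem IsFlow.hasDerivAt_cW (h : IsFlow ε r f r' f') (hR : HasDerivAt R r' s)
    (hF : HasDerivAt F f' s) (hRs : R s = r) (hFs : F s = f) (hr : 0 < r) :
    HasDerivAt (fun x => cW ε (R x) (F x)) (cW ε r f * (1 / 2 - ε * f / r)) s := by
  have h1 := (hF.const_mul ε).fun_div (hR.const_mul 2) (by rw [hRs]; positivity)
  rw [hRs, hFs] at h1
  refine h1.congr_deriv ?_
  rw [h.dr, h.df, cW]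
  field_simp
  ring

theorem IsFlow.hasDerivAt_cG (h : IsFlow ε r f r' f') (hR : HasDerivAt R r' s)
    (hF : HasDerivAt F f' s) (hRs : R s = r) (hFs : F s = f) (hf : 0 < f) (hD : 0 < cD ε r f) :
    HasDerivAt (fun x => cG a b ε (R x) (F x))
      (a * b / (2 * cY ε r f * cD ε r f ^ 2) - (1 - ε * r) * cG a b ε r f) s := by
  have hy := cY_pos hf hD
  have hy2 := cY_sq hf hD
  have h1 := (((((h.hasDerivAt_cY hR hF hRs hFs hf hD).const_mul b).const_add 1).const_mul a).fun_div
    (hF.fun_mul (h.hasDerivAt_cD hR hF)) (by rw [hRs, hFs]; positivity))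
  rw [hRs, hFs] at h1
  refine h1.congr_deriv ?_
  rw [h.df]
  unfold cG
  have hfD : f = cY ε r f ^ 2 * cD ε r f := by rw [hy2]; field_simp
  generalize cY ε r f = y at *
  generalize cD ε r f = D at *
  subst hfD
  field_simp
  ring

theorem IsFlow.hasDerivAt_cB (h : IsFlow ε r f r' f') (hR : HasDerivAt R r' s)
    (hF : HasDerivAt F f' s) (hRs : R s = r) (hFs : F s = f) (hr : 0 < r) (hf : 0 < f)
    (hD : 0 < cD ε r f) :
    HasDerivAt (fun x => cB a b ε (R x) (F x))
      (ε * r * cB a b ε r f + (a ^ 2 * (-(1 / cY ε r f ^ 2) - b / cY ε r f) / 2 +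
        a * b / (8 * cY ε r f) -
        cW ε r f * (1 / 2 - ε * f / r) * (a * (1 + b * cY ε r f) / cY ε r f ^ 2) -
        cW ε r f * (a * b / (2 * cY ε r f) - a * (1 + b * cY ε r f) / cY ε r f ^ 2)) /
          cD ε r f ^ 2) s := by
  have hy := cY_pos hf hD
  have hY := h.hasDerivAt_cY hR hF hRs hFs hf hD
  have hDD := h.hasDerivAt_cD hR hF
  have hW := h.hasDerivAt_cW hR hF hRs hFs hr
  have hy' : cY ε (R s) (F s) ≠ 0 := by rw [hRs, hFs]; exact hy.ne'
  have hD' : cD ε (R s) (F s) ≠ 0 := by rw [hRs, hFs]; exact hD.ne'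
  have t1 := (hasDerivAt_const s (1 : ℝ)).fun_div (hY.fun_pow 2) (pow_ne_zero 2 hy')
  have t2 := (hasDerivAt_const s (2 * b)).fun_div hY hy'
  have t3 := (((t1.fun_add t2).add_const (b ^ 2)).const_mul (a ^ 2)).div_const 2
  have t4 := (hasDerivAt_const s (a * b)).fun_div (hY.const_mul 4) (mul_ne_zero (by norm_num) hy')
  have t5 := (((hY.const_mul b).const_add 1).const_mul a).fun_div (hY.fun_pow 2) (pow_ne_zero 2 hy')
  have t6 := ((t3.fun_sub t4).fun_sub (hW.fun_mul t5)).fun_div (hDD.fun_pow 2) (pow_ne_zero 2 hD')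
  simp only [hRs, hFs] at t6
  refine t6.congr_deriv ?_
  unfold cB
  generalize cY ε r f = y at *
  generalize cD ε r f = D at *
  generalize cW ε r f = w at *
  field_simp
  ring

end Curves

section Smoothness

variable {a b ε : ℝ} {P p : Spacetime n}

theorem contDiffAt_cD (hr : 0 < rP P p) :
    ContDiffAt ℝ ∞ (fun q => cD ε (rP P q) (fP P q)) p :=
  (contDiffAt_const.sub (contDiffAt_const.mul (contDiffAt_rP hr))).add
    (contDiffAt_const.mul (contDiff_fP P).contDiffAt)

theorem contDiffAt_div_cD (hr : 0 < rP P p) (hD : 0 < cD ε (rP P p) (fP P p)) :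
    ContDiffAt ℝ ∞ (fun q => fP P q / cD ε (rP P q) (fP P q)) p :=
  (contDiff_fP P).contDiffAt.div (contDiffAt_cD hr) hD.ne'

theorem contDiffAt_cY (hr : 0 < rP P p) (hf : 0 < fP P p) (hD : 0 < cD ε (rP P p) (fP P p)) :
    ContDiffAt ℝ ∞ (fun q => cY ε (rP P q) (fP P q)) p :=
  (contDiffAt_div_cD hr hD).sqrt (div_pos hf hD).ne'

theorem contDiffAt_cW (hr : 0 < rP P p) :
    ContDiffAt ℝ ∞ (fun q => cW ε (rP P q) (fP P q)) p :=
  (contDiffAt_const.mul (contDiff_fP P).contDiffAt).div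
    (contDiffAt_const.mul (contDiffAt_rP hr)) (by positivity)

theorem contDiffAt_cG (hr : 0 < rP P p) (hf : 0 < fP P p) (hD : 0 < cD ε (rP P p) (fP P p)) :
    ContDiffAt ℝ ∞ (fun q => cG a b ε (rP P q) (fP P q)) p :=
  (contDiffAt_const.mul (contDiffAt_const.add (contDiffAt_const.mul (contDiffAt_cY hr hf hD)))).div
    ((contDiff_fP P).contDiffAt.mul (contDiffAt_cD hr)) (by positivity)

theorem contDiffAt_cB (hr : 0 < rP P p) (hf : 0 < fP P p) (hD : 0 < cD ε (rP P p) (fP P p)) :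
    ContDiffAt ℝ ∞ (fun q => cB a b ε (rP P q) (fP P q)) p := by
  have hY := contDiffAt_cY hr hf hD
  have hy : cY ε (rP P p) (fP P p) ≠ 0 := (cY_pos hf hD).ne'
  have t1 := (contDiffAt_const (c := (1 : ℝ))).div (hY.pow 2) (pow_ne_zero 2 hy)
  have t2 := (contDiffAt_const (c := 2 * b)).div hY hy
  have t3 := ((contDiffAt_const (c := a ^ 2)).mul
    ((t1.add t2).add (contDiffAt_const (c := b ^ 2)))).div_const 2
  have t4 := (contDiffAt_const (c := a * b)).div ((contDiffAt_const (c := (4 : ℝ))).mul hY)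
    (mul_ne_zero (by norm_num) hy)
  have t5 := ((contDiffAt_const (c := a)).mul ((contDiffAt_const (c := (1 : ℝ))).add
    ((contDiffAt_const (c := b)).mul hY))).div (hY.pow 2) (pow_ne_zero 2 hy)
  exact ((t3.sub t4).sub ((contDiffAt_cW hr).mul t5)).div ((contDiffAt_cD hr).pow 2)
    (pow_ne_zero 2 hD.ne')

theorem contDiffAt_cE (hr : 0 < rP P p) (hf : 0 < fP P p) (hD : 0 < cD ε (rP P p) (fP P p)) :
    ContDiffAt ℝ ∞ (fun q => cE a b ε (rP P q) (fP P q)) p :=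
  (contDiffAt_const.mul (((contDiffAt_div_cD hr hD).log (div_pos hf hD).ne').add
    (contDiffAt_const.mul (contDiffAt_cY hr hf hD)))).exp

end Smoothness

end Mink

end

/-! ### The multiplier field: its length, Jacobian, divergence and deformation tensor. -/

noncomputable section

namespace Mink

variable {n : ℕ} {a b ε : ℝ} {P p : Spacetime n}

theorem fderiv_eq_of_hasDerivAt {h : Spacetime n → ℝ} {v : Spacetime n} {d : ℝ}
    (hh : DifferentiableAt ℝ h p) (hd : HasDerivAt (fun s : ℝ => h (p + s • v)) d 0) :
    fderiv ℝ h p v = d :=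
  HasDerivAt.unique (hh.hasFDerivAt.hasLineDerivAt v) hd

theorem hasDerivAt_rP_line (hr : 0 < rP P p) (v : Spacetime n) :
    HasDerivAt (fun s : ℝ => rP P (p + s • v)) (fderiv ℝ (rP P) p v) 0 :=
  ((contDiffAt_rP hr).differentiableAt (by simp)).hasFDerivAt.hasLineDerivAt v

theorem hasDerivAt_fP_line (P p v : Spacetime n) :
    HasDerivAt (fun s : ℝ => fP P (p + s • v)) (fderiv ℝ (fP P) p v) 0 :=
  ((contDiff_fP P).differentiable (by simp) p).hasFDerivAt.hasLineDerivAt v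

/-- The multiplier field `(1 - ε r_P) ∇ f_P + ε f_P ∇ r_P`. -/
def multiplier (ε : ℝ) (P p : Spacetime n) : Spacetime n :=
  WithLp.toLp 2 (Fin.cons (tP P p * (1 - ε * rP P p) / 2) fun i : Fin n =>
    xP P p i * ((1 - ε * rP P p + 2 * (ε * (fP P p / rP P p))) / 2))

theorem multiplier_zero (ε : ℝ) (P p : Spacetime n) :
    multiplier ε P p 0 = tP P p * (1 - ε * rP P p) / 2 := rfl

theorem multiplier_succ (ε : ℝ) (P p : Spacetime n) (i : Fin n) :
    multiplier ε P p i.succ =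
      xP P p i * ((1 - ε * rP P p + 2 * (ε * (fP P p / rP P p))) / 2) := rfl

theorem sg_mul_multiplier (hr : 0 < rP P p) (k : Fin (n + 1)) :
    sg k * multiplier ε P p k =
      (1 - ε * rP P p) * pd k (fP P) p + ε * fP P p * pd k (rP P) p := by
  refine Fin.cases ?_ (fun i => ?_) k
  · rw [multiplier_zero, sg_zero, pd_fP_zero, pd_rP_zero hr]; ring
  · rw [multiplier_succ, sg_succ, pd_fP_succ, pd_rP_succ hr, omega_eq]
    field_simp

theorem multiplier_eq (hr : 0 < rP P p) (k : Fin (n + 1)) :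
    multiplier ε P p k =
      sg k * ((1 - ε * rP P p) * pd k (fP P) p + ε * fP P p * pd k (rP P) p) := by
  rw [← sg_mul_multiplier hr, ← mul_assoc, sg_mul_self, one_mul]

theorem isFlow_multiplier (hr : 0 < rP P p) :
    IsFlow ε (rP P p) (fP P p) (fderiv ℝ (rP P) p (multiplier ε P p))
      (fderiv ℝ (fP P) p (multiplier ε P p)) := by
  constructor
  · rw [← sum_pd_mul]
    have : ∀ k, pd k (rP P) p * multiplier ε P p k =
        (1 - ε * rP P p) * (sg k * (pd k (fP P) p * pd k (rP P) p)) +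
        ε * fP P p * (sg k * (pd k (rP P) p * pd k (rP P) p)) := fun k => by
      rw [multiplier_eq hr]; ring
    simp_rw [this]
    rw [Finset.sum_add_distrib, ← Finset.mul_sum, ← Finset.mul_sum, inner_pd_fP_rP hr,
      inner_pd_rP_rP hr]
    ring
  · rw [← sum_pd_mul]
    have : ∀ k, pd k (fP P) p * multiplier ε P p k =
        (1 - ε * rP P p) * (sg k * (pd k (fP P) p * pd k (fP P) p)) +
        ε * fP P p * (sg k * (pd k (fP P) p * pd k (rP P) p)) := fun k => by
      rw [multiplier_eq hr]; ring
    simp_rw [this]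
    rw [Finset.sum_add_distrib, ← Finset.mul_sum, ← Finset.mul_sum, inner_pd_fP_rP hr,
      inner_pd_fP_fP]
    ring

/-- As S is the metric dual of σ, its square is σ(S). The factor f, which makes S null on the cone,
is what later controls the current there. -/
theorem metric_multiplier (hr : 0 < rP P p) :
    ∑ k, sg k * (multiplier ε P p k * multiplier ε P p k) =
      fP P p * cD ε (rP P p) (fP P p) := by
  have h := isFlow_multiplier (ε := ε) hr
  rw [← h.sigma, ← sum_pd_mul, ← sum_pd_mul, Finset.mul_sum, Finset.mul_sum,
    ← Finset.sum_add_distrib]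
  refine Finset.sum_congr rfl fun k _ => ?_
  have := sg_mul_multiplier (ε := ε) hr k
  linear_combination multiplier ε P p k * this

theorem contDiffAt_multiplier (hr : 0 < rP P p) (k : Fin (n + 1)) :
    ContDiffAt ℝ ∞ (fun q => multiplier ε P q k) p := by
  refine Fin.cases ?_ (fun i => ?_) k
  · simp_rw [multiplier_zero]
    exact ((contDiff_tP P).contDiffAt.mul (contDiffAt_const.sub
      (contDiffAt_const.mul (contDiffAt_rP hr)))).div_const _
  · simp_rw [multiplier_succ]
    exact (contDiff_xP P i).contDiffAt.mul (((contDiffAt_const.sub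
      (contDiffAt_const.mul (contDiffAt_rP hr))).add (contDiffAt_const.mul
        (contDiffAt_const.mul (contDiffAt_fP_div_rP hr)))).div_const _)

/-- The Jacobian matrix of the multiplier field. -/
theorem pd_multiplier_zero (hr : 0 < rP P p) (k : Fin (n + 1)) :
    pd k (fun q => multiplier ε P q 0) p =
      (1 - ε * rP P p) / 2 * pd k (tP P) p - ε * tP P p / 2 * pd k (rP P) p := by
  have hrd : DifferentiableAt ℝ (rP P) p := (contDiffAt_rP hr).differentiableAt (by simp)
  have htd : DifferentiableAt ℝ (tP P) p := (contDiff_tP P).differentiable (by simp) p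
  have : (fun q => multiplier ε P q 0) = fun q => (1 / 2) * tP P q - (ε / 2) * (tP P q * rP P q) :=
    funext fun q => by rw [multiplier_zero]; ring
  rw [this, pd_sub (by fun_prop) (by fun_prop), pd_const_mul htd, pd_const_mul (by fun_prop),
    pd_mul htd hrd]
  ring

theorem pd_multiplier_succ (hr : 0 < rP P p) (i : Fin n) (k : Fin (n + 1)) :
    pd k (fun q => multiplier ε P q i.succ) p =
      (1 - ε * rP P p + 2 * (ε * (fP P p / rP P p))) / 2 * pd k (fun q => xP P q i) p +
      xP P p i * (ε * (pd k (fP P) p / rP P p) -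
        (ε / 2 + ε * (fP P p / rP P p ^ 2)) * pd k (rP P) p) := by
  have hrd : DifferentiableAt ℝ (rP P) p := (contDiffAt_rP hr).differentiableAt (by simp)
  have hxd : DifferentiableAt ℝ (fun q => xP P q i) p := (contDiff_xP P i).differentiable (by simp) p
  have hfd : DifferentiableAt ℝ (fun q => fP P q / rP P q) p :=
    (contDiffAt_fP_div_rP hr).differentiableAt (by simp)
  have : (fun q => multiplier ε P q i.succ) = fun q => (1 / 2) * xP P q i -
      (ε / 2) * (xP P q i * rP P q) + ε * (xP P q i * (fP P q / rP P q)) :=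
    funext fun q => by rw [multiplier_succ]; ring
  rw [this, pd_add (by fun_prop) (by fun_prop), pd_sub (by fun_prop) (by fun_prop),
    pd_const_mul hxd, pd_const_mul (by fun_prop), pd_const_mul (by fun_prop), pd_mul hxd hrd,
    pd_mul hxd hfd, pd_fP_div_rP hr]
  ring

theorem pd_multiplier_zero_zero (hr : 0 < rP P p) :
    pd 0 (fun q => multiplier ε P q 0) p = (1 - ε * rP P p) / 2 := by
  rw [pd_multiplier_zero hr, pd_tP_zero, pd_rP_zero hr]; ring

theorem pd_multiplier_succ_zero (hr : 0 < rP P p) (j : Fin n) :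
    pd j.succ (fun q => multiplier ε P q 0) p = -(ε * tP P p / 2 * omega P p j) := by
  rw [pd_multiplier_zero hr, pd_tP_succ, pd_rP_succ hr]; ring

theorem pd_multiplier_zero_succ (hr : 0 < rP P p) (i : Fin n) :
    pd 0 (fun q => multiplier ε P q i.succ) p = -(ε * tP P p / 2 * omega P p i) := by
  rw [pd_multiplier_succ hr, pd_xP_zero, pd_rP_zero hr, pd_fP_zero, omega_eq]
  field_simp
  ring

theorem pd_multiplier_succ_succ (hr : 0 < rP P p) (i j : Fin n) :
    pd j.succ (fun q => multiplier ε P q i.succ) p =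
      (if i = j then (1 - ε * rP P p + 2 * (ε * (fP P p / rP P p))) / 2 else 0) -
      ε * (fP P p / rP P p) * (omega P p i * omega P p j) := by
  rw [pd_multiplier_succ hr, pd_xP_succ, pd_rP_succ hr, pd_fP_succ]
  split_ifs
  · rw [omega_eq, omega_eq]
    field_simp
    ring
  · rw [omega_eq, omega_eq]
    field_simp
    ring

theorem divergence_multiplier (hr : 0 < rP P p) :
    divergence (multiplier ε P) p =
      (n + 1) / 2 * (1 - ε * rP P p) + (n - 1) * (ε * (fP P p / rP P p)) := by
  rw [divergence, Fin.sum_univ_succ, pd_multiplier_zero_zero hr]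
  simp_rw [pd_multiplier_succ_succ hr]
  rw [Finset.sum_sub_distrib, ← Finset.mul_sum, sum_omega_sq hr]
  simp
  ring

/-- The squared angular gradient of a covector. -/
theorem sum_sub_radial_sq (hr : 0 < rP P p) (z : Fin n → ℝ) :
    ∑ i, (z i - (∑ j, omega P p j * z j) * omega P p i) ^ 2 =
      (∑ i, z i * z i) - (∑ j, omega P p j * z j) ^ 2 := by
  set m := ∑ j, omega P p j * z j with hm
  have : ∀ i, (z i - m * omega P p i) ^ 2 =
      z i * z i - 2 * m * (omega P p i * z i) + m ^ 2 * (omega P p i * omega P p i) :=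
    fun i => by ring
  simp_rw [this]
  rw [Finset.sum_add_distrib, Finset.sum_sub_distrib, ← Finset.mul_sum, ← Finset.mul_sum,
    sum_omega_sq hr, ← hm]
  ring

/-- The deformation tensor of the multiplier field, contracted with a covector. -/
theorem deformation_multiplier (hr : 0 < rP P p) (z : Fin (n + 1) → ℝ) :
    ∑ k, ∑ j, sg k * z k * z j * pd k (fun x => multiplier ε P x j) p =
      (1 - ε * rP P p) / 2 * (∑ j, sg j * (z j * z j)) +
      ε * (fP P p / rP P p) * ((∑ i : Fin n, z i.succ * z i.succ) -
        (∑ i : Fin n, omega P p i * z i.succ) ^ 2) := by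
  set m := ∑ i : Fin n, omega P p i * z i.succ with hm
  set A := (1 - ε * rP P p + 2 * (ε * (fP P p / rP P p))) / 2 with hA
  set B := ε * (fP P p / rP P p) with hB
  have inner : ∀ j : Fin n, ∑ i : Fin n, z j.succ * z i.succ *
      ((if i = j then A else 0) - B * (omega P p i * omega P p j)) =
      A * (z j.succ * z j.succ) - B * m * (omega P p j * z j.succ) := by
    intro j
    have : ∀ i : Fin n, z j.succ * z i.succ *
        ((if i = j then A else 0) - B * (omega P p i * omega P p j)) =
        (if i = j then A * (z j.succ * z i.succ) else 0) -
          B * (omega P p j * z j.succ) * (omega P p i * z i.succ) := by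
      intro i
      split_ifs <;> ring
    simp_rw [this]
    rw [Finset.sum_sub_distrib, ← Finset.mul_sum, ← hm]
    simp
    ring
  -- The mixed entries ∂_0 S^i and ∂_i S^0 are equal, so the sign of the time direction makes their
  -- contributions cancel.
  have s1 : ∑ i : Fin n, sg (0 : Fin (n + 1)) * z 0 * z i.succ * -(ε * tP P p / 2 * omega P p i) =
      ε * tP P p / 2 * z 0 * m := by
    rw [hm, Finset.mul_sum]
    exact Finset.sum_congr rfl fun i _ => by rw [sg_zero]; ring
  have s2 : ∑ i : Fin n, z i.succ * z 0 * -(ε * tP P p / 2 * omega P p i) =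
      -(ε * tP P p / 2 * z 0 * m) := by
    rw [hm, Finset.mul_sum, ← Finset.sum_neg_distrib]
    exact Finset.sum_congr rfl fun i _ => by ring
  rw [Fin.sum_univ_succ]
  simp_rw [Fin.sum_univ_succ, pd_multiplier_zero_zero hr, pd_multiplier_succ_zero hr,
    pd_multiplier_zero_succ hr, pd_multiplier_succ_succ hr, sg_succ, one_mul, ← hB, ← hA, inner]
  rw [Finset.sum_add_distrib, Finset.sum_sub_distrib, ← Finset.mul_sum, ← Finset.mul_sum, ← hm, s1,
    s2, sg_zero]
  rw [hA]
  ring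

theorem pd_cE (hr : 0 < rP P p) (hf : 0 < fP P p) (hD : 0 < cD ε (rP P p) (fP P p))
    (k : Fin (n + 1)) :
    pd k (fun q => cE a b ε (rP P q) (fP P q)) p =
      cE a b ε (rP P p) (fP P p) * cG a b ε (rP P p) (fP P p) * (sg k * multiplier ε P p k) := by
  rw [pd, fderiv_eq_of_hasDerivAt ((contDiffAt_cE hr hf hD).differentiableAt (by simp))
    (hasDerivAt_cE (hasDerivAt_rP_line hr _) (hasDerivAt_fP_line P p _) (by simp) (by simp) hf hD),
    sg_mul_multiplier hr]
  rfl

theorem fderiv_cG_multiplier (hr : 0 < rP P p) (hf : 0 < fP P p)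
    (hD : 0 < cD ε (rP P p) (fP P p)) :
    fderiv ℝ (fun q => cG a b ε (rP P q) (fP P q)) p (multiplier ε P p) =
      a * b / (2 * cY ε (rP P p) (fP P p) * cD ε (rP P p) (fP P p) ^ 2) -
        (1 - ε * rP P p) * cG a b ε (rP P p) (fP P p) :=
  fderiv_eq_of_hasDerivAt ((contDiffAt_cG hr hf hD).differentiableAt (by simp))
    ((isFlow_multiplier hr).hasDerivAt_cG (hasDerivAt_rP_line hr _) (hasDerivAt_fP_line P p _)
      (by simp) (by simp) hf hD)

theorem fderiv_cB_multiplier (hr : 0 < rP P p) (hf : 0 < fP P p)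
    (hD : 0 < cD ε (rP P p) (fP P p)) :
    fderiv ℝ (fun q => cB a b ε (rP P q) (fP P q)) p (multiplier ε P p) =
      ε * rP P p * cB a b ε (rP P p) (fP P p) +
        (a ^ 2 * (-(1 / cY ε (rP P p) (fP P p) ^ 2) - b / cY ε (rP P p) (fP P p)) / 2 +
        a * b / (8 * cY ε (rP P p) (fP P p)) -
        cW ε (rP P p) (fP P p) * (1 / 2 - ε * fP P p / rP P p) *
          (a * (1 + b * cY ε (rP P p) (fP P p)) / cY ε (rP P p) (fP P p) ^ 2) -
        cW ε (rP P p) (fP P p) * (a * b / (2 * cY ε (rP P p) (fP P p)) -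
          a * (1 + b * cY ε (rP P p) (fP P p)) / cY ε (rP P p) (fP P p) ^ 2)) /
          cD ε (rP P p) (fP P p) ^ 2 :=
  fderiv_eq_of_hasDerivAt ((contDiffAt_cB hr hf hD).differentiableAt (by simp))
    ((isFlow_multiplier hr).hasDerivAt_cB (hasDerivAt_rP_line hr _) (hasDerivAt_fP_line P p _)
      (by simp) (by simp) hr hf hD)

/-- The zeroth order part of the multiplier. -/
def cQ (n : ℕ) (ε r f : ℝ) : ℝ := (n - 1) / 4 * (1 - ε * r) + (n - 2) / 2 * (ε * (f / r))

theorem contDiffAt_cQ (hr : 0 < rP P p) :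
    ContDiffAt ℝ ∞ (fun q => cQ n ε (rP P q) (fP P q)) p :=
  (contDiffAt_const.mul (contDiffAt_const.sub (contDiffAt_const.mul (contDiffAt_rP hr)))).add
    (contDiffAt_const.mul (contDiffAt_const.mul (contDiffAt_fP_div_rP hr)))

theorem box_add {f g : Spacetime n → ℝ} (hf : ContDiffAt ℝ 2 f p)
    (hg : ContDiffAt ℝ 2 g p) : box (fun x => f x + g x) p = box f p + box g p := by
  have hf0 : ∀ᶠ x in 𝓝 p, DifferentiableAt ℝ f x :=
    (hf.eventually (by simp)).mono fun x hx => hx.differentiableAt (by simp)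
  have hg0 : ∀ᶠ x in 𝓝 p, DifferentiableAt ℝ g x :=
    (hg.eventually (by simp)).mono fun x hx => hx.differentiableAt (by simp)
  have h : ∀ k, pd k (pd k fun x => f x + g x) p = pd k (pd k f) p + pd k (pd k g) p := by
    intro k
    have e : (pd k fun x => f x + g x) =ᶠ[𝓝 p] fun x => pd k f x + pd k g x := by
      filter_upwards [hf0, hg0] with x h1 h2 using pd_add h1 h2 k
    rw [pd_congr e, pd_add (differentiableAt_pd hf k) (differentiableAt_pd hg k)]
  simp only [box_eq_sum, h, mul_add, Finset.sum_add_distrib]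

theorem box_const (c : ℝ) : box (fun _ : Spacetime n => c) p = 0 := by
  have : ∀ k, pd k (fun _ : Spacetime n => c) = fun _ => 0 := fun k => funext fun q => pd_const k c q
  simp [box_eq_sum, this, pd_const]

theorem box_const_mul {f : Spacetime n → ℝ} (hf : ContDiffAt ℝ 2 f p) (c : ℝ) :
    box (fun x => c * f x) p = c * box f p := by
  rw [box_mul contDiffAt_const hf, box_const]
  simp [pd_const]

theorem box_cQ (hr : 0 < rP P p) :
    box (fun q => cQ n ε (rP P q) (fP P q)) p =
      -(ε * (n - 1) ^ 2 / (4 * rP P p)) + (n - 2) / 2 * ε *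
        ((n - 1) / (2 * rP P p) + (3 - n) * fP P p / rP P p ^ 3) := by
  have h1 : ContDiffAt ℝ 2 (rP P) p := (contDiffAt_rP hr).of_le two_le_infty
  have h2 : ContDiffAt ℝ 2 (fun q => fP P q / rP P q) p :=
    (contDiffAt_fP_div_rP hr).of_le two_le_infty
  have : (fun q => cQ n ε (rP P q) (fP P q)) = fun q => (((n : ℝ) - 1) / 4 +
      (-((n - 1) / 4 * ε)) * rP P q) + ((n - 2) / 2 * ε) * (fP P q / rP P q) :=
    funext fun q => by unfold cQ; ring
  rw [this, box_add (contDiffAt_const.add (contDiffAt_const.mul h1)) (contDiffAt_const.mul h2),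
    box_add contDiffAt_const (contDiffAt_const.mul h1), box_const, box_const_mul h1,
    box_const_mul h2, box_rP hr, box_fP_div_rP hr]
  ring

end Mink

end

/-! ### The conjugated wave operator and the divergence of the Carleman current. -/

noncomputable section

namespace Mink

variable {n : ℕ} {a b ε : ℝ} {P p : Spacetime n}

theorem sum_mul_pd (f : Spacetime n → ℝ) (p v : Spacetime n) :
    ∑ k, v k * pd k f p = fderiv ℝ f p v := by
  rw [← sum_pd_mul]
  exact Finset.sum_congr rfl fun k _ => mul_comm _ _

theorem continuous_cD (ε : ℝ) (P : Spacetime n) :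
    Continuous fun q => cD ε (rP P q) (fP P q) :=
  (continuous_const.sub (continuous_const.mul (continuous_rP P))).add
    (continuous_const.mul (contDiff_fP P).continuous)

theorem eventually_pos_conditions (hf : 0 < fP P p) (hD : 0 < cD ε (rP P p) (fP P p)) :
    ∀ᶠ q in 𝓝 p, 0 < fP P q ∧ 0 < cD ε (rP P q) (fP P q) :=
  ((contDiff_fP P).continuous.continuousAt.eventually_const_lt hf).and
    ((continuous_cD ε P).continuousAt.eventually_const_lt hD)

/-- The square root of the weight as a function on spacetime. -/
def wt (a b ε : ℝ) (P q : Spacetime n) : ℝ := cE a b ε (rP P q) (fP P q)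

theorem wt_pos (a b ε : ℝ) (P q : Spacetime n) : 0 < wt a b ε P q := Real.exp_pos _

theorem contDiffAt_wt (hf : 0 < fP P p) (hD : 0 < cD ε (rP P p) (fP P p)) :
    ContDiffAt ℝ ∞ (wt a b ε P) p := contDiffAt_cE (rP_pos hf) hf hD

theorem pd_wt (hf : 0 < fP P p) (hD : 0 < cD ε (rP P p) (fP P p)) (k : Fin (n + 1)) :
    pd k (wt a b ε P) p =
      wt a b ε P p * cG a b ε (rP P p) (fP P p) * (sg k * multiplier ε P p k) :=
  pd_cE (rP_pos hf) hf hD k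

theorem box_wt (hf : 0 < fP P p) (hD : 0 < cD ε (rP P p) (fP P p)) :
    box (wt a b ε P) p = wt a b ε P p * (cG a b ε (rP P p) (fP P p) *
      divergence (multiplier ε P) p +
      fderiv ℝ (fun q => cG a b ε (rP P q) (fP P q)) p (multiplier ε P p) +
      cG a b ε (rP P p) (fP P p) ^ 2 * (fP P p * cD ε (rP P p) (fP P p))) := by
  have hr := rP_pos hf
  have hEd : DifferentiableAt ℝ (wt a b ε P) p :=
    (contDiffAt_wt hf hD).differentiableAt (by simp)
  have hGd : DifferentiableAt ℝ (fun q => cG a b ε (rP P q) (fP P q)) p :=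
    (contDiffAt_cG hr hf hD).differentiableAt (by simp)
  have hSd : ∀ k, DifferentiableAt ℝ (fun q => multiplier ε P q k) p := fun k =>
    (contDiffAt_multiplier hr k).differentiableAt (by simp)
  have e : ∀ k, pd k (wt a b ε P) =ᶠ[𝓝 p] fun q => sg k *
      (wt a b ε P q * cG a b ε (rP P q) (fP P q) * multiplier ε P q k) := by
    intro k
    filter_upwards [eventually_pos_conditions hf hD] with q hq
    rw [pd_wt hq.1 hq.2]; ring
  have h1 : ∀ k, sg k * pd k (pd k (wt a b ε P)) p =
      wt a b ε P p * cG a b ε (rP P p) (fP P p) * pd k (fun q => multiplier ε P q k) p +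
      wt a b ε P p * (pd k (fun q => cG a b ε (rP P q) (fP P q)) p * multiplier ε P p k) +
      wt a b ε P p * cG a b ε (rP P p) (fP P p) ^ 2 *
        (sg k * (multiplier ε P p k * multiplier ε P p k)) := by
    intro k
    rw [pd_congr (e k), pd_const_mul ((hEd.fun_mul hGd).fun_mul (hSd k)),
      pd_mul (hEd.fun_mul hGd) (hSd k), pd_mul hEd hGd, pd_wt hf hD]
    linear_combination (wt a b ε P p * cG a b ε (rP P p) (fP P p) *
        pd k (fun q => multiplier ε P q k) p +
      wt a b ε P p * (pd k (fun q => cG a b ε (rP P q) (fP P q)) p * multiplier ε P p k) +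
      wt a b ε P p * cG a b ε (rP P p) (fP P p) ^ 2 * multiplier ε P p k ^ 2 * sg k) *
        sg_mul_self k
  rw [box_eq_sum]
  simp_rw [h1]
  rw [Finset.sum_add_distrib, Finset.sum_add_distrib, ← Finset.mul_sum, ← Finset.mul_sum,
    ← Finset.mul_sum, metric_multiplier hr, sum_pd_mul]
  rw [divergence]
  ring

theorem pd_wt_mul {φ : Spacetime n → ℝ} (hf : 0 < fP P p) (hD : 0 < cD ε (rP P p) (fP P p))
    (hφ : DifferentiableAt ℝ φ p) (k : Fin (n + 1)) :
    pd k (fun q => wt a b ε P q * φ q) p = wt a b ε P p *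
      (pd k φ p + cG a b ε (rP P p) (fP P p) * (sg k * multiplier ε P p k) * φ p) := by
  have hEd : DifferentiableAt ℝ (wt a b ε P) p :=
    (contDiffAt_wt hf hD).differentiableAt (by simp)
  rw [pd_mul hEd hφ]
  rw [pd_wt hf hD]; ring

theorem fderiv_wt_mul_multiplier {φ : Spacetime n → ℝ} (hf : 0 < fP P p)
    (hD : 0 < cD ε (rP P p) (fP P p)) (hφ : DifferentiableAt ℝ φ p) :
    fderiv ℝ (fun q => wt a b ε P q * φ q) p (multiplier ε P p) = wt a b ε P p *
      (fderiv ℝ φ p (multiplier ε P p) + cG a b ε (rP P p) (fP P p) *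
        (fP P p * cD ε (rP P p) (fP P p)) * φ p) := by
  rw [← sum_pd_mul, ← sum_pd_mul, ← metric_multiplier (rP_pos hf)]
  simp_rw [pd_wt_mul hf hD hφ, Finset.mul_sum, Finset.sum_mul]
  rw [← Finset.sum_add_distrib, Finset.mul_sum]
  exact Finset.sum_congr rfl fun k _ => by ring

/-- The product rule for □(Eφ), with E Sφ rewritten as Sψ - G fD ψ. This substitution reverses the
sign of the G² term of □E. -/
theorem box_wt_mul {φ : Spacetime n → ℝ} (hf : 0 < fP P p) (hD : 0 < cD ε (rP P p) (fP P p))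
    (hφ : ContDiffAt ℝ 2 φ p) :
    box (fun q => wt a b ε P q * φ q) p = wt a b ε P p * box φ p +
      2 * cG a b ε (rP P p) (fP P p) *
        fderiv ℝ (fun q => wt a b ε P q * φ q) p (multiplier ε P p) +
      (cG a b ε (rP P p) (fP P p) * divergence (multiplier ε P) p +
      fderiv ℝ (fun q => cG a b ε (rP P q) (fP P q)) p (multiplier ε P p) -
      cG a b ε (rP P p) (fP P p) ^ 2 * (fP P p * cD ε (rP P p) (fP P p))) *
        (wt a b ε P p * φ p) := by
  have hr := rP_pos hf
  have hφ0 : DifferentiableAt ℝ φ p := hφ.differentiableAt (by simp)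
  have h1 : ∑ k, sg k * (pd k (wt a b ε P) p * pd k φ p) =
      wt a b ε P p * cG a b ε (rP P p) (fP P p) * fderiv ℝ φ p (multiplier ε P p) := by
    rw [← sum_pd_mul, Finset.mul_sum]
    refine Finset.sum_congr rfl fun k _ => ?_
    rw [pd_wt hf hD]
    linear_combination wt a b ε P p * cG a b ε (rP P p) (fP P p) *
      multiplier ε P p k * pd k φ p * sg_mul_self k
  rw [box_mul ((contDiffAt_wt hf hD).of_le two_le_infty) hφ, h1, box_wt hf hD,
    fderiv_wt_mul_multiplier hf hD hφ0]
  ring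

/-- The zeroth order coefficient in the divergence of the current. -/
def cZ (a b ε r f : ℝ) : ℝ :=
  (a ^ 2 * (b / cY ε r f + b ^ 2) / 2 + cW ε r f * (a * (1 + b * cY ε r f) / cY ε r f) ^ 2 -
    a * b / (8 * cY ε r f) - cW ε r f * (a * b / cY ε r f) -
    cW ε r f * (a * (1 + b * cY ε r f) / cY ε r f ^ 2) / 2) / cD ε r f ^ 2

/-- The current of the Carleman estimate. -/
def carlemanCurrent (a b ε : ℝ) (P : Spacetime n) (φ : Spacetime n → ℝ) :
    Spacetime n → Spacetime n :=
  energyCurrent (multiplier ε P) (fun q => cQ n ε (rP P q) (fP P q))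
    (fun q => cB a b ε (rP P q) (fP P q)) (fun q => wt a b ε P q * φ q)

/-- Here B is determined by G s + SG - G² fD = 2Gq - 2B, where s = div S. With this choice the terms
2GT² and ψT complete to 2G(T + qψ)², and the coefficient left on ψ² is SB + Bs - 2Bq, which the last
step computes. -/
theorem zeroth_order_identity {r f y D m ψ T Y : ℝ} (hy : 0 < y) (hD : 0 < D)
    (hr : 0 < r) (hyf : f = y ^ 2 * D) {w G B q s SG SB : ℝ}
    (hw : w = ε * f / (2 * r)) (hG : G = a * (1 + b * y) / (f * D))
    (hB : B = (a ^ 2 * (1 / y ^ 2 + 2 * b / y + b ^ 2) / 2 - a * b / (4 * y) -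
      w * (a * (1 + b * y) / y ^ 2)) / D ^ 2)
    (hq : q = (m - 1) / 4 * (1 - ε * r) + (m - 2) / 2 * (ε * (f / r)))
    (hs : s = (m + 1) / 2 * (1 - ε * r) + (m - 1) * (ε * (f / r)))
    (hSG : SG = a * b / (2 * y * D ^ 2) - (1 - ε * r) * G)
    (hSB : SB = ε * r * B + (a ^ 2 * (-(1 / y ^ 2) - b / y) / 2 + a * b / (8 * y) -
        w * (1 / 2 - ε * f / r) * (a * (1 + b * y) / y ^ 2) -
        w * (a * b / (2 * y) - a * (1 + b * y) / y ^ 2)) / D ^ 2) :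
    (Y + 2 * G * T + (G * s + SG - G ^ 2 * (f * D)) * ψ) * (T + q * ψ) +
      (SB + B * s) * (ψ * ψ) + 2 * B * ψ * T =
    Y * (T + q * ψ) + 2 * G * (T + q * ψ) ^ 2 +
      (a ^ 2 * (b / y + b ^ 2) / 2 + w * (a * (1 + b * y) / y) ^ 2 - a * b / (8 * y) -
        w * (a * b / y) - w * (a * (1 + b * y) / y ^ 2) / 2) / D ^ 2 * (ψ * ψ) := by
  have h1 : ε * (f / r) = 2 * w := by rw [hw]; field_simp
  have h1' : ε * f / r = 2 * w := by rw [hw]; field_simp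
  have hG' : G = a * (1 + b * y) / (y ^ 2 * D ^ 2) := by rw [hG, hyf]; field_simp
  rw [h1] at hq hs
  rw [h1'] at hSB
  have hAB : G * s + SG - G ^ 2 * (f * D) = 2 * G * q - 2 * B := by
    rw [hs, hSG, hq, hB, hG', hyf]
    field_simp
    ring
  have hZ : SB + B * s - 2 * B * q =
      (a ^ 2 * (b / y + b ^ 2) / 2 + w * (a * (1 + b * y) / y) ^ 2 - a * b / (8 * y) -
        w * (a * b / y) - w * (a * (1 + b * y) / y ^ 2) / 2) / D ^ 2 := by
    have e : SB + B * s - 2 * B * q = SB + B * (1 - ε * r + 2 * w) := by rw [hs, hq]; ring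
    rw [e, hSB, hB]
    field_simp
    ring
  rw [hAB, ← hZ]
  ring

/-- The energy identity with the conjugated equation inserted. Apart from the source term and the
square of M, the quadratic part in dψ has a factor ε. -/
theorem divergence_carlemanCurrent {φ : Spacetime n → ℝ} (hf : 0 < fP P p)
    (hD : 0 < cD ε (rP P p) (fP P p)) (hφ : ContDiffAt ℝ 2 φ p)
    {ψ : Spacetime n → ℝ} (hψ : ψ = fun q => wt a b ε P q * φ q) {M : ℝ}
    (hM : M = fderiv ℝ ψ p (multiplier ε P p) + cQ n ε (rP P p) (fP P p) * ψ p) :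
    divergence (carlemanCurrent a b ε P φ) p =
      wt a b ε P p * box φ p * M + 2 * cG a b ε (rP P p) (fP P p) * M ^ 2 +
      ε * (fP P p / rP P p) * ((∑ i : Fin n, pd i.succ ψ p * pd i.succ ψ p) -
        (∑ i : Fin n, omega P p i * pd i.succ ψ p) ^ 2) -
      cW ε (rP P p) (fP P p) * (∑ j, sg j * (pd j ψ p * pd j ψ p)) +
      (cZ a b ε (rP P p) (fP P p) -
        1 / 2 * box (fun q => cQ n ε (rP P q) (fP P q)) p) * (ψ p * ψ p) := by
  have hr := rP_pos hf
  have hψ2 : ContDiffAt ℝ 2 ψ p := by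
    rw [hψ]; exact ((contDiffAt_wt hf hD).of_le two_le_infty).mul hφ
  have hbox := box_wt_mul (a := a) (b := b) hf hD hφ
  have hψp : wt a b ε P p * φ p = ψ p := by rw [hψ]
  rw [hψp, ← hψ] at hbox
  have key := divergence_energyCurrent hψ2 ((contDiffAt_cQ (n := n) (ε := ε) hr).of_le two_le_infty)
    (fun k => (contDiffAt_multiplier (ε := ε) hr k).differentiableAt (by simp))
    ((contDiffAt_cB (a := a) (b := b) hr hf hD).differentiableAt (by simp))
  rw [carlemanCurrent, ← hψ, key, deformation_multiplier hr, sum_mul_pd, sum_mul_pd, hbox]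
  have hyf : fP P p = cY ε (rP P p) (fP P p) ^ 2 * cD ε (rP P p) (fP P p) := by
    rw [cY_sq hf hD]; field_simp
  have hid := zeroth_order_identity (a := a) (b := b) (m := n) (ψ := ψ p)
    (T := fderiv ℝ ψ p (multiplier ε P p)) (Y := wt a b ε P p * box φ p)
    (w := cW ε (rP P p) (fP P p)) (G := cG a b ε (rP P p) (fP P p))
    (B := cB a b ε (rP P p) (fP P p)) (q := cQ n ε (rP P p) (fP P p))
    (cY_pos hf hD) hD hr hyf rfl rfl rfl rfl (divergence_multiplier hr)
    (fderiv_cG_multiplier (a := a) (b := b) hr hf hD)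
    (fderiv_cB_multiplier (a := a) (b := b) hr hf hD)
  -- The term (1 - εr)/2 cancels the metric part of the deformation tensor. The extra w = εf/(2r)
  -- takes half of the angular term and gives it to the product of the null derivatives.
  have hq : 1 / 2 * divergence (multiplier ε P) p - cQ n ε (rP P p) (fP P p) =
      (1 - ε * rP P p) / 2 + cW ε (rP P p) (fP P p) := by
    rw [divergence_multiplier hr, cQ, cW]
    field_simp
    ring
  rw [hq]
  rw [hM, cZ]
  linear_combination hid

end Mink

end

/-! ### The pointwise Carleman inequality. -/

noncomputable section

namespace Mink

variable {n : ℕ} {a b ε : ℝ} {P p : Spacetime n}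

section Scalars

variable {r f y D m u v w : ℝ}

/-- The main term a²b/(2y) comes from the exponential factor of the weight. It loses at most
a²b/(8y) to the term ab/(8y), since a ≤ a², which leaves 3/8. The terms with w have a nonnegative
sum. -/
theorem zeroth_order_lower_bound (ha : 1 ≤ a) (hb : 0 < b) (hy : 0 < y) (hD : 0 < D)
    (hw : 0 ≤ w) :
    3 / 8 * (a ^ 2 * b / (y * D ^ 2)) ≤
      (a ^ 2 * (b / y + b ^ 2) / 2 + w * (a * (1 + b * y) / y) ^ 2 - a * b / (8 * y) -
        w * (a * b / y) - w * (a * (1 + b * y) / y ^ 2) / 2) / D ^ 2 := by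
  have hby : 0 < b * y := mul_pos hb hy
  have h1 : (a ^ 2 * (b / y + b ^ 2) / 2 + w * (a * (1 + b * y) / y) ^ 2 - a * b / (8 * y) -
      w * (a * b / y) - w * (a * (1 + b * y) / y ^ 2) / 2) / D ^ 2 -
      3 / 8 * (a ^ 2 * b / (y * D ^ 2)) = (a * (a - 1) * b / (8 * y) + a ^ 2 * b ^ 2 / 2 +
        w * a / y ^ 2 * (a * (1 + b * y) ^ 2 - b * y - (1 + b * y) / 2)) / D ^ 2 := by
    field_simp
    ring
  have h2 : 0 ≤ a * (1 + b * y) ^ 2 - b * y - (1 + b * y) / 2 := by nlinarith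
  have h3 : 0 ≤ a - 1 := by linarith
  have h4 : 0 < a := by linarith
  rw [← sub_nonneg, h1]
  positivity

/-- From (yD²)² ≤ y²D = f ≤ r²/4. It compares the first-order scale ε/r with the zeroth-order scale
b/(yD²). -/
theorem inv_le_of_null_coordinates (hr : 0 < r) (hy : 0 < y) (hD : 0 < D) (hD1 : D ≤ 1)
    (hyf : f = y ^ 2 * D) (hf : f ≤ r ^ 2 / 4) : 1 / r ≤ 1 / (2 * (y * D ^ 2)) := by
  have h1 : (y * D ^ 2) ^ 2 ≤ (r / 2) ^ 2 := by
    have : D ^ 4 ≤ D := by nlinarith [pow_le_one₀ (n := 3) hD.le hD1]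
    have h2 : y ^ 2 * D ^ 4 ≤ y ^ 2 * D := by gcongr
    calc (y * D ^ 2) ^ 2 = y ^ 2 * D ^ 4 := by ring
      _ ≤ r ^ 2 / 4 := by linarith
      _ = (r / 2) ^ 2 := by ring
  have h2 := abs_le_of_sq_le_sq h1 (by positivity)
  apply one_div_le_one_div_of_le (by positivity)
  linarith [le_abs_self (y * D ^ 2)]

theorem inv_sqrt_le (hy : 0 < y) (hD : 0 < D) (hD1 : D ≤ 1) (hyf : f = y ^ 2 * D) :
    1 / √f ≤ 1 / (y * D ^ 2) := by
  apply one_div_le_one_div_of_le (by positivity)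
  apply Real.le_sqrt_of_sq_le
  rw [hyf]
  have : D ^ 4 ≤ D := by nlinarith [pow_le_one₀ (n := 3) hD.le hD1]
  calc (y * D ^ 2) ^ 2 = y ^ 2 * D ^ 4 := by ring
    _ ≤ _ := by gcongr

theorem cQ_sq_le {q : ℝ} (hm : 1 ≤ m) (hr : 0 < r) (hf : 0 < f) (hfr : f ≤ r ^ 2 / 4) (hε : 0 < ε)
    (hεr : ε * r ≤ 1 / 32)
    (hq : q = (m - 1) / 4 * (1 - ε * r) + (m - 2) / 2 * (ε * (f / r))) : q ^ 2 ≤ m ^ 2 := by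
  have h1 : ε * (f / r) ≤ 1 / 128 := by
    have : f / r ≤ r / 4 := by rw [div_le_iff₀ hr]; nlinarith
    nlinarith
  have h2 : 0 < ε * (f / r) := by positivity
  have h3 : 0 < ε * r := by positivity
  generalize ε * (f / r) = z at *
  generalize ε * r = x at *
  apply sq_le_sq'
  · nlinarith
  · nlinarith

/-- Only an upper bound is needed, because □q enters the divergence with the factor -1/2. -/
theorem box_cQ_le {e : ℝ} (hm : 1 ≤ m) (hr : 0 < r) (hf : 0 < f) (hfr : f ≤ r ^ 2 / 4)
    (hε : 0 < ε) (he : e = -(ε * (m - 1) ^ 2 / (4 * r)) + (m - 2) / 2 * ε *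
        ((m - 1) / (2 * r) + (3 - m) * f / r ^ 3)) : e ≤ ε / r * m ^ 2 := by
  have h1 : f / r ^ 2 ≤ 1 / 4 := by rw [div_le_iff₀ (by positivity)]; linarith
  have h2 : 0 < f / r ^ 2 := by positivity
  have h3 : e = ε / r * (-(m - 1) / 4 + (m - 2) * (3 - m) * (f / r ^ 2) / 2) := by
    rw [he]; field_simp; ring
  rw [h3]
  refine mul_le_mul_of_nonneg_left ?_ (by positivity)
  have h4 : (m - 2) * (3 - m) ≤ m ^ 2 := by nlinarith
  nlinarith [sq_nonneg m]


theorem weight_factor_bounds (hε : 0 < ε) (hu : u < 0) (hv : 0 < v) (hr : r = v - u)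
    (hεr : ε * r ≤ 1 / 32) : (31 / 32 ≤ 1 + ε * u ∧ 1 + ε * u ≤ 1) ∧
      (31 / 32 ≤ 1 - ε * v ∧ 1 - ε * v ≤ 1) := by
  subst hr
  have h1 : ε * u < 0 := mul_neg_of_pos_of_neg hε hu
  have h2 : 0 < ε * v := mul_pos hε hv
  rw [mul_sub] at hεr
  refine ⟨⟨?_, ?_⟩, ?_, ?_⟩ <;> linarith

/-- One copy of GM² pays for the source E□φ; this is where the coefficient 1/(4a) of ζf|□φ|² arises.
-/
theorem completed_square {G M β E : ℝ} (ha : 0 < a) (hf : 0 < f) (hG : a / f ≤ G) :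
    0 ≤ E ^ 2 * f * β ^ 2 / (4 * a) + E * β * M + G * M ^ 2 := by
  have h1 : E ^ 2 * f * β ^ 2 / (4 * a) + E * β * M + a / f * M ^ 2 =
      f / (4 * a) * (E * β + 2 * a / f * M) ^ 2 := by
    field_simp
    ring
  have h2 : 0 ≤ f / (4 * a) * (E * β + 2 * a / f * M) ^ 2 := by positivity
  linarith [mul_le_mul_of_nonneg_right hG (sq_nonneg M)]

/-- Used to return from null derivatives of ψ to those of φ, at the cost of a zeroth-order term. -/
theorem sq_half_le {x y c : ℝ} (hc : 31 / 32 ≤ c) :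
    1 / 4 * x ^ 2 - y ^ 2 ≤ (c * x + y) ^ 2 := by
  have h1 : 1 / 2 * (c * x) ^ 2 - y ^ 2 ≤ (c * x + y) ^ 2 := by
    nlinarith [sq_nonneg (c * x + 2 * y)]
  have h2 : 1 / 2 ≤ c ^ 2 := by nlinarith
  nlinarith [mul_le_mul_of_nonneg_right h2 (sq_nonneg x)]

/-- The algebraic core of the pointwise Carleman estimate. -/
theorem pointwise_algebra {κ h G q M T X Y E s β α x y e Z K p₁ p₂ : ℝ}
    (ha : 1 ≤ a) (hf0 : 0 < f) (hκ : 0 < κ) (hκf : κ * f ≤ 1 / 2)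
    (hp₁ : 31 / 32 ≤ p₁) (hp₂ : 31 / 32 ≤ p₂) (hp₁' : p₁ ≤ 1) (hp₂' : p₂ ≤ 1)
    (hDd : D = p₁ * p₂)
    (hG : G = h / (f * D)) (hha : a ≤ h) (hh : h ≤ 2 * a) (hT : 2 * T = p₁ * X + p₂ * Y)
    (hX : p₁ * X = E * (p₁ * x + h * s)) (hY : p₂ * Y = E * (p₂ * y + h * s))
    (hα : 0 ≤ α) (hM : M = T + q * (E * s)) (hK : κ * a ^ 2 ≤ K / 64)
    (hq : q ^ 2 ≤ a ^ 2) (he : e ≤ κ * a ^ 2) (hZ : 3 / 8 * K ≤ Z) :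
    1 / 16 * (κ * E ^ 2 * (x ^ 2 + y ^ 2 + f * α) + K * (E * s) ^ 2) ≤
      E ^ 2 * f * β ^ 2 / (4 * a) + (E * β * M + 2 * G * M ^ 2 +
        κ / 2 * (-(X * Y)) + κ * f / 2 * (E ^ 2 * α) + (Z - 1 / 2 * e) * (E * s) ^ 2) := by
  have hD0 : 1 / 2 ≤ D := by rw [hDd]; nlinarith
  have hD1 : D ≤ 1 := by rw [hDd]; nlinarith
  have hDp : 0 < D := by linarith
  have ha0 : 0 < a := by linarith
  have hh0 : 0 < h := by linarith
  have hGa : a / f ≤ G := by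
    rw [hG, div_le_div_iff₀ hf0 (by positivity)]
    calc a * (f * D) = (a * D) * f := by ring
      _ ≤ (h * 1) * f := by gcongr
      _ = h * f := by ring
  have i1 := completed_square (M := M) (β := β) (E := E) ha0 hf0 hGa
  -- The indefinite product becomes a sum of squares once the square of 2T = p₁X + p₂Y is split off,
  -- and T is M up to a zeroth-order term.
  have i2 : -(X * Y) = (2 * D)⁻¹ * ((p₁ * X) ^ 2 + (p₂ * Y) ^ 2 - 4 * T ^ 2) := by
    have h3 : (p₁ * X) ^ 2 + (p₂ * Y) ^ 2 - 4 * T ^ 2 = -2 * (D * (X * Y)) := by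
      rw [hDd]
      linear_combination (-2 * T - p₁ * X - p₂ * Y) * hT
    rw [h3]; field_simp
  have i3 : T ^ 2 ≤ 2 * M ^ 2 + 2 * q ^ 2 * (E * s) ^ 2 := by
    have : T = M - q * (E * s) := by rw [hM]; ring
    rw [this]
    nlinarith [sq_nonneg (M + q * (E * s))]
  -- The second copy of GM² absorbs the term κD⁻¹T² of the splitting.
  have i4 : κ * (2 * D⁻¹) ≤ G := by
    rw [hG, le_div_iff₀ (by positivity)]
    calc κ * (2 * D⁻¹) * (f * D) = 2 * (κ * f) := by field_simp
      _ ≤ h := by linarith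
  have hDi1 : 1 ≤ D⁻¹ := (one_le_inv₀ hDp).2 hD1
  have hDi2 : D⁻¹ ≤ 2 := by rw [inv_le_comm₀ hDp (by norm_num)]; linarith
  have i5 : (1 / 4 * x ^ 2 - (h * s) ^ 2) * E ^ 2 ≤ (p₁ * X) ^ 2 := by
    rw [hX, mul_pow E, mul_comm (E ^ 2)]
    exact mul_le_mul_of_nonneg_right (sq_half_le hp₁) (sq_nonneg E)
  have i6 : (1 / 4 * y ^ 2 - (h * s) ^ 2) * E ^ 2 ≤ (p₂ * Y) ^ 2 := by
    rw [hY, mul_pow E, mul_comm (E ^ 2)]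
    exact mul_le_mul_of_nonneg_right (sq_half_le hp₂) (sq_nonneg E)
  have i7 : h ^ 2 ≤ 4 * a ^ 2 := (pow_le_pow_left₀ hh0.le hh 2).trans_eq (by ring)
  have j1 : κ / 2 * (-(X * Y)) ≥ κ / 4 * D⁻¹ * (1 / 4 * (x ^ 2 + y ^ 2) * E ^ 2) -
      κ / 2 * D⁻¹ * h ^ 2 * (E * s) ^ 2 - G * M ^ 2 - 2 * κ * D⁻¹ * q ^ 2 * (E * s) ^ 2 := by
    have e1 : κ / 2 * (-(X * Y)) = κ / 4 * D⁻¹ * ((p₁ * X) ^ 2 + (p₂ * Y) ^ 2) -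
        κ * D⁻¹ * T ^ 2 := by rw [i2, mul_inv]; ring
    have hc : 0 < κ / 4 * D⁻¹ := by positivity
    have hc2 : 0 < κ * D⁻¹ := by positivity
    have e2 := mul_le_mul_of_nonneg_left (add_le_add i5 i6) hc.le
    have e3 := mul_le_mul_of_nonneg_left i3 hc2.le
    have e4 := mul_le_mul_of_nonneg_right i4 (sq_nonneg M)
    rw [e1]
    linarith
  have j2 : κ / 16 * ((x ^ 2 + y ^ 2) * E ^ 2) ≤
      κ / 4 * D⁻¹ * (1 / 4 * (x ^ 2 + y ^ 2) * E ^ 2) := by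
    have : 0 ≤ κ / 16 * ((x ^ 2 + y ^ 2) * E ^ 2) := by positivity
    have e := mul_le_mul_of_nonneg_left hDi1 this
    linarith
  -- With D⁻¹ ≤ 2, h ≤ 2a and q² ≤ a², the left side is at most (4 + 4 + 1/2)κa², and κa² ≤ K/64.
  -- What remains of 3/8 K is the 1/16 K of the conclusion.
  have j3 : κ / 2 * D⁻¹ * h ^ 2 + 2 * κ * D⁻¹ * q ^ 2 + 1 / 2 * e ≤ 5 / 16 * K := by
    have e1 : κ / 2 * D⁻¹ * h ^ 2 ≤ κ / 2 * 2 * (4 * a ^ 2) := by gcongr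
    have e2 : 2 * κ * D⁻¹ * q ^ 2 ≤ 2 * κ * 2 * a ^ 2 := by gcongr
    have e3 : 0 < κ * a ^ 2 := by positivity
    linarith
  have j4 : (1 / 16 * K) * (E * s) ^ 2 ≤ (Z - 1 / 2 * e - κ / 2 * D⁻¹ * h ^ 2 -
      2 * κ * D⁻¹ * q ^ 2) * (E * s) ^ 2 :=
    mul_le_mul_of_nonneg_right (by linarith) (sq_nonneg _)
  have j5 : 0 ≤ κ * E ^ 2 * (f * α) := by positivity
  linarith

end Scalars

theorem uP_neg (hf : 0 < fP P p) : uP P p < 0 := by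
  have := abs_lt.1 (abs_tP_lt hf)
  unfold uP; linarith

theorem vP_pos (hf : 0 < fP P p) : 0 < vP P p := by
  have := abs_lt.1 (abs_tP_lt hf)
  unfold vP; linarith

theorem rP_eq_sub (P p : Spacetime n) : rP P p = vP P p - uP P p := by
  unfold uP vP; ring

theorem tP_eq_add (P p : Spacetime n) : tP P p = vP P p + uP P p := by
  unfold uP vP; ring

theorem cD_eq (ε : ℝ) (P p : Spacetime n) :
    cD ε (rP P p) (fP P p) = (1 + ε * uP P p) * (1 - ε * vP P p) := by
  rw [cD, fP, rP_eq_sub]; ring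

theorem cD_bounds (hε : 0 < ε) (hεr : ε * rP P p ≤ 1 / 32) (hf : 0 < fP P p) :
    1 / 2 ≤ cD ε (rP P p) (fP P p) ∧ cD ε (rP P p) (fP P p) ≤ 1 := by
  obtain ⟨⟨h1, h2⟩, h3, h4⟩ := weight_factor_bounds hε (uP_neg hf) (vP_pos hf) (rP_eq_sub P p) hεr
  rw [cD_eq]
  constructor <;> nlinarith

theorem weight_eq (hε : 0 < ε) (hεr : ε * rP P p ≤ 1 / 32) (hf : 0 < fP P p) :
    weight P a b ε p = wt a b ε P p ^ 2 := by
  obtain ⟨⟨h1, h2⟩, h3, h4⟩ := weight_factor_bounds hε (uP_neg hf) (vP_pos hf) (rP_eq_sub P p) hεr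
  have hD : 0 < cD ε (rP P p) (fP P p) := by linarith [(cD_bounds hε hεr hf).1]
  have hX : 0 < fP P p / cD ε (rP P p) (fP P p) := div_pos hf hD
  have hY : 2 * b * √(fP P p) / (√(1 + ε * uP P p) * √(1 - ε * vP P p)) =
      2 * b * cY ε (rP P p) (fP P p) := by
    rw [← Real.sqrt_mul (by linarith), ← cD_eq, cY, Real.sqrt_div hf.le]
    ring
  rw [weight, hY, ← cD_eq, Real.rpow_def_of_pos (by positivity), Real.log_mul hX.ne'
    (Real.exp_pos _).ne', Real.log_exp, wt, cE, sq, ← Real.exp_add]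
  congr 1
  ring

/-- The radial component of the multiplier field. -/
def radialMultiplier (ε : ℝ) (P p : Spacetime n) : ℝ :=
  rP P p * ((1 - ε * rP P p + 2 * (ε * (fP P p / rP P p))) / 2)

theorem multiplier_succ_eq (hr : 0 < rP P p) (i : Fin n) :
    multiplier ε P p i.succ = radialMultiplier ε P p * omega P p i := by
  rw [multiplier_succ, xP_eq hr, radialMultiplier]; ring

theorem two_mul_radialMultiplier (hr : 0 < rP P p) :
    2 * radialMultiplier ε P p = rP P p - ε * (uP P p ^ 2 + vP P p ^ 2) := by
  have : 2 * radialMultiplier ε P p = rP P p - ε * rP P p ^ 2 + 2 * ε * fP P p := by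
    rw [radialMultiplier]; field_simp
  rw [this, fP, rP_eq_sub]; ring

theorem two_mul_multiplier_zero (ε : ℝ) (P p : Spacetime n) :
    2 * multiplier ε P p 0 = tP P p + ε * (uP P p ^ 2 - vP P p ^ 2) := by
  rw [multiplier_zero, tP_eq_add, rP_eq_sub]; ring

/-- In null coordinates 2S = (1 + εu) u∂_u + (1 - εv) v∂_v; this is the relation between T, X and Y
in the algebra. -/
theorem two_mul_fderiv_multiplier (hr : 0 < rP P p) (ψ : Spacetime n → ℝ) :
    2 * fderiv ℝ ψ p (multiplier ε P p) = (1 + ε * uP P p) * (uP P p * dU P ψ p) +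
      (1 - ε * vP P p) * (vP P p * dV P ψ p) := by
  have h : fderiv ℝ ψ p (multiplier ε P p) =
      multiplier ε P p 0 * pd 0 ψ p + radialMultiplier ε P p * dR P ψ p := by
    rw [← sum_mul_pd, Fin.sum_univ_succ, dR, Finset.mul_sum]
    congr 1
    exact Finset.sum_congr rfl fun i _ => by rw [multiplier_succ_eq hr]; ring
  rw [h, dU, dV]
  linear_combination (pd 0 ψ p) * two_mul_multiplier_zero ε P p +
    (dR P ψ p) * two_mul_radialMultiplier (ε := ε) hr + pd 0 ψ p * tP_eq_add P p +
    dR P ψ p * rP_eq_sub P p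

theorem dR_wt_mul {φ : Spacetime n → ℝ} (hf : 0 < fP P p) (hD : 0 < cD ε (rP P p) (fP P p))
    (hφ : DifferentiableAt ℝ φ p) :
    dR P (fun q => wt a b ε P q * φ q) p = wt a b ε P p *
      (dR P φ p + cG a b ε (rP P p) (fP P p) * radialMultiplier ε P p * φ p) := by
  have hr := rP_pos hf
  rw [dR, dR]
  have : ∀ i : Fin n, omega P p i * pd i.succ (fun q => wt a b ε P q * φ q) p =
      wt a b ε P p * (omega P p i * pd i.succ φ p) + wt a b ε P p *
        (cG a b ε (rP P p) (fP P p) * radialMultiplier ε P p * φ p) *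
        (omega P p i * omega P p i) := by
    intro i
    rw [pd_wt_mul hf hD hφ, sg_succ, multiplier_succ_eq hr]
    ring
  simp_rw [this]
  rw [Finset.sum_add_distrib, ← Finset.mul_sum, ← Finset.mul_sum, sum_omega_sq hr]
  ring

/-- The weight is constant on the spheres, so it commutes with their gradient. -/
theorem angGradSq_wt_mul {φ : Spacetime n → ℝ} (hf : 0 < fP P p)
    (hD : 0 < cD ε (rP P p) (fP P p)) (hφ : DifferentiableAt ℝ φ p) :
    angGradSq P (fun q => wt a b ε P q * φ q) p = wt a b ε P p ^ 2 * angGradSq P φ p := by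
  rw [angGradSq, angGradSq, Finset.mul_sum]
  refine Finset.sum_congr rfl fun i _ => ?_
  rw [dR_wt_mul hf hD hφ, pd_wt_mul hf hD hφ, sg_succ, multiplier_succ_eq (rP_pos hf)]
  ring

theorem cG_mul (hf : 0 < fP P p) (hD : 0 < cD ε (rP P p) (fP P p)) :
    cG a b ε (rP P p) (fP P p) * (fP P p * cD ε (rP P p) (fP P p)) =
      a * (1 + b * cY ε (rP P p) (fP P p)) := by
  rw [cG]; field_simp

/-- The factor (1 + εu)u is chosen so that, multiplied by the null component of σ, it gives fD, and
GfD = a(1 + by) is bounded. -/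
theorem dU_wt_mul {φ : Spacetime n → ℝ} (hf : 0 < fP P p) (hD : 0 < cD ε (rP P p) (fP P p))
    (hφ : DifferentiableAt ℝ φ p) :
    (1 + ε * uP P p) * (uP P p * dU P (fun q => wt a b ε P q * φ q) p) = wt a b ε P p *
      ((1 + ε * uP P p) * (uP P p * dU P φ p) +
        a * (1 + b * cY ε (rP P p) (fP P p)) * φ p) := by
  have e : multiplier ε P p 0 + radialMultiplier ε P p = vP P p * (1 - ε * vP P p) := by
    linear_combination 1 / 2 * two_mul_multiplier_zero ε P p +
      1 / 2 * two_mul_radialMultiplier (ε := ε) (rP_pos hf) + 1 / 2 * tP_eq_add P p +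
      1 / 2 * rP_eq_sub P p
  rw [dU, dR_wt_mul hf hD hφ, pd_wt_mul hf hD hφ, sg_zero, ← cG_mul hf hD, cD_eq, fP, dU]
  linear_combination (-(1 + ε * uP P p) * uP P p * wt a b ε P p *
    cG a b ε (rP P p) (-(uP P p * vP P p)) * φ p) * e

theorem dV_wt_mul {φ : Spacetime n → ℝ} (hf : 0 < fP P p) (hD : 0 < cD ε (rP P p) (fP P p))
    (hφ : DifferentiableAt ℝ φ p) :
    (1 - ε * vP P p) * (vP P p * dV P (fun q => wt a b ε P q * φ q) p) = wt a b ε P p *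
      ((1 - ε * vP P p) * (vP P p * dV P φ p) +
        a * (1 + b * cY ε (rP P p) (fP P p)) * φ p) := by
  have e : radialMultiplier ε P p - multiplier ε P p 0 = -(uP P p * (1 + ε * uP P p)) := by
    linear_combination -(1 / 2) * two_mul_multiplier_zero ε P p +
      1 / 2 * two_mul_radialMultiplier (ε := ε) (rP_pos hf) - 1 / 2 * tP_eq_add P p +
      1 / 2 * rP_eq_sub P p
  rw [dV, dR_wt_mul hf hD hφ, pd_wt_mul hf hD hφ, sg_zero, ← cG_mul hf hD, cD_eq, fP, dV]
  linear_combination ((1 - ε * vP P p) * vP P p * wt a b ε P p *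
    cG a b ε (rP P p) (-(uP P p * vP P p)) * φ p) * e

theorem rpow_neg_half {f : ℝ} (hf : 0 < f) : f ^ (-(1 / 2) : ℝ) = 1 / √f := by
  rw [Real.rpow_neg hf.le, ← Real.sqrt_eq_rpow, one_div]

/-- The pointwise Carleman estimate. -/
theorem pointwise_carleman {φ : Spacetime n → ℝ} (hn : 1 ≤ n) (hna : (n : ℝ) ^ 2 ≤ a)
    (hb : 0 < b) (hε : 0 < ε) (hεb : ε ≤ b / 32) (hbr : b * rP P p ≤ 1) (hf : 0 < fP P p)
    (hφ : ContDiffAt ℝ 2 φ p) :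
    1 / 16 * (ε * (weight P a b ε p * (rP P p)⁻¹ * firstOrder P φ p) +
        b * a ^ 2 * (weight P a b ε p * fP P p ^ (-(1 / 2) : ℝ) * φ p ^ 2)) ≤
      weight P a b ε p * fP P p * |box φ p| ^ 2 / (4 * a) +
        divergence (carlemanCurrent a b ε P φ) p := by
  have hr := rP_pos hf
  have hεr : ε * rP P p ≤ 1 / 32 := by
    have := mul_le_mul_of_nonneg_right hεb hr.le
    linarith
  have hDb := cD_bounds hε hεr hf
  have hD : 0 < cD ε (rP P p) (fP P p) := by linarith [hDb.1]
  obtain ⟨⟨h1, h2⟩, h3, h4⟩ := weight_factor_bounds hε (uP_neg hf) (vP_pos hf) (rP_eq_sub P p) hεr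
  have hn1 : (1 : ℝ) ≤ n := by exact_mod_cast hn
  have ha : 1 ≤ a := by nlinarith
  have hφ0 : DifferentiableAt ℝ φ p := hφ.differentiableAt (by simp)
  have hy := cY_pos hf hD
  have hyf : fP P p = cY ε (rP P p) (fP P p) ^ 2 * cD ε (rP P p) (fP P p) := by
    rw [cY_sq hf hD]; field_simp
  have hyr : b * cY ε (rP P p) (fP P p) ≤ 1 := by
    have : cY ε (rP P p) (fP P p) ≤ rP P p := by
      refine abs_le_of_sq_le_sq' ?_ hr.le |>.2
      rw [cY_sq hf hD, div_le_iff₀ hD]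
      nlinarith [fP_le P p, sq_nonneg (rP P p)]
    nlinarith
  have hinv := inv_le_of_null_coordinates hr hy hD hDb.2 hyf (fP_le P p)
  have hsq := inv_sqrt_le hy hD hDb.2 hyf
  have hna2 : (n : ℝ) ^ 2 ≤ a ^ 2 := by nlinarith
  have hκ : 0 < ε / rP P p := by positivity
  -- The constant 64 is 32 from ε ≤ b/32 times 2 from f ≤ r²/4.
  have hK : ε / rP P p * a ^ 2 ≤
      a ^ 2 * b / (cY ε (rP P p) (fP P p) * cD ε (rP P p) (fP P p) ^ 2) / 64 := by
    have e1 : ε * (1 / rP P p) ≤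
        b / 32 * (1 / (2 * (cY ε (rP P p) (fP P p) * cD ε (rP P p) (fP P p) ^ 2))) := by gcongr
    calc ε / rP P p * a ^ 2 = ε * (1 / rP P p) * a ^ 2 := by ring
      _ ≤ b / 32 * (1 / (2 * (cY ε (rP P p) (fP P p) * cD ε (rP P p) (fP P p) ^ 2))) * a ^ 2 := by
        gcongr
      _ = _ := by field_simp; norm_num
  have hκf : ε / rP P p * fP P p ≤ 1 / 2 := by
    rw [div_mul_eq_mul_div, div_le_iff₀ hr]
    nlinarith [fP_le P p]
  have hw : 0 ≤ cW ε (rP P p) (fP P p) := by unfold cW; positivity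
  -- The algebra is applied with p₁ = 1 + εu, p₂ = 1 - εv, X = u∂_uψ, Y = v∂_vψ, T = Sψ, s = φ, e =
  -- □q and K = a²b/(yD²). The bound h ≤ 2a uses by ≤ 1, which follows from y ≤ r and br ≤ 1.
  have key := pointwise_algebra (κ := ε / rP P p) (f := fP P p)
    (h := a * (1 + b * cY ε (rP P p) (fP P p))) (G := cG a b ε (rP P p) (fP P p))
    (q := cQ n ε (rP P p) (fP P p)) (β := box φ p) (α := angGradSq P φ p)
    (x := uP P p * dU P φ p) (y := vP P p * dV P φ p) (Z := cZ a b ε (rP P p) (fP P p))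
    ha hf hκ hκf h1 h3 h2 h4 (cD_eq ε P p) rfl (by nlinarith [mul_pos hb hy])
    (by nlinarith) (two_mul_fderiv_multiplier hr (fun q => wt a b ε P q * φ q))
    (dU_wt_mul hf hD hφ0) (dV_wt_mul hf hD hφ0)
    (Finset.sum_nonneg fun i _ => sq_nonneg _) rfl hK
    ((cQ_sq_le hn1 hr hf (fP_le P p) hε hεr rfl).trans hna2)
    ((box_cQ_le hn1 hr hf (fP_le P p) hε (box_cQ hr)).trans (by gcongr))
    (zeroth_order_lower_bound ha hb hy hD hw)
  have hdiv := divergence_carlemanCurrent (a := a) (b := b) hf hD hφ rfl rfl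
  have hang := sum_sub_radial_sq hr fun i => pd i.succ (fun q => wt a b ε P q * φ q) p
  rw [← dR, ← angGradSq, angGradSq_wt_mul hf hD hφ0] at hang
  have hQ : ∑ j, sg j * (pd j (fun q => wt a b ε P q * φ q) p *
      pd j (fun q => wt a b ε P q * φ q) p) =
      -(dU P (fun q => wt a b ε P q * φ q) p * dV P (fun q => wt a b ε P q * φ q) p) +
        wt a b ε P p ^ 2 * angGradSq P φ p := by
    rw [hang, Fin.sum_univ_succ, sg_zero, dU, dV]
    simp_rw [sg_succ, one_mul]
    ring
  rw [hQ, ← dR, ← hang] at hdiv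
  have e1 : weight P a b ε p * (rP P p)⁻¹ * firstOrder P φ p * ε =
      ε / rP P p * wt a b ε P p ^ 2 * ((uP P p * dU P φ p) ^ 2 + (vP P p * dV P φ p) ^ 2 +
        fP P p * angGradSq P φ p) := by
    rw [weight_eq hε hεr hf, firstOrder, sq_abs, sq_abs]
    ring
  have e2 : b * a ^ 2 * (weight P a b ε p * fP P p ^ (-(1 / 2) : ℝ) * φ p ^ 2) ≤
      a ^ 2 * b / (cY ε (rP P p) (fP P p) * cD ε (rP P p) (fP P p) ^ 2) *
        (wt a b ε P p * φ p) ^ 2 := by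
    rw [weight_eq hε hεr hf, rpow_neg_half hf]
    calc _ = (1 / √(fP P p)) * (b * a ^ 2 * (wt a b ε P p * φ p) ^ 2) := by ring
      _ ≤ (1 / (cY ε (rP P p) (fP P p) * cD ε (rP P p) (fP P p) ^ 2)) *
          (b * a ^ 2 * (wt a b ε P p * φ p) ^ 2) := by gcongr
      _ = _ := by ring
  have e3 : cW ε (rP P p) (fP P p) = ε / rP P p * fP P p / 2 := by unfold cW; field_simp
  have e4 : fP P p = -(uP P p * vP P p) := rfl
  rw [hdiv, e3, sq_abs, weight_eq hε hεr hf]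
  rw [weight_eq hε hεr hf] at e1 e2
  generalize fderiv ℝ (fun q => wt a b ε P q * φ q) p (multiplier ε P p) +
    cQ n ε (rP P p) (fP P p) * (wt a b ε P p * φ p) = M at *
  generalize dU P (fun q => wt a b ε P q * φ q) p = du at *
  generalize dV P (fun q => wt a b ε P q * φ q) p = dv at *
  have e5 : ε / rP P p / 2 * -(uP P p * du * (vP P p * dv)) =
      ε / rP P p * fP P p / 2 * (du * dv) := by rw [e4]; ring
  rw [e5] at key
  have e6 : ε * (fP P p / rP P p) = ε / rP P p * fP P p := by ring
  rw [e6]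
  linarith

end Mink

end

/-! ### The current as a function of the first jet of φ, continuous up to the boundary. -/

noncomputable section

namespace Mink

variable {n : ℕ} {a b ε : ℝ} {P p : Spacetime n}

/-- The differential of the conjugated function, in terms of the first jet `(φ, L)`. -/
def jetGrad (a b ε : ℝ) (P : Spacetime n) (L : Spacetime n → Spacetime n →L[ℝ] ℝ)
    (φ : Spacetime n → ℝ) (k : Fin (n + 1)) (p : Spacetime n) : ℝ :=
  wt a b ε P p * (L p (EuclideanSpace.single k 1) +
    cG a b ε (rP P p) (fP P p) * (sg k * multiplier ε P p k) * φ p)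

/-- The multiplier applied to the conjugated function. -/
def jetMultiplier (a b ε : ℝ) (P : Spacetime n) (L : Spacetime n → Spacetime n →L[ℝ] ℝ)
    (φ : Spacetime n → ℝ) (p : Spacetime n) : ℝ :=
  (∑ j, multiplier ε P p j * jetGrad a b ε P L φ j p) +
    cQ n ε (rP P p) (fP P p) * (wt a b ε P p * φ p)

/-- The current, in terms of the first jet. -/
def jetCurrent (a b ε : ℝ) (P : Spacetime n) (L : Spacetime n → Spacetime n →L[ℝ] ℝ)
    (φ : Spacetime n → ℝ) (p : Spacetime n) : Spacetime n := WithLp.toLp 2 fun k =>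
  sg k * jetGrad a b ε P L φ k p * jetMultiplier a b ε P L φ p -
    1 / 2 * (multiplier ε P p k *
      ∑ j, sg j * (jetGrad a b ε P L φ j p * jetGrad a b ε P L φ j p)) -
    1 / 2 * (wt a b ε P p * φ p * (wt a b ε P p * φ p) *
      (sg k * pd k (fun q => cQ n ε (rP P q) (fP P q)) p)) +
    cB a b ε (rP P p) (fP P p) * (wt a b ε P p * φ p * (wt a b ε P p * φ p)) *
      multiplier ε P p k

/-- The part of the divergence of the current without second derivatives. -/
def jetRemainder (a b ε : ℝ) (P : Spacetime n) (L : Spacetime n → Spacetime n →L[ℝ] ℝ)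
    (φ : Spacetime n → ℝ) (p : Spacetime n) : ℝ :=
  2 * cG a b ε (rP P p) (fP P p) * jetMultiplier a b ε P L φ p ^ 2 +
    ε * (fP P p / rP P p) *
      ((∑ i : Fin n, jetGrad a b ε P L φ i.succ p * jetGrad a b ε P L φ i.succ p) -
        (∑ i : Fin n, omega P p i * jetGrad a b ε P L φ i.succ p) ^ 2) -
    cW ε (rP P p) (fP P p) *
      (∑ j, sg j * (jetGrad a b ε P L φ j p * jetGrad a b ε P L φ j p)) +
    (cZ a b ε (rP P p) (fP P p) - 1 / 2 * box (fun q => cQ n ε (rP P q) (fP P q)) p) *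
      (wt a b ε P p * φ p * (wt a b ε P p * φ p))

section Jet

variable {φ : Spacetime n → ℝ} {L : Spacetime n → Spacetime n →L[ℝ] ℝ}

theorem pd_wt_mul_eq_jetGrad (hf : 0 < fP P p) (hD : 0 < cD ε (rP P p) (fP P p))
    (hφ : DifferentiableAt ℝ φ p) (hL : L p = fderiv ℝ φ p) (k : Fin (n + 1)) :
    pd k (fun q => wt a b ε P q * φ q) p = jetGrad a b ε P L φ k p := by
  rw [pd_wt_mul hf hD hφ, jetGrad, hL, pd]

/-- With the derivative within the closure in place of L, the jet expression extends the current
continuously to boundary points, where full partial derivatives of φ may carry no information. -/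
theorem carlemanCurrent_eq_jetCurrent (hf : 0 < fP P p) (hD : 0 < cD ε (rP P p) (fP P p))
    (hφ : DifferentiableAt ℝ φ p) (hL : L p = fderiv ℝ φ p) :
    carlemanCurrent a b ε P φ p = jetCurrent a b ε P L φ p := by
  have h := pd_wt_mul_eq_jetGrad (a := a) (b := b) hf hD hφ hL
  simp only [carlemanCurrent, energyCurrent, jetCurrent, jetMultiplier, h]

/-- Second derivatives of φ enter only through □φ; the rest is continuous up to the boundary.
Integrability of the divergence is thereby reduced to that of □φ. -/
theorem divergence_carlemanCurrent_eq_jet (hf : 0 < fP P p)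
    (hD : 0 < cD ε (rP P p) (fP P p)) (hφ : ContDiffAt ℝ 2 φ p) (hL : L p = fderiv ℝ φ p) :
    divergence (carlemanCurrent a b ε P φ) p =
      box φ p * (wt a b ε P p * jetMultiplier a b ε P L φ p) + jetRemainder a b ε P L φ p := by
  have h := pd_wt_mul_eq_jetGrad (a := a) (b := b) hf hD (hφ.differentiableAt (by simp)) hL
  rw [divergence_carlemanCurrent (a := a) (b := b) hf hD hφ rfl rfl, ← sum_mul_pd, jetRemainder]
  simp only [h, jetMultiplier]
  ring

theorem contDiffAt_carlemanCurrent (hf : 0 < fP P p) (hD : 0 < cD ε (rP P p) (fP P p))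
    (hφ : ContDiffAt ℝ 2 φ p) : ContDiffAt ℝ 1 (carlemanCurrent a b ε P φ) p := by
  have hr := rP_pos hf
  have one : (1 : WithTop ℕ∞) ≤ ∞ := le_trans (by norm_num) two_le_infty
  have hψ : ContDiffAt ℝ 2 (fun q => wt a b ε P q * φ q) p :=
    ((contDiffAt_wt hf hD).of_le two_le_infty).mul hφ
  have hψ1 : ContDiffAt ℝ 1 (fun q => wt a b ε P q * φ q) p := hψ.of_le (by norm_num)
  have hq : ContDiffAt ℝ 2 (fun q => cQ n ε (rP P q) (fP P q)) p :=
    (contDiffAt_cQ hr).of_le two_le_infty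
  have hq1 : ContDiffAt ℝ 1 (fun q => cQ n ε (rP P q) (fP P q)) p := hq.of_le (by norm_num)
  have hB : ContDiffAt ℝ 1 (fun q => cB a b ε (rP P q) (fP P q)) p :=
    (contDiffAt_cB hr hf hD).of_le one
  have hS : ∀ k, ContDiffAt ℝ 1 (fun q => multiplier ε P q k) p := fun k =>
    (contDiffAt_multiplier hr k).of_le one
  have hd := contDiffAt_pd hψ
  have hT : ContDiffAt ℝ 1 (fun x => ∑ j, multiplier ε P x j *
      pd j (fun q => wt a b ε P q * φ q) x) p := ContDiffAt.sum fun j _ => (hS j).mul (hd j)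
  have hQ : ContDiffAt ℝ 1 (fun x => ∑ j, sg j * (pd j (fun q => wt a b ε P q * φ q) x *
      pd j (fun q => wt a b ε P q * φ q) x)) p :=
    ContDiffAt.sum fun j _ => contDiffAt_const.mul ((hd j).mul (hd j))
  rw [contDiffAt_euclidean]
  intro k
  exact (((contDiffAt_const.mul (hd k)).mul (hT.add (hq1.mul hψ1))).sub
    (contDiffAt_const.mul ((hS k).mul hQ))).sub (contDiffAt_const.mul ((hψ1.mul hψ1).mul
      (contDiffAt_const.mul (contDiffAt_pd hq k)))) |>.add ((hB.mul (hψ1.mul hψ1)).mul (hS k))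

/-- The region in which the coefficients of the current are smooth. -/
def regularRegion (ε : ℝ) (P : Spacetime n) : Set (Spacetime n) :=
  {q | 0 < fP P q ∧ 0 < cD ε (rP P q) (fP P q)}

variable {s : Set (Spacetime n)}

theorem continuousOn_jetGrad (hs : s ⊆ regularRegion ε P) (hL : ContinuousOn L s)
    (hφ : ContinuousOn φ s) (k : Fin (n + 1)) : ContinuousOn (jetGrad a b ε P L φ k) s := by
  have h1 : ContinuousOn (wt a b ε P) s := fun q hq =>
    (contDiffAt_wt (hs hq).1 (hs hq).2).continuousAt.continuousWithinAt
  have h2 : ContinuousOn (fun q => cG a b ε (rP P q) (fP P q)) s := fun q hq =>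
    (contDiffAt_cG (rP_pos (hs hq).1) (hs hq).1 (hs hq).2).continuousAt.continuousWithinAt
  have h3 : ContinuousOn (fun q => multiplier ε P q k) s := fun q hq =>
    (contDiffAt_multiplier (rP_pos (hs hq).1) k).continuousAt.continuousWithinAt
  exact h1.mul ((hL.clm_apply continuousOn_const).add
    ((h2.mul (continuousOn_const.mul h3)).mul hφ))

theorem continuousOn_jetMultiplier (hs : s ⊆ regularRegion ε P) (hL : ContinuousOn L s)
    (hφ : ContinuousOn φ s) : ContinuousOn (jetMultiplier a b ε P L φ) s := by
  have h1 : ContinuousOn (wt a b ε P) s := fun q hq =>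
    (contDiffAt_wt (hs hq).1 (hs hq).2).continuousAt.continuousWithinAt
  have h2 : ContinuousOn (fun q => cQ n ε (rP P q) (fP P q)) s := fun q hq =>
    (contDiffAt_cQ (rP_pos (hs hq).1)).continuousAt.continuousWithinAt
  have h3 : ∀ k, ContinuousOn (fun q => multiplier ε P q k) s := fun k q hq =>
    (contDiffAt_multiplier (rP_pos (hs hq).1) k).continuousAt.continuousWithinAt
  exact (continuousOn_finsetSum _ fun k _ => (h3 k).mul (continuousOn_jetGrad hs hL hφ k)).add
    (h2.mul (h1.mul hφ))

theorem continuousOn_jetCurrent (hs : s ⊆ regularRegion ε P) (hL : ContinuousOn L s)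
    (hφ : ContinuousOn φ s) : ContinuousOn (jetCurrent a b ε P L φ) s := by
  have h1 : ContinuousOn (fun q => wt a b ε P q * φ q) s := ContinuousOn.mul (fun q hq =>
    (contDiffAt_wt (hs hq).1 (hs hq).2).continuousAt.continuousWithinAt) hφ
  have h2 : ∀ k, ContinuousOn (pd k fun q => cQ n ε (rP P q) (fP P q)) s := fun k q hq =>
    (contDiffAt_pd ((contDiffAt_cQ (rP_pos (hs hq).1)).of_le two_le_infty)
      k).continuousAt.continuousWithinAt
  have h3 : ∀ k, ContinuousOn (fun q => multiplier ε P q k) s := fun k q hq =>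
    (contDiffAt_multiplier (rP_pos (hs hq).1) k).continuousAt.continuousWithinAt
  have h4 : ContinuousOn (fun q => cB a b ε (rP P q) (fP P q)) s := fun q hq =>
    (contDiffAt_cB (rP_pos (hs hq).1) (hs hq).1 (hs hq).2).continuousAt.continuousWithinAt
  have h5 := continuousOn_jetGrad (a := a) (b := b) hs hL hφ
  have h6 := continuousOn_jetMultiplier (a := a) (b := b) hs hL hφ
  refine (PiLp.continuous_toLp 2 _).comp_continuousOn (continuousOn_pi.2 fun k => ?_)
  exact (((continuousOn_const.mul (h5 k)).mul h6).sub (continuousOn_const.mul ((h3 k).mul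
    (continuousOn_finsetSum _ fun j _ => continuousOn_const.mul ((h5 j).mul (h5 j)))))).sub
    (continuousOn_const.mul ((h1.mul h1).mul (continuousOn_const.mul (h2 k)))) |>.add
    ((h4.mul (h1.mul h1)).mul (h3 k))

theorem continuousOn_jetRemainder (hs : s ⊆ regularRegion ε P) (hL : ContinuousOn L s)
    (hφ : ContinuousOn φ s) : ContinuousOn (jetRemainder a b ε P L φ) s := by
  have hr : ContinuousOn (rP P) s := (continuous_rP P).continuousOn
  have hf : ContinuousOn (fP P) s := (contDiff_fP P).continuous.continuousOn
  have hr0 : ∀ q ∈ s, rP P q ≠ 0 := fun q hq => (rP_pos (hs hq).1).ne'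
  have hY : ContinuousOn (fun q => cY ε (rP P q) (fP P q)) s := fun q hq =>
    (contDiffAt_cY (rP_pos (hs hq).1) (hs hq).1 (hs hq).2).continuousAt.continuousWithinAt
  have hY0 : ∀ q ∈ s, cY ε (rP P q) (fP P q) ≠ 0 := fun q hq => (cY_pos (hs hq).1 (hs hq).2).ne'
  have hD : ContinuousOn (fun q => cD ε (rP P q) (fP P q)) s := (continuous_cD ε P).continuousOn
  have hD0 : ∀ q ∈ s, cD ε (rP P q) (fP P q) ≠ 0 := fun q hq => (hs hq).2.ne'
  have hW : ContinuousOn (fun q => cW ε (rP P q) (fP P q)) s := fun q hq =>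
    (contDiffAt_cW (rP_pos (hs hq).1)).continuousAt.continuousWithinAt
  have hG : ContinuousOn (fun q => cG a b ε (rP P q) (fP P q)) s := fun q hq =>
    (contDiffAt_cG (rP_pos (hs hq).1) (hs hq).1 (hs hq).2).continuousAt.continuousWithinAt
  have hZ : ContinuousOn (fun q => cZ a b ε (rP P q) (fP P q)) s := by
    unfold cZ
    refine ContinuousOn.div ?_ (hD.pow 2) fun q hq => pow_ne_zero 2 (hD0 q hq)
    have e1 := (continuousOn_const (c := b)).div hY hY0
    have e2 := (continuousOn_const (c := a * b)).div hY hY0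
    have e3 := (continuousOn_const (c := a)).mul ((continuousOn_const (c := (1 : ℝ))).add
      ((continuousOn_const (c := b)).mul hY))
    have e4 := (continuousOn_const (c := a * b)).div ((continuousOn_const (c := (8 : ℝ))).mul hY)
      fun q hq => mul_ne_zero (by norm_num) (hY0 q hq)
    exact (((((continuousOn_const.mul (e1.add continuousOn_const)).div_const _).add
      (hW.mul ((e3.div hY hY0).pow 2))).sub e4).sub (hW.mul e2)).sub
      ((hW.mul (e3.div (hY.pow 2) fun q hq => pow_ne_zero 2 (hY0 q hq))).div_const _)
  have hbox : ContinuousOn (fun p => box (fun q => cQ n ε (rP P q) (fP P q)) p) s := by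
    have e : ContinuousOn (fun p => -(ε * ((n : ℝ) - 1) ^ 2 / (4 * rP P p)) + (n - 2) / 2 * ε *
        ((n - 1) / (2 * rP P p) + (3 - n) * fP P p / rP P p ^ 3)) s := by
      refine ContinuousOn.add (ContinuousOn.neg (continuousOn_const.div
        (continuousOn_const.mul hr) fun q hq => mul_ne_zero (by norm_num) (hr0 q hq)))
        (continuousOn_const.mul (ContinuousOn.add (continuousOn_const.div
        (continuousOn_const.mul hr) fun q hq => mul_ne_zero (by norm_num) (hr0 q hq))
        ((continuousOn_const.mul hf).div (hr.pow 3) fun q hq => pow_ne_zero 3 (hr0 q hq))))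
    exact e.congr fun q hq => box_cQ (rP_pos (hs hq).1)
  have hω : ∀ i, ContinuousOn (fun q => omega P q i) s := fun i =>
    ((contDiff_xP P i).continuous.continuousOn.div hr hr0)
  have h1 : ContinuousOn (fun q => wt a b ε P q * φ q) s := ContinuousOn.mul (fun q hq =>
    (contDiffAt_wt (hs hq).1 (hs hq).2).continuousAt.continuousWithinAt) hφ
  have h5 := continuousOn_jetGrad (a := a) (b := b) hs hL hφ
  have h6 := continuousOn_jetMultiplier (a := a) (b := b) hs hL hφ
  exact ((((continuousOn_const.mul hG).mul (h6.pow 2)).add ((continuousOn_const.mul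
    (hf.div hr hr0)).mul ((continuousOn_finsetSum _ fun i _ => (h5 i.succ).mul (h5 i.succ)).sub
      ((continuousOn_finsetSum _ fun i _ => (hω i).mul (h5 i.succ)).pow 2)))).sub
    (hW.mul (continuousOn_finsetSum _ fun j _ => continuousOn_const.mul ((h5 j).mul (h5 j))))).add
    ((hZ.sub (continuousOn_const.mul hbox)).mul (h1.mul h1))

end Jet

end Mink

end

/-! ### Geometry of the boundary and the flux of the current for φ = 0. -/

noncomputable section

namespace Mink

variable {n : ℕ} {a b ε : ℝ} {P p : Spacetime n} {U : Set (Spacetime n)}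

theorem isOpen_of_definingFunctions (hb : ∀ p ∈ frontier U, ∃ ρ, IsDefiningFunctionAt U p ρ) :
    IsOpen U := by
  rw [isOpen_iff_mem_nhds]
  intro p hp
  by_contra h
  have hpf : p ∈ frontier U := ⟨subset_closure hp, fun h' => h (mem_interior_iff_mem_nhds.1 h')⟩
  obtain ⟨ρ, hρ⟩ := hb p hpf
  have := hρ.eventually_mem_iff.self_of_nhds.1 hp
  rw [hρ.eq_zero hpf] at this
  exact lt_irrefl _ this

theorem IsDefiningFunctionAt.mem_tangentConeAt {ρ : Spacetime n → ℝ}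
    (hρ : IsDefiningFunctionAt U p ρ) (hp : p ∈ frontier U) {w : Spacetime n}
    (hw : fderiv ℝ ρ p w < 0) : w ∈ tangentConeAt ℝ U p := by
  have hd : HasDerivAt (fun s : ℝ => ρ (p + s • w)) (fderiv ℝ ρ p w) 0 :=
    (hρ.smooth.differentiable (by simp) p).hasFDerivAt.hasLineDerivAt w
  have h1 := (hasDerivWithinAt_iff_tendsto_slope' (by simp)).1 (hd.hasDerivWithinAt (s := Ioi 0))
  have hl : Tendsto (fun s : ℝ => p + s • w) (𝓝[>] 0) (𝓝 p) := by
    have h1 : ContinuousAt (fun s : ℝ => p + s • w) 0 := by fun_prop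
    have h2 := h1.tendsto
    simp only [zero_smul, add_zero] at h2
    exact h2.mono_left nhdsWithin_le_nhds
  refine mem_tangentConeAt_of_add_smul_mem (l := 𝓝[>] (0 : ℝ)) (c := fun s => s) ?_ ?_
  · exact tendsto_id.mono_left (nhdsWithin_mono _ fun x hx => (ne_of_gt hx : x ≠ 0))
  · filter_upwards [h1.eventually_lt_const hw, hl.eventually hρ.eventually_mem_iff,
      self_mem_nhdsWithin] with s hs hs1 hs2
    have hs2' : (0 : ℝ) < s := hs2
    rw [hs1]
    simp only [slope_def_field, zero_smul, add_zero, sub_zero, hρ.eq_zero hp] at hs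
    by_contra h
    exact absurd hs (not_lt.2 (div_nonneg (not_lt.1 h) hs2'.le))

/-- The tangent cone at a boundary point contains the open half-space dρ < 0, which spans: every x
is (x + cw) - cw with w in the half-space and c large. -/
theorem uniqueDiffOn_closure_of_definingFunctions
    (hb : ∀ p ∈ frontier U, ∃ ρ, IsDefiningFunctionAt U p ρ) : UniqueDiffOn ℝ (closure U) := by
  have hU := isOpen_of_definingFunctions hb
  intro p hp
  by_cases hpU : p ∈ U
  · exact (hU.uniqueDiffWithinAt hpU).closure
  have hpf : p ∈ frontier U := by
    rw [hU.frontier_eq]; exact ⟨hp, hpU⟩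
  obtain ⟨ρ, hρ⟩ := hb p hpf
  refine UniqueDiffWithinAt.closure ⟨?_, hp⟩
  obtain ⟨w, hw⟩ : ∃ w, fderiv ℝ ρ p w < 0 := by
    by_contra! h
    refine hρ.fderiv_ne_zero (ContinuousLinearMap.ext fun w => le_antisymm ?_ (h w))
    have := h (-w)
    simp only [map_neg] at this
    simpa using this
  have htop : Submodule.span ℝ (tangentConeAt ℝ U p) = ⊤ := by
    rw [eq_top_iff]
    intro x _
    obtain ⟨c, hc⟩ := exists_gt (fderiv ℝ ρ p x / -fderiv ℝ ρ p w)
    rw [div_lt_iff₀ (by linarith)] at hc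
    have h1 : x + c • w ∈ Submodule.span ℝ (tangentConeAt ℝ U p) := by
      refine Submodule.subset_span (hρ.mem_tangentConeAt hpf ?_)
      simp only [map_add, map_smul, smul_eq_mul]
      linarith
    have h2 := Submodule.smul_mem _ c
      (Submodule.subset_span (R := ℝ) (hρ.mem_tangentConeAt hpf hw))
    have := Submodule.sub_mem _ h1 h2
    simpa using this
  rw [htop]
  exact dense_univ

/-- A function that vanishes on the boundary has vanishing tangential derivatives there. -/
theorem IsDefiningFunctionAt.apply_eq_zero_of_tangent {ρ φ : Spacetime n → ℝ}
    (hρ : IsDefiningFunctionAt U p ρ) (hp : p ∈ frontier U) {ℓ : Spacetime n →L[ℝ] ℝ}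
    (hℓ : HasFDerivWithinAt φ ℓ (closure U) p)
    (hφ : ∀ᶠ q in 𝓝 p, q ∈ frontier U → φ q = 0) {w : Spacetime n}
    (hw : fderiv ℝ ρ p w = 0) : ℓ w = 0 := by
  have hs : HasStrictFDerivAt ρ (fderiv ℝ ρ p) p :=
    hρ.smooth.contDiffAt.hasStrictFDerivAt (by simp)
  have hne : (fderiv ℝ ρ p).toLinearMap ≠ 0 := fun h => hρ.fderiv_ne_zero (by
    ext x
    exact congrArg (fun g : Spacetime n →ₗ[ℝ] ℝ => g x) h)
  have hrange : (fderiv ℝ ρ p).range = ⊤ := LinearMap.range_eq_top.2 (LinearMap.surjective hne)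
  let w' : (fderiv ℝ ρ p).ker := ⟨w, hw⟩
  have hg : HasDerivAt (fun s : ℝ => s • w') w' 0 := by
    simpa using (hasDerivAt_id (0 : ℝ)).smul_const w'
  -- The implicit function theorem gives a curve in the level set of ρ through p with velocity w. It
  -- stays in the boundary, so φ vanishes along it.
  have hγ : HasDerivAt (fun s : ℝ => hs.implicitFunction ρ _ hrange (ρ p) (s • w')) w 0 := by
    have h1 : HasFDerivAt (hs.implicitFunction ρ _ hrange (ρ p))
        (fderiv ℝ ρ p).ker.subtypeL ((0 : ℝ) • w') := by
      rw [zero_smul]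
      exact (hs.to_implicitFunction hrange).hasFDerivAt
    exact h1.comp_hasDerivAt (0 : ℝ) hg
  set γ := fun s : ℝ => hs.implicitFunction ρ _ hrange (ρ p) (s • w') with hγd
  have hγ0 : γ 0 = p := by
    simp only [hγd, zero_smul]
    exact hs.implicitFunction_apply_image hrange
  have hρ0 : ∀ᶠ s in 𝓝 (0 : ℝ), ρ (γ s) = 0 := by
    have h1 := hs.map_implicitFunction_eq hrange
    have h2 : Tendsto (fun s : ℝ => (ρ p, s • w')) (𝓝 0) (𝓝 (ρ p, 0)) := by
      have : ContinuousAt (fun s : ℝ => (ρ p, s • w')) 0 := by fun_prop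
      simpa [ContinuousAt] using this
    filter_upwards [h2.eventually h1] with s hs'
    rw [← hρ.eq_zero hp]
    exact hs'
  have hγt : Tendsto γ (𝓝 0) (𝓝 p) := by
    have := hγ.continuousAt.tendsto
    rwa [hγ0] at this
  have hfr : ∀ᶠ s in 𝓝 (0 : ℝ), γ s ∈ frontier U := by
    filter_upwards [hρ0, hγt.eventually hρ.eventually_frontier] with s h1 h2 using h2.2 h1
  have hzero : (fun s => φ (γ s)) =ᶠ[𝓝 0] fun _ => 0 := by
    filter_upwards [hfr, hγt.eventually hφ] with s h1 h2 using h2 h1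
  have h1 : HasFDerivWithinAt φ ℓ (closure U) (γ 0) := by rwa [hγ0]
  have hmem : ∀ᶠ s in 𝓝 (0 : ℝ), γ s ∈ closure U :=
    hfr.mono fun s h => frontier_subset_closure h
  have h2 : HasDerivWithinAt (fun s => φ (γ s)) (ℓ w) (γ ⁻¹' closure U) 0 :=
    h1.comp_hasDerivWithinAt (0 : ℝ) hγ.hasDerivWithinAt (fun s hs => hs)
  have h3 : HasDerivAt (fun s => φ (γ s)) (ℓ w) 0 := h2.hasDerivAt hmem
  exact h3.unique ((hasDerivAt_const (0 : ℝ) (0 : ℝ)).congr_of_eventuallyEq hzero)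

theorem norm_fderiv_eq_norm_grad (ρ : Spacetime n → ℝ) (p : Spacetime n) :
    ‖fderiv ℝ ρ p‖ = ‖grad ρ p‖ := by
  set v : Spacetime n := WithLp.toLp 2 fun k => pd k ρ p with hv
  have h1 : fderiv ℝ ρ p = innerSL ℝ v := by
    ext x
    rw [innerSL_apply_apply, ← sum_pd_mul, PiLp.inner_apply]
    exact Finset.sum_congr rfl fun k _ => by simp [hv, mul_comm]
  rw [h1, innerSL_apply_norm, EuclideanSpace.norm_eq, EuclideanSpace.norm_eq, Fin.sum_univ_succ,
    Fin.sum_univ_succ]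
  simp [hv, grad]

theorem grad_apply (ρ : Spacetime n → ℝ) (p : Spacetime n) (k : Fin (n + 1)) :
    grad ρ p k = sg k * pd k ρ p := by
  refine Fin.cases ?_ (fun i => ?_) k <;> simp [grad]

/-- The boundary flux of the current for functions that vanish on the boundary. -/
theorem areaDensity_mul_boundaryTerm {φ : Spacetime n → ℝ}
    {L : Spacetime n → Spacetime n →L[ℝ] ℝ} (hε : 0 < ε) (hεr : ε * rP P p ≤ 1 / 32)
    (hf : 0 < fP P p) (hρ : fderiv ℝ (definingFunction U p) p ≠ 0)
    (hm : 0 < metric (grad (definingFunction U p) p) (grad (definingFunction U p) p))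
    (hL : ∀ w, fderiv ℝ (definingFunction U p) p w = 0 → L p w = 0) (hφ : φ p = 0) :
    areaDensity U p * (weight P a b ε p * boundaryFactor U P ε p * |L p (normal U p)| ^ 2) =
      2 * flux U (jetCurrent a b ε P L φ) p := by
  have hr := rP_pos hf
  set ρ := definingFunction U p with hρd
  set m := metric (grad ρ p) (grad ρ p) with hmd
  have hm0 : m = ∑ k, sg k * (pd k ρ p * pd k ρ p) := by
    rw [hmd, metric_eq_sum]
    refine Finset.sum_congr rfl fun k _ => ?_
    rw [grad_apply]
    linear_combination (sg k * pd k ρ p * pd k ρ p) * sg_mul_self k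
  set σ := ∑ k, multiplier ε P p k * pd k ρ p with hσ
  obtain ⟨w, hw⟩ : ∃ w, fderiv ℝ ρ p w ≠ 0 := by
    by_contra! h
    exact hρ (ContinuousLinearMap.ext h)
  -- Since L annihilates the kernel of dρ, it equals c dρ, and all jet quantities become multiples
  -- of E c.
  set c := L p w / fderiv ℝ ρ p w with hc
  have hLc : ∀ x, L p x = c * fderiv ℝ ρ p x := by
    intro x
    have h1 := hL (x - (fderiv ℝ ρ p x / fderiv ℝ ρ p w) • w) (by
      simp [div_mul_cancel₀ _ hw])
    simp only [map_sub, map_smul, smul_eq_mul] at h1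
    rw [sub_eq_zero.1 h1, hc]
    ring
  have hj : ∀ k, jetGrad a b ε P L φ k p = wt a b ε P p * (c * pd k ρ p) := by
    intro k
    rw [jetGrad, hφ, hLc, pd]
    ring
  have hM : jetMultiplier a b ε P L φ p = wt a b ε P p * c * σ := by
    rw [jetMultiplier, hφ, hσ, Finset.mul_sum]
    simp_rw [hj]
    rw [mul_zero, mul_zero, add_zero]
    exact Finset.sum_congr rfl fun k _ => by ring
  have hQ : ∑ j, sg j * (jetGrad a b ε P L φ j p * jetGrad a b ε P L φ j p) =
      wt a b ε P p ^ 2 * c ^ 2 * m := by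
    rw [hm0, Finset.mul_sum]
    simp_rw [hj]
    exact Finset.sum_congr rfl fun k _ => by ring
  have hJ : ∀ k, jetCurrent a b ε P L φ p k = wt a b ε P p ^ 2 * c ^ 2 *
      (σ * (sg k * pd k ρ p) - 1 / 2 * m * multiplier ε P p k) := by
    intro k
    simp only [jetCurrent]
    rw [hQ, hM, hj, hφ]
    ring
  -- Let m be the metric square of the gradient of ρ, and here σ = dρ(S). Then J = E²c²(σ∇ρ - mS/2),
  -- so the two terms of dρ(J) combine to half of E²c²mσ. On the other side 𝒩φ = c√m, the boundary
  -- factor is σ/√m and the area density is √m/|dρ|.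
  have hflux : fderiv ℝ ρ p (jetCurrent a b ε P L φ p) =
      1 / 2 * (wt a b ε P p ^ 2 * c ^ 2 * m * σ) := by
    rw [← sum_pd_mul]
    simp_rw [hJ]
    have : ∀ k, pd k ρ p * (wt a b ε P p ^ 2 * c ^ 2 *
        (σ * (sg k * pd k ρ p) - 1 / 2 * m * multiplier ε P p k)) =
        wt a b ε P p ^ 2 * c ^ 2 * σ * (sg k * (pd k ρ p * pd k ρ p)) -
        wt a b ε P p ^ 2 * c ^ 2 * (1 / 2 * m) * (multiplier ε P p k * pd k ρ p) :=
      fun k => by ring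
    simp_rw [this]
    rw [Finset.sum_sub_distrib, ← Finset.mul_sum, ← Finset.mul_sum, ← hm0, ← hσ]
    ring
  have hsq : √m * √m = m := Real.mul_self_sqrt hm.le
  have hsq0 : 0 < √m := Real.sqrt_pos.2 hm
  have hN : ∀ g : Spacetime n → ℝ, fderiv ℝ g p (normal U p) =
      (√m)⁻¹ * ∑ k, sg k * (pd k g p * pd k ρ p) := by
    intro g
    rw [normal, map_smul, smul_eq_mul, ← hρd, ← hmd, ← sum_pd_mul]
    congr 1
    exact Finset.sum_congr rfl fun k _ => by rw [grad_apply]; ring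
  have hLN : L p (normal U p) = c * √m := by
    rw [hLc, hN, ← hm0]
    have h1 : (√m)⁻¹ * m = √m := by
      rw [inv_mul_eq_iff_eq_mul₀ hsq0.ne', hsq]
    rw [h1]
  have hbf : boundaryFactor U P ε p = (√m)⁻¹ * σ := by
    rw [boundaryFactor, hN, hN, hσ]
    simp_rw [multiplier_eq hr]
    have : ∀ k, sg k * ((1 - ε * rP P p) * pd k (fP P) p + ε * fP P p * pd k (rP P) p) *
        pd k ρ p = (1 - ε * rP P p) * (sg k * (pd k (fP P) p * pd k ρ p)) +
          ε * fP P p * (sg k * (pd k (rP P) p * pd k ρ p)) := fun k => by ring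
    simp_rw [this]
    rw [Finset.sum_add_distrib, ← Finset.mul_sum, ← Finset.mul_sum]
    ring
  have harea : areaDensity U p = √m / ‖fderiv ℝ ρ p‖ := by
    rw [areaDensity, normal, ← hρd, ← hmd, norm_smul, norm_inv, Real.norm_of_nonneg hsq0.le,
      norm_fderiv_eq_norm_grad, mul_inv, inv_inv]
    rfl
  have hnorm : 0 < ‖fderiv ℝ ρ p‖ := norm_pos_iff.2 hρ
  rw [harea, hbf, hLN, weight_eq hε hεr hf, flux, ← hρd, hflux, sq_abs, mul_pow, sq (√m), hsq]
  field_simp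

end Mink

end

/-! ### Bounds for the coefficients and the current near the null cone. -/

noncomputable section

namespace Mink

/-- The real function `f` is bounded on `s`. -/
def BoundedOn {X : Type*} (s : Set X) (f : X → ℝ) : Prop := ∃ C, ∀ x ∈ s, |f x| ≤ C

namespace BoundedOn

variable {X : Type*} {s t : Set X} {f g : X → ℝ}

theorem const (s : Set X) (c : ℝ) : BoundedOn s fun _ => c := ⟨|c|, fun _ _ => le_rfl⟩

theorem congr (hf : BoundedOn s f) (h : ∀ x ∈ s, g x = f x) : BoundedOn s g := by
  obtain ⟨C, hC⟩ := hf
  exact ⟨C, fun x hx => by rw [h x hx]; exact hC x hx⟩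

theorem mono (hf : BoundedOn s f) (h : t ⊆ s) : BoundedOn t f := by
  obtain ⟨C, hC⟩ := hf
  exact ⟨C, fun x hx => hC x (h hx)⟩

theorem add (hf : BoundedOn s f) (hg : BoundedOn s g) : BoundedOn s fun x => f x + g x := by
  obtain ⟨C, hC⟩ := hf
  obtain ⟨D, hD⟩ := hg
  exact ⟨C + D, fun x hx => (abs_add_le _ _).trans (add_le_add (hC x hx) (hD x hx))⟩

theorem mul (hf : BoundedOn s f) (hg : BoundedOn s g) : BoundedOn s fun x => f x * g x := by
  obtain ⟨C, hC⟩ := hf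
  obtain ⟨D, hD⟩ := hg
  exact ⟨C * D, fun x hx => by
    rw [abs_mul]
    exact mul_le_mul (hC x hx) (hD x hx) (abs_nonneg _) ((abs_nonneg _).trans (hC x hx))⟩

theorem const_mul (hf : BoundedOn s f) (c : ℝ) : BoundedOn s fun x => c * f x := (const s c).mul hf

theorem sub (hf : BoundedOn s f) (hg : BoundedOn s g) : BoundedOn s fun x => f x - g x :=
  (hf.add (hg.const_mul (-1))).congr fun x _ => by ring

theorem pow (hf : BoundedOn s f) (k : ℕ) : BoundedOn s fun x => f x ^ k := by
  obtain ⟨C, hC⟩ := hf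
  exact ⟨C ^ k, fun x hx => by rw [abs_pow]; exact pow_le_pow_left₀ (abs_nonneg _) (hC x hx) k⟩

theorem sum {ι : Type*} {u : Finset ι} {F : ι → X → ℝ} (h : ∀ i ∈ u, BoundedOn s (F i)) :
    BoundedOn s fun x => ∑ i ∈ u, F i x := by
  classical
  induction u using Finset.induction_on with
  | empty => simpa using const s 0
  | insert i u hi ih =>
    simp only [Finset.sum_insert hi]
    exact (h i (Finset.mem_insert_self i u)).add
      (ih fun j hj => h j (Finset.mem_insert_of_mem hj))

theorem of_isCompact [TopologicalSpace X] (hs : IsCompact s) (hf : ContinuousOn f s) :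
    BoundedOn s f := by
  obtain ⟨C, hC⟩ := hs.exists_bound_of_continuousOn hf
  exact ⟨C, hC⟩

end BoundedOn

variable {n : ℕ} {a b ε R : ℝ} {P p : Spacetime n} {s : Set (Spacetime n)}

/-- The standing assumptions on the region of integration. -/
structure Confined (s : Set (Spacetime n)) (P : Spacetime n) (R b ε : ℝ) : Prop where
  hf : ∀ p ∈ s, 0 < fP P p
  hr : ∀ p ∈ s, rP P p < R
  hb : 0 < b
  hε : 0 < ε
  hεR : ε * R ≤ 1 / 32
  hbR : b * R ≤ 1

namespace Confined

theorem mono {t : Set (Spacetime n)} (h : Confined s P R b ε) (hts : t ⊆ s) :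
    Confined t P R b ε :=
  ⟨fun p hp => h.hf p (hts hp), fun p hp => h.hr p (hts hp), h.hb, h.hε, h.hεR, h.hbR⟩

theorem eps_mul_rP_le (h : Confined s P R b ε) (hp : p ∈ s) : ε * rP P p ≤ 1 / 32 :=
  (mul_le_mul_of_nonneg_left (h.hr p hp).le h.hε.le).trans h.hεR

theorem b_mul_rP_le (h : Confined s P R b ε) (hp : p ∈ s) : b * rP P p ≤ 1 :=
  (mul_le_mul_of_nonneg_left (h.hr p hp).le h.hb.le).trans h.hbR

theorem half_le_cD (h : Confined s P R b ε) (hp : p ∈ s) : 1 / 2 ≤ cD ε (rP P p) (fP P p) :=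
  (cD_bounds h.hε (h.eps_mul_rP_le hp) (h.hf p hp)).1

theorem cD_pos (h : Confined s P R b ε) (hp : p ∈ s) : 0 < cD ε (rP P p) (fP P p) := by
  linarith [h.half_le_cD hp]

theorem subset_regularRegion (h : Confined s P R b ε) : s ⊆ regularRegion ε P := fun p hp => ⟨h.hf p hp, h.cD_pos hp⟩

theorem rP_bdd (h : Confined s P R b ε) : BoundedOn s (rP P) :=
  ⟨R, fun p hp => by rw [abs_of_nonneg (rP_nonneg P p)]; exact (h.hr p hp).le⟩

theorem tP_bdd (h : Confined s P R b ε) : BoundedOn s (tP P) := ⟨R, fun p hp => ((abs_tP_lt (h.hf p hp)).trans (h.hr p hp)).le⟩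

theorem uP_bdd (h : Confined s P R b ε) : BoundedOn s (uP P) :=
  ((h.tP_bdd.sub h.rP_bdd).const_mul (1 / 2)).congr fun p _ => by unfold uP; ring

theorem vP_bdd (h : Confined s P R b ε) : BoundedOn s (vP P) :=
  ((h.tP_bdd.add h.rP_bdd).const_mul (1 / 2)).congr fun p _ => by unfold vP; ring

theorem fP_bdd (h : Confined s P R b ε) : BoundedOn s (fP P) :=
  ((h.uP_bdd.mul h.vP_bdd).const_mul (-1)).congr fun p _ => by unfold fP; ring

theorem omega_bdd (h : Confined s P R b ε) (i : Fin n) : BoundedOn s fun p => omega P p i := by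
  refine ⟨1, fun p hp => ?_⟩
  have hr := rP_pos (h.hf p hp)
  have h1 : omega P p i * omega P p i ≤ 1 := by
    rw [← sum_omega_sq hr]
    exact Finset.single_le_sum (f := fun i => omega P p i * omega P p i)
      (fun j _ => mul_self_nonneg _) (Finset.mem_univ i)
  exact abs_le_one_iff_mul_self_le_one.2 h1

theorem xP_bdd (h : Confined s P R b ε) (i : Fin n) : BoundedOn s fun p => xP P p i :=
  (h.rP_bdd.mul (h.omega_bdd i)).congr fun p hp => xP_eq (rP_pos (h.hf p hp)) i

theorem fP_div_sq_bdd (h : Confined s P R b ε) : BoundedOn s fun p => fP P p / rP P p ^ 2 := by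
  refine ⟨1 / 4, fun p hp => ?_⟩
  have hr := rP_pos (h.hf p hp)
  rw [abs_of_nonneg (div_nonneg (h.hf p hp).le (by positivity)), div_le_iff₀ (by positivity)]
  linarith [fP_le P p]

theorem fP_div_rP_bdd (h : Confined s P R b ε) : BoundedOn s fun p => fP P p / rP P p :=
  (h.fP_div_sq_bdd.mul h.rP_bdd).congr fun p hp => by
    have hr := rP_pos (h.hf p hp)
    field_simp

theorem multiplier_bdd (h : Confined s P R b ε) (k : Fin (n + 1)) : BoundedOn s fun p => multiplier ε P p k := by
  have h1 := (BoundedOn.const s 1).sub (h.rP_bdd.const_mul ε)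
  refine Fin.cases ?_ (fun i => ?_) k
  · exact ((h.tP_bdd.mul h1).const_mul (1 / 2)).congr fun p _ => by rw [multiplier_zero]; ring
  · exact ((h.xP_bdd i).mul ((h1.add ((h.fP_div_rP_bdd.const_mul ε).const_mul 2)).const_mul
      (1 / 2))).congr fun p _ => by rw [multiplier_succ]; ring

theorem cQ_bdd (h : Confined s P R b ε) : BoundedOn s fun p => cQ n ε (rP P p) (fP P p) :=
  (((BoundedOn.const s 1).sub (h.rP_bdd.const_mul ε)).const_mul _).add
    ((h.fP_div_rP_bdd.const_mul ε).const_mul _)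

theorem pd_rP_bdd (h : Confined s P R b ε) (k : Fin (n + 1)) : BoundedOn s (pd k (rP P)) := by
  refine Fin.cases ?_ (fun i => ?_) k
  · exact (BoundedOn.const s 0).congr fun p hp => pd_rP_zero (rP_pos (h.hf p hp))
  · exact (h.omega_bdd i).congr fun p hp => pd_rP_succ (rP_pos (h.hf p hp)) i

theorem pd_fP_div_rP_bdd (h : Confined s P R b ε) (k : Fin (n + 1)) : BoundedOn s fun p => pd k (fP P) p / rP P p := by
  refine Fin.cases ?_ (fun i => ?_) k
  · refine ⟨1 / 2, fun p hp => ?_⟩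
    have hr := rP_pos (h.hf p hp)
    change |pd 0 (fP P) p / rP P p| ≤ 1 / 2
    rw [pd_fP_zero, abs_div, abs_neg, abs_div, abs_of_pos hr, abs_two, div_le_iff₀ hr]
    linarith [abs_tP_lt (h.hf p hp)]
  · refine ((h.omega_bdd i).const_mul (1 / 2)).congr fun p hp => ?_
    have hr := rP_pos (h.hf p hp)
    rw [pd_fP_succ, xP_eq hr]
    field_simp

theorem pd_fP_bdd (h : Confined s P R b ε) (k : Fin (n + 1)) : BoundedOn s (pd k (fP P)) :=
  (h.rP_bdd.mul (h.pd_fP_div_rP_bdd k)).congr fun p hp => by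
    have hr := rP_pos (h.hf p hp)
    field_simp

theorem pd_cQ_bdd (h : Confined s P R b ε) (k : Fin (n + 1)) :
    BoundedOn s (pd k fun q => cQ n ε (rP P q) (fP P q)) := by
  refine (((h.pd_rP_bdd k).const_mul (-((n - 1) / 4 * ε))).add (((h.pd_fP_div_rP_bdd k).sub
    (h.fP_div_sq_bdd.mul (h.pd_rP_bdd k))).const_mul ((n - 2) / 2 * ε))).congr fun p hp => ?_
  have hr := rP_pos (h.hf p hp)
  have hrd : DifferentiableAt ℝ (rP P) p := (contDiffAt_rP hr).differentiableAt (by simp)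
  have hfd : DifferentiableAt ℝ (fun q => fP P q / rP P q) p :=
    (contDiffAt_fP_div_rP hr).differentiableAt (by simp)
  have e : (fun q => cQ n ε (rP P q) (fP P q)) = fun q => (((n : ℝ) - 1) / 4 +
      (-((n - 1) / 4 * ε)) * rP P q) + ((n - 2) / 2 * ε) * (fP P q / rP P q) :=
    funext fun q => by unfold cQ; ring
  rw [e, pd_add (by fun_prop) (by fun_prop), pd_add (by fun_prop) (by fun_prop), pd_const,
    pd_const_mul hrd, pd_const_mul hfd, pd_fP_div_rP hr, zero_add]

theorem inv_cD_bdd (h : Confined s P R b ε) : BoundedOn s fun p => (cD ε (rP P p) (fP P p))⁻¹ := by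
  refine ⟨2, fun p hp => ?_⟩
  rw [abs_of_nonneg (inv_nonneg.2 (h.cD_pos hp).le), inv_le_comm₀ (h.cD_pos hp) (by norm_num)]
  linarith [h.half_le_cD hp]

theorem cY_bdd (h : Confined s P R b ε) : BoundedOn s fun p => cY ε (rP P p) (fP P p) := by
  refine ⟨R, fun p hp => ?_⟩
  have hr := rP_pos (h.hf p hp)
  have hD := h.half_le_cD hp
  refine le_trans ?_ (h.hr p hp).le
  refine abs_le_of_sq_le_sq ?_ hr.le
  rw [cY_sq (h.hf p hp) (h.cD_pos hp), div_le_iff₀ (h.cD_pos hp)]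
  nlinarith [fP_le P p, sq_nonneg (rP P p)]

theorem cW_bdd (h : Confined s P R b ε) : BoundedOn s fun p => cW ε (rP P p) (fP P p) :=
  (h.fP_div_rP_bdd.const_mul (ε / 2)).congr fun p _ => by unfold cW; ring

theorem slope_bdd (h : Confined s P R b ε) (a : ℝ) : BoundedOn s fun p => a * (1 + b * cY ε (rP P p) (fP P p)) :=
  ((BoundedOn.const s 1).add (h.cY_bdd.const_mul b)).const_mul a

theorem fP_mul_cG_bdd (h : Confined s P R b ε) (a : ℝ) : BoundedOn s fun p => fP P p * cG a b ε (rP P p) (fP P p) :=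
  ((h.slope_bdd a).mul h.inv_cD_bdd).congr fun p hp => by
    have hf := h.hf p hp
    have hD := h.cD_pos hp
    rw [cG]; field_simp

/-- The worst term of B is 1/y², which is of order 1/f, and w is bounded because f/r is. -/
theorem fP_mul_cB_bdd (h : Confined s P R b ε) (a : ℝ) : BoundedOn s fun p => fP P p * cB a b ε (rP P p) (fP P p) := by
  refine ((((((BoundedOn.const s 1).add (h.cY_bdd.const_mul (2 * b))).add
    ((h.cY_bdd.pow 2).const_mul (b ^ 2))).const_mul (a ^ 2 / 2)).sub
    (h.cY_bdd.const_mul (a * b / 4))).sub (h.cW_bdd.mul (h.slope_bdd a))).mul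
    h.inv_cD_bdd |>.congr fun p hp => ?_
  have hf := h.hf p hp
  have hD := h.cD_pos hp
  have hy := cY_pos hf hD
  have hyf : fP P p = cY ε (rP P p) (fP P p) ^ 2 * cD ε (rP P p) (fP P p) := by
    rw [cY_sq hf hD]; field_simp
  unfold cB
  have e : fP P p * ((a ^ 2 * (1 / cY ε (rP P p) (fP P p) ^ 2 + 2 * b / cY ε (rP P p) (fP P p) +
      b ^ 2) / 2 - a * b / (4 * cY ε (rP P p) (fP P p)) - cW ε (rP P p) (fP P p) *
      (a * (1 + b * cY ε (rP P p) (fP P p)) / cY ε (rP P p) (fP P p) ^ 2)) /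
      cD ε (rP P p) (fP P p) ^ 2) = cY ε (rP P p) (fP P p) ^ 2 * cD ε (rP P p) (fP P p) *
      ((a ^ 2 * (1 / cY ε (rP P p) (fP P p) ^ 2 + 2 * b / cY ε (rP P p) (fP P p) +
      b ^ 2) / 2 - a * b / (4 * cY ε (rP P p) (fP P p)) - cW ε (rP P p) (fP P p) *
      (a * (1 + b * cY ε (rP P p) (fP P p)) / cY ε (rP P p) (fP P p) ^ 2)) /
      cD ε (rP P p) (fP P p) ^ 2) := congrArg (· * _) hyf
  rw [e]
  field_simp

/-- E is (f/D)^a times a bounded exponential. One power of f/D is split off and the remaining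
exponent a - 1 is nonnegative. -/
theorem wt_div_bdd (h : Confined s P R b ε) (ha : 1 ≤ a) : BoundedOn s fun p => wt a b ε P p / fP P p := by
  obtain ⟨C, hC⟩ := h.fP_bdd
  obtain ⟨C', hC'⟩ := h.slope_bdd (2 * a)
  refine ⟨Real.exp ((a - 1) * (2 * C) + C') * 2, fun p hp => ?_⟩
  have hf := h.hf p hp
  have hD := h.cD_pos hp
  have hX : 0 < fP P p / cD ε (rP P p) (fP P p) := div_pos hf hD
  have hfC := (le_abs_self _).trans (hC p hp)
  have h1 : fP P p / cD ε (rP P p) (fP P p) ≤ 2 * C := by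
    rw [div_le_iff₀ hD]; nlinarith [h.half_le_cD hp]
  have h2 : Real.log (fP P p / cD ε (rP P p) (fP P p)) ≤ 2 * C :=
    (Real.log_le_sub_one_of_pos hX).trans (by linarith)
  have h3 : 2 * a * (1 + b * cY ε (rP P p) (fP P p)) ≤ C' := (le_abs_self _).trans (hC' p hp)
  have h4 : wt a b ε P p = Real.exp ((a - 1) * Real.log (fP P p / cD ε (rP P p) (fP P p)) +
      2 * a * (b * cY ε (rP P p) (fP P p))) * (fP P p / cD ε (rP P p) (fP P p)) := by
    nth_rewrite 2 [← Real.exp_log hX]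
    rw [wt, cE, ← Real.exp_add]
    congr 1
    ring
  rw [abs_of_nonneg (div_nonneg (wt_pos a b ε P p).le hf.le), h4]
  have h5 : Real.exp ((a - 1) * Real.log (fP P p / cD ε (rP P p) (fP P p)) +
      2 * a * (b * cY ε (rP P p) (fP P p))) * (fP P p / cD ε (rP P p) (fP P p)) / fP P p =
      Real.exp ((a - 1) * Real.log (fP P p / cD ε (rP P p) (fP P p)) +
      2 * a * (b * cY ε (rP P p) (fP P p))) * (cD ε (rP P p) (fP P p))⁻¹ := by
    field_simp
  rw [h5]
  have h6 : (cD ε (rP P p) (fP P p))⁻¹ ≤ 2 := by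
    rw [inv_le_comm₀ hD (by norm_num)]; linarith [h.half_le_cD hp]
  refine mul_le_mul (Real.exp_le_exp.2 ?_) h6 (inv_nonneg.2 hD.le) (Real.exp_pos _).le
  have h7 := mul_le_mul_of_nonneg_left h2 (by linarith : (0 : ℝ) ≤ a - 1)
  linarith

/-- The current vanishes at least linearly towards the null cone. -/
theorem jetCurrent_div_bdd (h : Confined s P R b ε) (ha : 1 ≤ a) {φ : Spacetime n → ℝ}
    {L : Spacetime n → Spacetime n →L[ℝ] ℝ}
    (hL : ∀ k, BoundedOn s fun p => L p (EuclideanSpace.single k 1)) (hφ : BoundedOn s φ)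
    (k : Fin (n + 1)) : BoundedOn s fun p => jetCurrent a b ε P L φ p k / fP P p := by
  -- The differential dψ is of size E/f, so a quadratic expression in it could be of size E²/f².
  -- Contracting with S, or taking the metric square, gains a factor f because g(S, S) = fD. The
  -- current is thus O(E²/f), that is O(f), since E²/f² is bounded.
  have hE := (h.wt_div_bdd ha).pow 2
  have hS := h.multiplier_bdd
  have hT : BoundedOn s fun p => ∑ j, multiplier ε P p j * L p (EuclideanSpace.single j 1) :=
    BoundedOn.sum fun j _ => (hS j).mul (hL j)
  have hM := (hT.add ((h.slope_bdd a).mul hφ)).add (h.cQ_bdd.mul hφ)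
  have hd := (h.fP_bdd.mul (hL k)).add ((h.fP_mul_cG_bdd a).mul (((hS k).const_mul (sg k)).mul hφ))
  have hQ0 : BoundedOn s fun p => ∑ j, sg j * (L p (EuclideanSpace.single j 1) *
      L p (EuclideanSpace.single j 1)) := BoundedOn.sum fun j _ => ((hL j).mul (hL j)).const_mul _
  have hQ := ((h.fP_bdd.mul hQ0).add (((h.fP_mul_cG_bdd a).mul (hφ.mul hT)).const_mul 2)).add
    ((h.fP_mul_cG_bdd a).mul ((h.slope_bdd a).mul (hφ.mul hφ)))
  refine (hE.mul (((((hd.mul hM).const_mul (sg k)).sub (((hS k).mul hQ).const_mul (1 / 2))).sub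
    ((h.fP_bdd.mul ((hφ.mul hφ).mul (h.pd_cQ_bdd k))).const_mul (1 / 2 * sg k))).add
    ((h.fP_mul_cB_bdd a).mul ((hφ.mul hφ).mul (hS k))))).congr fun p hp => ?_
  have hf := h.hf p hp
  have hD := h.cD_pos hp
  have hr := rP_pos hf
  have hslope := cG_mul (a := a) (b := b) hf hD
  have hmet := metric_multiplier (ε := ε) hr
  have eM : jetMultiplier a b ε P L φ p = wt a b ε P p *
      ((∑ j, multiplier ε P p j * L p (EuclideanSpace.single j 1)) +
        a * (1 + b * cY ε (rP P p) (fP P p)) * φ p + cQ n ε (rP P p) (fP P p) * φ p) := by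
    have e1 : ∑ j, multiplier ε P p j * jetGrad a b ε P L φ j p = wt a b ε P p *
        (∑ j, multiplier ε P p j * L p (EuclideanSpace.single j 1)) +
        wt a b ε P p * cG a b ε (rP P p) (fP P p) * φ p *
          ∑ j, sg j * (multiplier ε P p j * multiplier ε P p j) := by
      rw [Finset.mul_sum, Finset.mul_sum, ← Finset.sum_add_distrib]
      exact Finset.sum_congr rfl fun j _ => by rw [jetGrad]; ring
    rw [jetMultiplier, e1, hmet, ← hslope]
    ring
  have eQ : ∑ j, sg j * (jetGrad a b ε P L φ j p * jetGrad a b ε P L φ j p) =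
      wt a b ε P p ^ 2 * ((∑ j, sg j * (L p (EuclideanSpace.single j 1) *
        L p (EuclideanSpace.single j 1))) + 2 * cG a b ε (rP P p) (fP P p) * φ p *
        (∑ j, multiplier ε P p j * L p (EuclideanSpace.single j 1)) +
        cG a b ε (rP P p) (fP P p) * (a * (1 + b * cY ε (rP P p) (fP P p))) * (φ p * φ p)) := by
    have e1 : ∑ j, sg j * (jetGrad a b ε P L φ j p * jetGrad a b ε P L φ j p) =
        wt a b ε P p ^ 2 * (∑ j, sg j * (L p (EuclideanSpace.single j 1) *
          L p (EuclideanSpace.single j 1))) +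
        2 * wt a b ε P p ^ 2 * cG a b ε (rP P p) (fP P p) * φ p *
          (∑ j, multiplier ε P p j * L p (EuclideanSpace.single j 1)) +
        wt a b ε P p ^ 2 * cG a b ε (rP P p) (fP P p) ^ 2 * φ p ^ 2 *
          ∑ j, sg j * (multiplier ε P p j * multiplier ε P p j) := by
      rw [Finset.mul_sum, Finset.mul_sum, Finset.mul_sum, ← Finset.sum_add_distrib,
        ← Finset.sum_add_distrib]
      refine Finset.sum_congr rfl fun j _ => ?_
      rw [jetGrad]
      linear_combination (2 * wt a b ε P p ^ 2 * cG a b ε (rP P p) (fP P p) * φ p *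
        (multiplier ε P p j * L p (EuclideanSpace.single j 1)) +
        wt a b ε P p ^ 2 * cG a b ε (rP P p) (fP P p) ^ 2 * φ p ^ 2 * sg j *
          (multiplier ε P p j * multiplier ε P p j)) * sg_mul_self j
    rw [e1, hmet, ← hslope]
    ring
  simp only [jetCurrent]
  rw [eM, eQ, jetGrad]
  field_simp

end Confined

end Mink

end

/-! ### Integrability of the terms of the estimate. -/

noncomputable section

namespace Mink

variable {n : ℕ} {a b ε R : ℝ} {P p : Spacetime n} {U : Set (Spacetime n)}
  {φ : Spacetime n → ℝ}

theorem isOpen_exterior (P : Spacetime n) : IsOpen (exterior P) :=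
  isOpen_lt continuous_const (contDiff_fP P).continuous

theorem norm_sub_sq (P p : Spacetime n) : ‖p - P‖ ^ 2 = tP P p ^ 2 + rP P p ^ 2 := by
  rw [EuclideanSpace.norm_sq_eq, Fin.sum_univ_succ, rP_sq]
  simp [tP, time, xP, sq]

theorem isCompact_cylinder (P : Spacetime n) (R : ℝ) :
    IsCompact {q : Spacetime n | |tP P q| ≤ R ∧ rP P q ≤ R} := by
  refine Metric.isCompact_of_isClosed_isBounded ?_ ?_
  · exact (isClosed_le (contDiff_tP P).continuous.abs continuous_const).inter
      (isClosed_le (continuous_rP P) continuous_const)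
  · refine (Metric.isBounded_closedBall (x := P) (r := 2 * R)).subset fun q hq => ?_
    obtain ⟨h1, h2⟩ := hq
    have hR : 0 ≤ R := (abs_nonneg _).trans h1
    rw [mem_closedBall_iff_norm]
    refine abs_le_of_sq_le_sq' ?_ (by linarith) |>.2
    rw [norm_sub_sq]
    have h3 := sq_le_sq' (by linarith [neg_abs_le (tP P q)]) ((le_abs_self (tP P q)).trans h1)
    have h4 := pow_le_pow_left₀ (rP_nonneg P q) h2 2
    nlinarith

theorem BoundedOn.integrableOn {s : Set (Spacetime n)} {f : Spacetime n → ℝ}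
    {μ : Measure (Spacetime n)} (h : BoundedOn s f) (hs : MeasurableSet s) (hμ : μ s < ⊤)
    (hf : ContinuousOn f s) : IntegrableOn f s μ := by
  obtain ⟨C, hC⟩ := h
  exact IntegrableOn.of_bound hμ (hf.aestronglyMeasurable hs) C
    ((ae_restrict_iff' hs).2 (ae_of_all _ hC))

/-- The hypotheses of the Carleman estimate that concern smoothness and size. -/
structure Setting (U : Set (Spacetime n)) (P : Spacetime n) (R a b ε : ℝ)
    (φ : Spacetime n → ℝ) : Prop where
  boundary : ∀ p ∈ frontier U, ∃ ρ, IsDefiningFunctionAt U p ρ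
  confined : Confined (closure U ∩ exterior P) P R b ε
  one_le : 1 ≤ a
  contDiffOn_two : ContDiffOn ℝ 2 φ U
  contDiffOn_one : ContDiffOn ℝ 1 φ (closure U)

/-- The differential of a function that is `C¹` up to the boundary. -/
def diffClosure (U : Set (Spacetime n)) (φ : Spacetime n → ℝ) (p : Spacetime n) :
    Spacetime n →L[ℝ] ℝ := fderivWithin ℝ φ (closure U) p

namespace Setting

theorem isOpen (h : Setting U P R a b ε φ) : IsOpen U := isOpen_of_definingFunctions h.boundary

theorem closure_subset_cylinder (h : Setting U P R a b ε φ) :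
    closure U ∩ exterior P ⊆ {q | |tP P q| ≤ R ∧ rP P q ≤ R} := fun p hp =>
  ⟨((abs_tP_lt (h.confined.hf p hp)).trans (h.confined.hr p hp)).le, (h.confined.hr p hp).le⟩

theorem interior_subset (_ : Setting U P R a b ε φ) : U ∩ exterior P ⊆ closure U ∩ exterior P :=
  inter_subset_inter_left _ subset_closure

theorem frontier_subset (_ : Setting U P R a b ε φ) :
    frontier U ∩ exterior P ⊆ closure U ∩ exterior P :=
  inter_subset_inter_left _ frontier_subset_closure

theorem measurableSet_interior (h : Setting U P R a b ε φ) : MeasurableSet (U ∩ exterior P) :=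
  (h.isOpen.inter (isOpen_exterior P)).measurableSet

theorem measurableSet_frontier (_ : Setting U P R a b ε φ) :
    MeasurableSet (frontier U ∩ exterior P) :=
  isClosed_frontier.measurableSet.inter (isOpen_exterior P).measurableSet

theorem volume_lt_top (h : Setting U P R a b ε φ) : volume (U ∩ exterior P) < ⊤ :=
  lt_of_le_of_lt (measure_mono (h.interior_subset.trans h.closure_subset_cylinder))
    (isCompact_cylinder P R).measure_lt_top

theorem area_lt_top (h : Setting U P R a b ε φ) :
    Measure.euclideanHausdorffMeasure n (frontier U ∩ exterior P) < ⊤ :=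
  lt_of_le_of_lt (measure_mono (subset_inter inter_subset_left
    (h.frontier_subset.trans h.closure_subset_cylinder)))
    (measure_frontier_inter_lt_top h.boundary (isCompact_cylinder P R))

theorem continuousOn_diffClosure (h : Setting U P R a b ε φ) :
    ContinuousOn (diffClosure U φ) (closure U) :=
  h.contDiffOn_one.continuousOn_fderivWithin
    (uniqueDiffOn_closure_of_definingFunctions h.boundary) le_rfl

theorem diffClosure_eq (h : Setting U P R a b ε φ) (hp : p ∈ U) :
    diffClosure U φ p = fderiv ℝ φ p :=
  fderivWithin_of_mem_nhds (mem_of_superset (h.isOpen.mem_nhds hp) subset_closure)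

theorem contDiffAt (h : Setting U P R a b ε φ) (hp : p ∈ U) : ContDiffAt ℝ 2 φ p :=
  h.contDiffOn_two.contDiffAt (h.isOpen.mem_nhds hp)

theorem pd_eq (h : Setting U P R a b ε φ) (hp : p ∈ U) (k : Fin (n + 1)) :
    pd k φ p = diffClosure U φ p (EuclideanSpace.single k 1) := by
  rw [h.diffClosure_eq hp, pd]

theorem boundedOn_of_continuousOn (h : Setting U P R a b ε φ) {f : Spacetime n → ℝ}
    (hf : ContinuousOn f (closure U)) : BoundedOn (closure U ∩ exterior P) f :=
  (BoundedOn.of_isCompact ((isCompact_cylinder P R).inter_left isClosed_closure)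
    (hf.mono inter_subset_left)).mono (subset_inter inter_subset_left h.closure_subset_cylinder)

theorem boundedOn_phi (h : Setting U P R a b ε φ) : BoundedOn (closure U ∩ exterior P) φ :=
  h.boundedOn_of_continuousOn h.contDiffOn_one.continuousOn

theorem boundedOn_diffClosure (h : Setting U P R a b ε φ) (k : Fin (n + 1)) :
    BoundedOn (closure U ∩ exterior P)
      fun p => diffClosure U φ p (EuclideanSpace.single k 1) :=
  h.boundedOn_of_continuousOn (h.continuousOn_diffClosure.clm_apply continuousOn_const)

theorem boundedOn_current (h : Setting U P R a b ε φ) (k : Fin (n + 1)) :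
    BoundedOn (closure U ∩ exterior P)
      fun p => jetCurrent a b ε P (diffClosure U φ) φ p k / fP P p :=
  h.confined.jetCurrent_div_bdd h.one_le h.boundedOn_diffClosure h.boundedOn_phi k

theorem continuousOn_current (h : Setting U P R a b ε φ) :
    ContinuousOn (jetCurrent a b ε P (diffClosure U φ) φ) (closure U ∩ exterior P) :=
  continuousOn_jetCurrent h.confined.subset_regularRegion
    (h.continuousOn_diffClosure.mono inter_subset_left)
    (h.contDiffOn_one.continuousOn.mono inter_subset_left)

theorem continuousOn_pd (h : Setting U P R a b ε φ) (k : Fin (n + 1)) :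
    ContinuousOn (pd k φ) U := fun _ hp =>
  (contDiffAt_pd (h.contDiffAt hp) k).continuousAt.continuousWithinAt

theorem continuousOn_box (h : Setting U P R a b ε φ) : ContinuousOn (box φ) U := by
  have h1 : ∀ k, ContinuousOn (pd k (pd k φ)) U := fun k => by
    have h2 : ContDiffOn ℝ 1 (pd k φ) U := fun p hp =>
      (contDiffAt_pd (h.contDiffAt hp) k).contDiffWithinAt
    exact (h2.continuousOn_fderiv_of_isOpen h.isOpen le_rfl).clm_apply continuousOn_const
  have h3 : box φ = fun p => ∑ k, sg k * pd k (pd k φ) p := funext fun p => box_eq_sum φ p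
  rw [h3]
  exact continuousOn_finsetSum _ fun k _ => continuousOn_const.mul (h1 k)

theorem continuousOn_wt (h : Setting U P R a b ε φ) :
    ContinuousOn (wt a b ε P) (closure U ∩ exterior P) := fun q hq =>
  (contDiffAt_wt (h.confined.hf q hq) (h.confined.cD_pos hq)).continuousAt.continuousWithinAt

theorem weight_eq_sq (h : Setting U P R a b ε φ) (hp : p ∈ closure U ∩ exterior P) :
    weight P a b ε p = wt a b ε P p ^ 2 :=
  weight_eq h.confined.hε (h.confined.eps_mul_rP_le hp) (h.confined.hf p hp)

theorem continuousOn_omega (h : Setting U P R a b ε φ) (i : Fin n) :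
    ContinuousOn (fun p => omega P p i) (closure U ∩ exterior P) :=
  (contDiff_xP P i).continuous.continuousOn.div (continuous_rP P).continuousOn
    fun q hq => (rP_pos (h.confined.hf q hq)).ne'

/-- The integrand is bounded on a set of finite volume: ζ = (E/f)² f², and f/r is bounded, so 1/r
does no harm at the vertex. -/
theorem integrableOn_firstOrder (h : Setting U P R a b ε φ) :
    IntegrableOn (fun p => weight P a b ε p * (rP P p)⁻¹ * firstOrder P φ p)
      (U ∩ exterior P) := by
  have hc := h.confined.mono h.interior_subset
  have hd : ∀ k, BoundedOn (U ∩ exterior P) (pd k φ) := fun k =>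
    ((h.boundedOn_diffClosure k).mono h.interior_subset).congr fun p hp => h.pd_eq hp.1 k
  have hdc : ∀ k, ContinuousOn (pd k φ) (U ∩ exterior P) := fun k =>
    (h.continuousOn_pd k).mono inter_subset_left
  have hω : ∀ i, ContinuousOn (fun p => omega P p i) (U ∩ exterior P) := fun i =>
    (h.continuousOn_omega i).mono h.interior_subset
  have hR : BoundedOn (U ∩ exterior P) (dR P φ) :=
    BoundedOn.sum fun i _ => (hc.omega_bdd i).mul (hd i.succ)
  have hRc : ContinuousOn (dR P φ) (U ∩ exterior P) :=
    continuousOn_finsetSum _ fun i _ => (hω i).mul (hdc i.succ)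
  have hA : BoundedOn (U ∩ exterior P) (angGradSq P φ) :=
    BoundedOn.sum fun i _ => ((hd i.succ).sub (hR.mul (hc.omega_bdd i))).pow 2
  have hAc : ContinuousOn (angGradSq P φ) (U ∩ exterior P) :=
    continuousOn_finsetSum _ fun i _ => ((hdc i.succ).sub (hRc.mul (hω i))).pow 2
  have ht := (contDiff_tP P).continuous.continuousOn (s := U ∩ exterior P)
  have hr := (continuous_rP P).continuousOn (s := U ∩ exterior P)
  have hF : BoundedOn (U ∩ exterior P) (firstOrder P φ) :=
    ((((hc.uP_bdd.mul ((hd 0).sub hR)).pow 2).add ((hc.vP_bdd.mul ((hd 0).add hR)).pow 2)).add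
      (hc.fP_bdd.mul hA)).congr fun p _ => by rw [firstOrder, sq_abs, sq_abs, dU, dV]
  have hFc : ContinuousOn (firstOrder P φ) (U ∩ exterior P) :=
    (((((ht.sub hr).div_const 2).mul ((hdc 0).sub hRc)).abs.pow 2).add
      ((((ht.add hr).div_const 2).mul ((hdc 0).add hRc)).abs.pow 2)).add
      ((contDiff_fP P).continuous.continuousOn.mul hAc)
  have hw : ContinuousOn (weight P a b ε) (U ∩ exterior P) :=
    ((h.continuousOn_wt.pow 2).mono h.interior_subset).congr fun p hp =>
      h.weight_eq_sq (h.interior_subset hp)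
  refine BoundedOn.integrableOn ?_ h.measurableSet_interior h.volume_lt_top
    ((hw.mul (hr.inv₀ fun q hq => (rP_pos (hc.hf q hq)).ne')).mul hFc)
  refine ((((hc.wt_div_bdd h.one_le).pow 2).mul (hc.fP_bdd.mul hc.fP_div_rP_bdd)).mul hF).congr
    fun p hp => ?_
  have hf := hc.hf p hp
  have hr := rP_pos hf
  rw [h.weight_eq_sq (h.interior_subset hp)]
  field_simp

theorem integrableOn_zerothOrder (h : Setting U P R a b ε φ) :
    IntegrableOn (fun p => weight P a b ε p * fP P p ^ (-(1 / 2) : ℝ) * φ p ^ 2)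
      (U ∩ exterior P) := by
  have hc := h.confined.mono h.interior_subset
  have hφ := h.boundedOn_phi.mono h.interior_subset
  have hsq : BoundedOn (U ∩ exterior P) fun p => √(fP P p) := by
    obtain ⟨C, hC⟩ := hc.fP_bdd
    refine ⟨√C, fun p hp => ?_⟩
    rw [abs_of_nonneg (Real.sqrt_nonneg _)]
    exact Real.sqrt_le_sqrt ((le_abs_self _).trans (hC p hp))
  have hw : ContinuousOn (weight P a b ε) (U ∩ exterior P) :=
    ((h.continuousOn_wt.pow 2).mono h.interior_subset).congr fun p hp =>
      h.weight_eq_sq (h.interior_subset hp)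
  have hf0 := (contDiff_fP P).continuous.continuousOn (s := U ∩ exterior P)
  refine BoundedOn.integrableOn ?_ h.measurableSet_interior h.volume_lt_top
    ((hw.mul (hf0.rpow_const fun q hq => Or.inl (hc.hf q hq).ne')).mul
      ((h.contDiffOn_two.continuousOn.mono inter_subset_left).pow 2))
  refine ((((hc.wt_div_bdd h.one_le).pow 2).mul (hc.fP_bdd.mul hsq)).mul (hφ.pow 2)).congr
    fun p hp => ?_
  have hf := hc.hf p hp
  have hs : 0 < √(fP P p) := Real.sqrt_pos.2 hf
  rw [h.weight_eq_sq (h.interior_subset hp), rpow_neg_half hf]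
  have e : fP P p = √(fP P p) ^ 2 := (Real.sq_sqrt hf.le).symm
  generalize √(fP P p) = y at *
  rw [e]
  field_simp

theorem exists_norm_current_le (h : Setting U P R a b ε φ) :
    ∃ C, ∀ p ∈ closure U ∩ exterior P,
      ‖jetCurrent a b ε P (diffClosure U φ) φ p‖ ≤ C * fP P p := by
  choose C hC using h.boundedOn_current
  refine ⟨∑ k, C k, fun p hp => ?_⟩
  have hf := h.confined.hf p hp
  have h1 : jetCurrent a b ε P (diffClosure U φ) φ p =
      ∑ k, jetCurrent a b ε P (diffClosure U φ) φ p k • EuclideanSpace.single k (1 : ℝ) := by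
    ext j
    simp [Finset.sum_apply, Pi.single_apply]
  rw [h1, Finset.sum_mul]
  refine (norm_sum_le _ _).trans (Finset.sum_le_sum fun k _ => ?_)
  have h2 := hC k p hp
  rw [abs_div, abs_of_pos hf, div_le_iff₀ hf] at h2
  simpa [norm_smul] using h2

/-- The defining function in `flux` is chosen separately at each point. Near a given point it is
replaced by one fixed ρ, whose differential is continuous. -/
theorem continuousOn_flux (h : Setting U P R a b ε φ) {J : Spacetime n → Spacetime n}
    {s : Set (Spacetime n)} (hJ : ContinuousOn J s) (hs : s ⊆ frontier U) :
    ContinuousOn (flux U J) s := by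
  intro p hp
  obtain ⟨ρ, hρ⟩ := h.boundary p (hs hp)
  have hc : ContinuousAt (fderiv ℝ ρ) p := (hρ.smooth.continuous_fderiv (by simp)).continuousAt
  have h1 : ContinuousWithinAt (fun q => fderiv ℝ ρ q (J q) / ‖fderiv ℝ ρ q‖) s p :=
    (hc.continuousWithinAt.clm_apply (hJ p hp)).div hc.norm.continuousWithinAt
      (norm_ne_zero_iff.2 hρ.fderiv_ne_zero)
  refine h1.congr_of_eventuallyEq ?_ (flux_eq (hs hp) hρ J)
  filter_upwards [self_mem_nhdsWithin, mem_nhdsWithin_of_mem_nhds hρ.eventually] with q hq hq'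
  exact flux_eq (hs hq) hq' J

theorem abs_flux_le (J : Spacetime n → Spacetime n) (p : Spacetime n) :
    |flux U J p| ≤ ‖J p‖ := by
  rw [flux, abs_div, abs_norm]
  rcases (norm_nonneg (fderiv ℝ (definingFunction U p) p)).eq_or_lt with h0 | h0
  · rw [← h0, div_zero]; exact norm_nonneg _
  · rw [div_le_iff₀ h0, mul_comm]
    exact (fderiv ℝ (definingFunction U p) p).le_opNorm (J p)

theorem integrableOn_flux (h : Setting U P R a b ε φ) :
    IntegrableOn (flux U (jetCurrent a b ε P (diffClosure U φ) φ)) (frontier U ∩ exterior P)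
      (Measure.euclideanHausdorffMeasure n) := by
  refine BoundedOn.integrableOn ?_ h.measurableSet_frontier h.area_lt_top
    (h.continuousOn_flux (h.continuousOn_current.mono h.frontier_subset) inter_subset_left)
  obtain ⟨C, hC⟩ := h.exists_norm_current_le
  obtain ⟨D, hD⟩ := h.confined.fP_bdd
  refine ⟨|C| * D, fun p hp => (abs_flux_le _ _).trans ((hC p (h.frontier_subset hp)).trans ?_)⟩
  have hf := h.confined.hf p (h.frontier_subset hp)
  have h1 := (le_abs_self _).trans (hD p (h.frontier_subset hp))
  calc C * fP P p ≤ |C| * fP P p := mul_le_mul_of_nonneg_right (le_abs_self C) hf.le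
    _ ≤ |C| * D := by gcongr

/-- Vanishing of φ on the part of ∂U in the open exterior makes its tangential derivatives vanish
there. The boundary term then inherits measurability and integrability from the flux of a continuous
field. -/
theorem areaDensity_mul_eq_flux (h : Setting U P R a b ε φ)
    (ht : ∀ p ∈ frontier U, ∀ ρ, IsDefiningFunctionAt U p ρ → 0 < metric (grad ρ p) (grad ρ p))
    (h0 : ∀ p ∈ frontier U ∩ exterior P, φ p = 0) (hp : p ∈ frontier U ∩ exterior P) :
    areaDensity U p * (weight P a b ε p * boundaryFactor U P ε p * |normalDeriv U φ p| ^ 2) =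
      2 * flux U (jetCurrent a b ε P (diffClosure U φ) φ) p := by
  have hρ := definingFunction_spec (h.boundary p hp.1)
  have hpc := h.frontier_subset hp
  refine areaDensity_mul_boundaryTerm (L := diffClosure U φ) h.confined.hε
    (h.confined.eps_mul_rP_le hpc) hp.2 hρ.fderiv_ne_zero (ht p hp.1 _ hρ) (fun w hw => ?_)
    (h0 p hp)
  refine hρ.apply_eq_zero_of_tangent hp.1
    ((h.contDiffOn_one.differentiableOn (by simp) p
      (frontier_subset_closure hp.1)).hasFDerivWithinAt) ?_ hw
  filter_upwards [(isOpen_exterior P).mem_nhds hp.2] with q hq hq'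
  exact h0 q ⟨hq', hq⟩

end Setting

end Mink

end

/-! ### Cutoff near the null cone and integration of the pointwise inequality. -/

noncomputable section

namespace Mink

variable {n : ℕ} {a b ε R : ℝ} {P p : Spacetime n} {U : Set (Spacetime n)}
  {φ : Spacetime n → ℝ}

theorem divergence_congr {J K : Spacetime n → Spacetime n} (h : J =ᶠ[𝓝 p] K) :
    divergence J p = divergence K p :=
  Finset.sum_congr rfl fun k _ => pd_congr (h.fun_comp fun v : Spacetime n => v k) k

/-- The cutoff of the region where `f_P` is small, at scale `1 / m`. -/
def coneCutoff (P : Spacetime n) (m : ℝ) (p : Spacetime n) : ℝ := cutoff (m * fP P p)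

theorem contDiff_coneCutoff (P : Spacetime n) (m : ℝ) : ContDiff ℝ ∞ (coneCutoff P m) :=
  contDiff_cutoff.comp (contDiff_const.mul (contDiff_fP P))

theorem coneCutoff_nonneg (P : Spacetime n) (m : ℝ) (p : Spacetime n) : 0 ≤ coneCutoff P m p :=
  cutoff_nonneg _

theorem coneCutoff_le_one (P : Spacetime n) (m : ℝ) (p : Spacetime n) : coneCutoff P m p ≤ 1 :=
  cutoff_le_one _

theorem abs_coneCutoff_le (P : Spacetime n) (m : ℝ) (p : Spacetime n) : |coneCutoff P m p| ≤ 1 := by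
  rw [abs_of_nonneg (coneCutoff_nonneg P m p)]; exact coneCutoff_le_one P m p

theorem coneCutoff_eq_zero {m : ℝ} (h : m * fP P p ≤ 1) : coneCutoff P m p = 0 := cutoff_of_le h

theorem fderiv_coneCutoff (P : Spacetime n) (m : ℝ) (p v : Spacetime n) :
    fderiv ℝ (coneCutoff P m) p v = m * deriv cutoff (m * fP P p) * fderiv ℝ (fP P) p v := by
  have h1 : HasFDerivAt (fP P) (fderiv ℝ (fP P) p) p :=
    ((contDiff_fP P).differentiable (by simp) p).hasFDerivAt
  have h2 : HasFDerivAt (coneCutoff P m) _ p :=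
    (hasDerivAt_cutoff (m * fP P p)).comp_hasFDerivAt p (h1.const_mul m)
  rw [h2.fderiv]
  simp only [smul_apply, smul_eq_mul]
  ring

theorem eventually_coneCutoff_eq_one (hf : 0 < fP P p) :
    ∀ᶠ k : ℕ in atTop, coneCutoff P (k + 1) p = 1 ∧
      ∀ v, fderiv ℝ (coneCutoff P (k + 1)) p v = 0 := by
  have h1 : Tendsto (fun k : ℕ => (k + 1 : ℝ) * fP P p) atTop atTop :=
    (tendsto_natCast_atTop_atTop.atTop_add tendsto_const_nhds).atTop_mul_const hf
  filter_upwards [h1.eventually_gt_atTop 2] with k hk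
  refine ⟨cutoff_of_ge hk.le, fun v => ?_⟩
  rw [fderiv_coneCutoff, deriv_cutoff_eq_zero fun h => absurd h.2 (not_le.2 hk), mul_zero, zero_mul]

namespace Setting

theorem isCompact_support (h : Setting U P R a b ε φ) {m : ℝ} (hm : 0 < m) :
    IsCompact (closure U ∩ {q | 1 ≤ m * fP P q}) := by
  have hcl : IsClosed (closure U ∩ {q | 1 ≤ m * fP P q}) := isClosed_closure.inter
    (isClosed_le continuous_const (continuous_const.mul (contDiff_fP P).continuous))
  refine (isCompact_cylinder P R).of_isClosed_subset hcl fun q hq => ?_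
  refine h.closure_subset_cylinder ⟨hq.1, ?_⟩
  have h1 : 1 ≤ m * fP P q := hq.2
  exact (mul_pos_iff_of_pos_left hm).1 (by linarith)

theorem support_subset (_ : Setting U P R a b ε φ) {m : ℝ} (hm : 0 < m) :
    closure U ∩ {q | 1 ≤ m * fP P q} ⊆ closure U ∩ exterior P := fun q hq => by
  have h1 : 1 ≤ m * fP P q := hq.2
  exact ⟨hq.1, (mul_pos_iff_of_pos_left hm).1 (by linarith)⟩

theorem boundedOn_coneCutoff_mul (h : Setting U P R a b ε φ) {m : ℝ} (hm : 0 < m)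
    {g : Spacetime n → ℝ} (hg : ContinuousOn g (closure U ∩ exterior P)) :
    BoundedOn (closure U ∩ exterior P) fun p => coneCutoff P m p * g p := by
  obtain ⟨C, hC⟩ := BoundedOn.of_isCompact (h.isCompact_support hm) (hg.mono (h.support_subset hm))
  refine ⟨|C|, fun p hp => ?_⟩
  by_cases h1 : 1 ≤ m * fP P p
  · rw [abs_mul]
    calc |coneCutoff P m p| * |g p| ≤ 1 * |C| :=
          mul_le_mul (abs_coneCutoff_le P m p) ((hC p ⟨hp.1, h1⟩).trans (le_abs_self C))
            (abs_nonneg _) zero_le_one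
      _ = |C| := one_mul _
  · simp only [coneCutoff_eq_zero (not_le.1 h1).le, zero_mul, abs_zero]
    exact abs_nonneg _

/-- The derivative of the cutoff contributes a bounded amount, uniformly in the scale. -/
theorem exists_abs_fderiv_coneCutoff_le (h : Setting U P R a b ε φ) :
    ∃ C, ∀ m, 0 < m → ∀ p ∈ closure U ∩ exterior P,
      |fderiv ℝ (coneCutoff P m) p (jetCurrent a b ε P (diffClosure U φ) φ p)| ≤ C := by
  obtain ⟨C₁, hC₁⟩ := (BoundedOn.of_isCompact (isCompact_Icc (a := (1 : ℝ)) (b := 2))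
    continuous_deriv_cutoff.continuousOn)
  have hb : BoundedOn (closure U ∩ exterior P) fun p =>
      ∑ k, pd k (fP P) p * (jetCurrent a b ε P (diffClosure U φ) φ p k / fP P p) :=
    BoundedOn.sum fun k _ => (h.confined.pd_fP_bdd k).mul (h.boundedOn_current k)
  obtain ⟨C₂, hC₂⟩ := hb
  refine ⟨2 * (|C₁| * |C₂|), fun m hm p hp => ?_⟩
  have hf := h.confined.hf p hp
  rw [fderiv_coneCutoff]
  by_cases h1 : m * fP P p ∈ Icc (1 : ℝ) 2
  · have h2 : fderiv ℝ (fP P) p (jetCurrent a b ε P (diffClosure U φ) φ p) = fP P p *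
        ∑ k, pd k (fP P) p * (jetCurrent a b ε P (diffClosure U φ) φ p k / fP P p) := by
      rw [← sum_pd_mul, Finset.mul_sum]
      exact Finset.sum_congr rfl fun k _ => by field_simp
    rw [h2]
    have h3 := (hC₁ _ h1).trans (le_abs_self C₁)
    have h4 := (hC₂ _ hp).trans (le_abs_self C₂)
    set S := ∑ k, pd k (fP P) p * (jetCurrent a b ε P (diffClosure U φ) φ p k / fP P p)
    -- The large factor m of the cutoff derivative meets the factor f of the current, and mf ≤ 2 on
    -- the support of the derivative.
    have h5 : |m * fP P p| ≤ 2 := by rw [abs_of_pos (by positivity)]; exact h1.2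
    calc |m * deriv cutoff (m * fP P p) * (fP P p * S)| =
          |m * fP P p| * (|deriv cutoff (m * fP P p)| * |S|) := by
          rw [← abs_mul, ← abs_mul]; congr 1; ring
      _ ≤ 2 * (|C₁| * |C₂|) := by gcongr
  · rw [deriv_cutoff_eq_zero h1, mul_zero, zero_mul, abs_zero]
    positivity

theorem integrableOn_fderiv_coneCutoff (h : Setting U P R a b ε φ) {m : ℝ} (hm : 0 < m) :
    IntegrableOn (fun p => fderiv ℝ (coneCutoff P m) p
      (jetCurrent a b ε P (diffClosure U φ) φ p)) (U ∩ exterior P) := by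
  obtain ⟨C, hC⟩ := h.exists_abs_fderiv_coneCutoff_le
  refine BoundedOn.integrableOn ⟨C, fun p hp => hC m hm p (h.interior_subset hp)⟩
    h.measurableSet_interior h.volume_lt_top ?_
  exact ((contDiff_coneCutoff P m).continuous_fderiv (by simp)).continuousOn.clm_apply
    (h.continuousOn_current.mono h.interior_subset)

theorem current_eq (h : Setting U P R a b ε φ) (hp : p ∈ U ∩ exterior P) :
    jetCurrent a b ε P (diffClosure U φ) φ =ᶠ[𝓝 p] carlemanCurrent a b ε P φ := by
  filter_upwards [(h.isOpen.inter (isOpen_exterior P)).mem_nhds hp] with q hq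
  have hq' := h.confined.subset_regularRegion (h.interior_subset hq)
  exact (carlemanCurrent_eq_jetCurrent hq'.1 hq'.2
    ((h.contDiffAt hq.1).differentiableAt (by simp)) (h.diffClosure_eq hq.1)).symm

theorem contDiffAt_current (h : Setting U P R a b ε φ) (hp : p ∈ U ∩ exterior P) :
    ContDiffAt ℝ 1 (jetCurrent a b ε P (diffClosure U φ) φ) p := by
  have hq' := h.confined.subset_regularRegion (h.interior_subset hp)
  exact (contDiffAt_carlemanCurrent hq'.1 hq'.2 (h.contDiffAt hp.1)).congr_of_eventuallyEq
    (h.current_eq hp)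

theorem divergence_eq (h : Setting U P R a b ε φ) (hp : p ∈ U ∩ exterior P) :
    divergence (carlemanCurrent a b ε P φ) p = box φ p *
      (wt a b ε P p * jetMultiplier a b ε P (diffClosure U φ) φ p) +
        jetRemainder a b ε P (diffClosure U φ) φ p := by
  have hq' := h.confined.subset_regularRegion (h.interior_subset hp)
  exact divergence_carlemanCurrent_eq_jet hq'.1 hq'.2 (h.contDiffAt hp.1) (h.diffClosure_eq hp.1)

/-- On the support of the cutoff f is bounded below, so the jet terms are bounded. The term with □φ
is controlled by ζf|□φ|² and the finite volume. -/
theorem integrableOn_coneCutoff_mul_divergence (h : Setting U P R a b ε φ)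
    (hbox : IntegrableOn (fun p => weight P a b ε p * fP P p * |box φ p| ^ 2) (U ∩ exterior P))
    {m : ℝ} (hm : 0 < m) :
    IntegrableOn (fun p => coneCutoff P m p * divergence (carlemanCurrent a b ε P φ) p)
      (U ∩ exterior P) := by
  have hLc := h.continuousOn_diffClosure.mono (inter_subset_left (t := exterior P))
  have hφc := h.contDiffOn_one.continuousOn.mono (inter_subset_left (t := exterior P))
  have hreg := h.confined.subset_regularRegion
  have hα := h.continuousOn_wt.mul (continuousOn_jetMultiplier (a := a) (b := b) hreg hLc hφc)
  have hβ := continuousOn_jetRemainder (a := a) (b := b) hreg hLc hφc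
  have hχ := (contDiff_coneCutoff P m).continuous.continuousOn (s := U ∩ exterior P)
  have hβi : IntegrableOn (fun p => coneCutoff P m p *
      jetRemainder a b ε P (diffClosure U φ) φ p) (U ∩ exterior P) :=
    BoundedOn.integrableOn ((h.boundedOn_coneCutoff_mul hm hβ).mono h.interior_subset)
      h.measurableSet_interior h.volume_lt_top (hχ.mul (hβ.mono h.interior_subset))
  have hαi : IntegrableOn (fun p => coneCutoff P m p * (box φ p * (wt a b ε P p *
      jetMultiplier a b ε P (diffClosure U φ) φ p))) (U ∩ exterior P) := by
    -- The coefficient of □φ is written as a bounded function z times E√f, and |z x| ≤ z² + x² is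
    -- used with x = E√f □φ.
    obtain ⟨C, hC⟩ := h.boundedOn_coneCutoff_mul hm
      (hα.div (h.continuousOn_wt.mul (contDiff_fP P).continuous.sqrt.continuousOn)
        fun q hq => mul_ne_zero (wt_pos a b ε P q).ne'
          (Real.sqrt_pos.2 (h.confined.hf q hq)).ne')
    have hconst : IntegrableOn (fun _ : Spacetime n => C ^ 2) (U ∩ exterior P) :=
      integrableOn_const h.volume_lt_top.ne
    refine Integrable.mono' (hconst.add hbox) ?_ ?_
    · exact (hχ.mul ((h.continuousOn_box.mono inter_subset_left).mul
        (hα.mono h.interior_subset))).aestronglyMeasurable h.measurableSet_interior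
    · refine (ae_restrict_iff' h.measurableSet_interior).2 (ae_of_all _ fun p hp => ?_)
      have hpc := h.interior_subset hp
      have hf := h.confined.hf p hpc
      have hw := wt_pos a b ε P p
      have hs : 0 < √(fP P p) := Real.sqrt_pos.2 hf
      have h1 := hC p hpc
      rw [Pi.add_apply, h.weight_eq_sq hpc, Real.norm_eq_abs, sq_abs]
      set z := coneCutoff P m p * (wt a b ε P p *
        jetMultiplier a b ε P (diffClosure U φ) φ p / (wt a b ε P p * √(fP P p))) with hz
      have h2 : coneCutoff P m p * (box φ p * (wt a b ε P p *
          jetMultiplier a b ε P (diffClosure U φ) φ p)) =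
          z * (wt a b ε P p * √(fP P p) * box φ p) := by
        rw [hz]; field_simp
      have h3 : wt a b ε P p ^ 2 * fP P p * box φ p ^ 2 =
          (wt a b ε P p * √(fP P p) * box φ p) ^ 2 := by
        rw [mul_pow, mul_pow, Real.sq_sqrt hf.le]
      have h1' : |z| ≤ C := h1
      rw [h2, h3, abs_mul, ← sq_abs (wt a b ε P p * √(fP P p) * box φ p)]
      generalize |wt a b ε P p * √(fP P p) * box φ p| = x
      nlinarith [sq_nonneg (|z| - x), abs_nonneg z, sq_nonneg x,
        pow_le_pow_left₀ (abs_nonneg z) h1' 2]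
  refine (hαi.add hβi).congr_fun (fun p hp => ?_) h.measurableSet_interior
  rw [h.divergence_eq hp]
  simp only [Pi.add_apply]
  ring

theorem divergence_cutoff_current (h : Setting U P R a b ε φ) {m : ℝ}
    (hp : p ∈ U ∩ exterior P) :
    divergence (fun q => coneCutoff P m q • jetCurrent a b ε P (diffClosure U φ) φ q) p =
      fderiv ℝ (coneCutoff P m) p (jetCurrent a b ε P (diffClosure U φ) φ p) +
        coneCutoff P m p * divergence (carlemanCurrent a b ε P φ) p := by
  rw [divergence_smul ((contDiff_coneCutoff P m).differentiable (by simp) p)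
    ((h.contDiffAt_current hp).differentiableAt (by simp)), divergence_congr (h.current_eq hp)]

theorem eventually_cutoff_smul_eq_zero {m : ℝ} (hm : 0 < m) (J : Spacetime n → Spacetime n)
    (hp : p ∉ exterior P) : (fun q => coneCutoff P m q • J q) =ᶠ[𝓝 p] fun _ => 0 := by
  have h1 : m * fP P p < 1 := by
    have : fP P p ≤ 0 := not_lt.1 hp
    nlinarith
  have hc : Continuous fun q => m * fP P q := continuous_const.mul (contDiff_fP P).continuous
  filter_upwards [hc.continuousAt.eventually_lt_const h1] with q hq
  rw [coneCutoff_eq_zero hq.le, zero_smul]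

/-- The divergence theorem for the current, cut off near the null cone. -/
theorem integral_coneCutoff_mul_divergence (h : Setting U P R a b ε φ)
    (hbox : IntegrableOn (fun p => weight P a b ε p * fP P p * |box φ p| ^ 2) (U ∩ exterior P))
    {m : ℝ} (hm : 0 < m) :
    ∫ p in U ∩ exterior P, coneCutoff P m p * divergence (carlemanCurrent a b ε P φ) p =
      (∫ p in frontier U ∩ exterior P, coneCutoff P m p *
        flux U (jetCurrent a b ε P (diffClosure U φ) φ) p ∂μHE[n]) -
      ∫ p in U ∩ exterior P, fderiv ℝ (coneCutoff P m) p
        (jetCurrent a b ε P (diffClosure U φ) φ p) := by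
  set J := jetCurrent a b ε P (diffClosure U φ) φ with hJ
  set V := fun q => coneCutoff P m q • J q with hV
  have hχ := contDiff_coneCutoff P m
  -- Off the exterior mf < 1, so the cut-off field vanishes in a neighbourhood, whatever values the
  -- current takes there.
  have hVc : ContinuousOn V (closure U) := by
    intro p hp
    by_cases hpe : p ∈ exterior P
    · have h1 : ContinuousWithinAt J (closure U) p :=
        (h.continuousOn_current p ⟨hp, hpe⟩).mono_of_mem_nhdsWithin
          (inter_mem_nhdsWithin _ ((isOpen_exterior P).mem_nhds hpe))
      exact hχ.continuous.continuousWithinAt.smul h1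
    · exact (continuousAt_const.congr
        (eventually_cutoff_smul_eq_zero hm J hpe).symm).continuousWithinAt
  have hVd : ContDiffOn ℝ 1 V U := by
    intro p hp
    by_cases hpe : p ∈ exterior P
    · exact ((hχ.of_le (le_trans (by norm_num) two_le_infty)).contDiffAt.smul
        (h.contDiffAt_current ⟨hp, hpe⟩)).contDiffWithinAt
    · exact (contDiffAt_const.congr_of_eventuallyEq
        (eventually_cutoff_smul_eq_zero hm J hpe)).contDiffWithinAt
  have hzero : ∀ p ∈ U \ (U ∩ exterior P), divergence V p = 0 := by
    intro p hp
    have hpe : p ∉ exterior P := fun h' => hp.2 ⟨hp.1, h'⟩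
    rw [divergence_congr (eventually_cutoff_smul_eq_zero hm J hpe), divergence]
    simp [pd_const]
  have hi1 := h.integrableOn_fderiv_coneCutoff hm
  have hi2 := h.integrableOn_coneCutoff_mul_divergence hbox hm
  have hdiv : EqOn (fun p => fderiv ℝ (coneCutoff P m) p (J p) +
      coneCutoff P m p * divergence (carlemanCurrent a b ε P φ) p) (divergence V)
      (U ∩ exterior P) := fun p hp => (h.divergence_cutoff_current hp).symm
  have hint : IntegrableOn (divergence V) U :=
    ((hi1.add hi2).congr_fun hdiv h.measurableSet_interior).of_forall_sdiff_eq_zero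
      h.isOpen.measurableSet hzero
  have key := integral_divergence h.isOpen h.boundary hVc (h.isCompact_support hm)
    (fun p hp hpK => by
      have : ¬ 1 ≤ m * fP P p := fun h' => hpK ⟨hp, h'⟩
      simp only [hV, coneCutoff_eq_zero (not_le.1 this).le, zero_smul]) hVd hint
  rw [setIntegral_eq_of_subset_of_forall_sdiff_eq_zero h.isOpen.measurableSet inter_subset_left
    hzero, ← setIntegral_congr_fun h.measurableSet_interior hdiv, integral_add hi1 hi2] at key
  have hflux : ∀ p, flux U V p = coneCutoff P m p * flux U J p := fun p => by
    simp only [flux, hV, map_smul, smul_eq_mul]; ring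
  have hfr : ∫ q in frontier U, flux U V q ∂μHE[n] =
      ∫ p in frontier U ∩ exterior P, coneCutoff P m p * flux U J p ∂μHE[n] := by
    rw [setIntegral_eq_of_subset_of_forall_sdiff_eq_zero isClosed_frontier.measurableSet
      (inter_subset_left (t := exterior P)) fun p hp => ?_]
    · simp_rw [hflux]
    · have hpe : p ∉ exterior P := fun h' => hp.2 ⟨hp.1, h'⟩
      rw [hflux, coneCutoff_eq_zero, zero_mul]
      have : fP P p ≤ 0 := not_lt.1 hpe
      nlinarith
  rw [hfr] at key
  linarith

theorem tendsto_integral_coneCutoff {μ : Measure (Spacetime n)} {s : Set (Spacetime n)}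
    (hs : MeasurableSet s) (hse : s ⊆ exterior P) {g : Spacetime n → ℝ}
    (hg : IntegrableOn g s μ) :
    Tendsto (fun k : ℕ => ∫ p in s, coneCutoff P (k + 1) p * g p ∂μ) atTop
      (𝓝 (∫ p in s, g p ∂μ)) := by
  refine tendsto_integral_of_dominated_convergence (fun p => ‖g p‖) (fun k => ?_) hg.norm
    (fun k => ae_of_all _ fun p => ?_) ((ae_restrict_iff' hs).2 (ae_of_all _ fun p hp => ?_))
  · exact (contDiff_coneCutoff P (k + 1)).continuous.aestronglyMeasurable.mul
      hg.aestronglyMeasurable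
  · rw [norm_mul]
    exact mul_le_of_le_one_left (norm_nonneg _) (abs_coneCutoff_le P (k + 1) p)
  · refine tendsto_const_nhds.congr' ?_
    filter_upwards [eventually_coneCutoff_eq_one (hse hp)] with k hk
    rw [hk.1, one_mul]

/-- At each point of the exterior the cutoff is eventually locally constant, and the integrands are
bounded uniformly in the scale. Hence the null cone contributes no boundary term. -/
theorem tendsto_integral_fderiv_coneCutoff (h : Setting U P R a b ε φ) :
    Tendsto (fun k : ℕ => ∫ p in U ∩ exterior P, fderiv ℝ (coneCutoff P (k + 1)) p
      (jetCurrent a b ε P (diffClosure U φ) φ p)) atTop (𝓝 0) := by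
  obtain ⟨C, hC⟩ := h.exists_abs_fderiv_coneCutoff_le
  have h0 : (0 : ℝ) = ∫ p in U ∩ exterior P, (0 : ℝ) := by simp
  rw [h0]
  refine tendsto_integral_of_dominated_convergence (fun _ => C) (fun k => ?_)
    (integrableOn_const h.volume_lt_top.ne) (fun k => ?_) ?_
  · exact (h.integrableOn_fderiv_coneCutoff (by positivity)).aestronglyMeasurable
  · exact (ae_restrict_iff' h.measurableSet_interior).2 (ae_of_all _ fun p hp =>
      hC _ (by positivity) p (h.interior_subset hp))
  · refine (ae_restrict_iff' h.measurableSet_interior).2 (ae_of_all _ fun p hp => ?_)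
    refine tendsto_const_nhds.congr' ?_
    filter_upwards [eventually_coneCutoff_eq_one hp.2] with k hk
    rw [hk.2]

/-- The Carleman estimate, with the boundary term expressed by the flux of the current. -/
theorem carleman_flux (h : Setting U P R a b ε φ) (hn : 1 ≤ n) (hna : (n : ℝ) ^ 2 ≤ a)
    (hεb : ε ≤ b / 32)
    (hbox : IntegrableOn (fun p => weight P a b ε p * fP P p * |box φ p| ^ 2)
      (U ∩ exterior P)) :
    1 / 16 * (ε * (∫ p in U ∩ exterior P, weight P a b ε p * (rP P p)⁻¹ * firstOrder P φ p) +
      b * a ^ 2 * ∫ p in U ∩ exterior P,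
        weight P a b ε p * fP P p ^ (-(1 / 2) : ℝ) * φ p ^ 2) ≤
    (∫ p in U ∩ exterior P, weight P a b ε p * fP P p * |box φ p| ^ 2) / (4 * a) +
      ∫ p in frontier U ∩ exterior P,
        flux U (jetCurrent a b ε P (diffClosure U φ) φ) p ∂μHE[n] := by
  have hm := h.measurableSet_interior
  have i1 := h.integrableOn_firstOrder
  have i2 := h.integrableOn_zerothOrder
  have iF := ((i1.const_mul ε).add (i2.const_mul (b * a ^ 2))).const_mul (1 / 16)
  have iW := hbox.div_const (4 * a)
  have hlhs : 1 / 16 * (ε * (∫ p in U ∩ exterior P,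
      weight P a b ε p * (rP P p)⁻¹ * firstOrder P φ p) + b * a ^ 2 * ∫ p in U ∩ exterior P,
        weight P a b ε p * fP P p ^ (-(1 / 2) : ℝ) * φ p ^ 2) =
      ∫ p in U ∩ exterior P, 1 / 16 * (ε * (weight P a b ε p * (rP P p)⁻¹ * firstOrder P φ p) +
        b * a ^ 2 * (weight P a b ε p * fP P p ^ (-(1 / 2) : ℝ) * φ p ^ 2)) := by
    rw [integral_const_mul, integral_add (i1.const_mul ε) (i2.const_mul (b * a ^ 2)),
      integral_const_mul, integral_const_mul]
  rw [hlhs, ← integral_div]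
  have t1 := tendsto_integral_coneCutoff hm inter_subset_right iF
  have t2 := tendsto_integral_coneCutoff hm inter_subset_right iW
  have t3 := tendsto_integral_coneCutoff h.measurableSet_frontier inter_subset_right
    h.integrableOn_flux
  have t4 := (t2.add t3).sub h.tendsto_integral_fderiv_coneCutoff
  rw [sub_zero] at t4
  -- The pointwise inequality is multiplied by the nonnegative cutoff before integration, so the
  -- uncut divergence is never integrated.
  refine le_of_tendsto_of_tendsto' t1 t4 fun k => ?_
  have hk : (0 : ℝ) < k + 1 := by positivity
  have hd := h.integrableOn_coneCutoff_mul_divergence hbox hk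
  have hcut : ∀ {g : Spacetime n → ℝ}, IntegrableOn g (U ∩ exterior P) →
      IntegrableOn (fun p => coneCutoff P (k + 1) p * g p) (U ∩ exterior P) := fun {g} hg =>
    Integrable.mono' hg.norm ((contDiff_coneCutoff P (k + 1)).continuous.aestronglyMeasurable.mul
      hg.aestronglyMeasurable) (ae_of_all _ fun p => by
        rw [norm_mul]
        exact mul_le_of_le_one_left (norm_nonneg _) (abs_coneCutoff_le P (k + 1) p))
  rw [add_sub_assoc, ← h.integral_coneCutoff_mul_divergence hbox hk, ← integral_add (hcut iW) hd]
  refine setIntegral_mono_on (hcut iF) ((hcut iW).add hd) hm fun p hp => ?_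
  have hpc := h.interior_subset hp
  have := pointwise_carleman hn hna h.confined.hb h.confined.hε hεb (h.confined.b_mul_rP_le hpc)
    hp.2 (h.contDiffAt hp.1)
  have h2 := mul_le_mul_of_nonneg_left this (coneCutoff_nonneg P (k + 1) p)
  exact h2.trans_eq (mul_add _ _ _)

end Setting

end Mink

end

/-! ### The Carleman estimate. -/

open Mink in
theorem theorem3p1 :
    ∃ c : ℝ, 0 < c ∧ ∀ n : ℕ, 1 ≤ n →
    ∃ cₙ : ℝ, 0 < cₙ ∧ ∃ C : ℝ, 0 < C ∧ ∃ C' : ℝ, 0 < C' ∧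
    ∀ (U : Set (Spacetime n)) (P : Spacetime n) (R ε a b : ℝ),
      IsGTC U → 0 < R → closure U ∩ exterior P ⊆ {p | rP P p < R} →
      0 < ε → 0 < a → 0 < b → (n : ℝ) ^ 2 ≤ a → ε ≤ cₙ * b → b ≤ c * R⁻¹ →
    ∀ φ : Spacetime n → ℝ,
      ContDiffOn ℝ 2 φ U → ContDiffOn ℝ 1 φ (closure U) →
      (∀ p ∈ frontier U ∩ exterior P, φ p = 0) →
      BoundaryIntegrable U (frontier U ∩ exterior P)
        (fun p => weight P a b ε p * boundaryFactor U P ε p * |normalDeriv U φ p| ^ 2) ∧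
      IntegrableOn (fun p => weight P a b ε p * (rP P p)⁻¹ * firstOrder P φ p)
        (U ∩ exterior P) ∧
      IntegrableOn (fun p => weight P a b ε p * fP P p ^ (-(1 / 2) : ℝ) * φ p ^ 2)
        (U ∩ exterior P) ∧
      (IntegrableOn (fun p => weight P a b ε p * fP P p * |box φ p| ^ 2) (U ∩ exterior P) →
        C * ε * (∫ p in U ∩ exterior P, weight P a b ε p * (rP P p)⁻¹ * firstOrder P φ p) +
          C * b * a ^ 2 *
            (∫ p in U ∩ exterior P, weight P a b ε p * fP P p ^ (-(1 / 2) : ℝ) * φ p ^ 2) ≤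
        1 / a * (∫ p in U ∩ exterior P, weight P a b ε p * fP P p * |box φ p| ^ 2) +
          C' * boundaryIntegral U (frontier U ∩ exterior P)
            (fun p => weight P a b ε p * boundaryFactor U P ε p * |normalDeriv U φ p| ^ 2)) := by
  -- Here c = 1 and cₙ = 1/32 give bR ≤ 1 and εR ≤ 1/32. C = 1/16 is the pointwise constant, and C'
  -- = 1/2 because the boundary integrand is twice the flux.
  refine ⟨1, one_pos, fun n hn => ⟨1 / 32, by norm_num, 1 / 16, by norm_num, 1 / 2, by norm_num, ?_⟩⟩
  intro U P R ε a b hU hR hUR hε ha hb hna hεb hbR φ hφ2 hφ1 h0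
  have hn1 : (1 : ℝ) ≤ n := by exact_mod_cast hn
  have hbR' : b * R ≤ 1 := by
    rw [one_mul] at hbR
    calc b * R ≤ R⁻¹ * R := by gcongr
      _ = 1 := inv_mul_cancel₀ hR.ne'
  have hεb' : ε ≤ b / 32 := by linarith
  have hεR : ε * R ≤ 1 / 32 := by
    calc ε * R ≤ b / 32 * R := by gcongr
      _ ≤ 1 / 32 := by linarith
  have h : Setting U P R a b ε φ :=
    ⟨hU.smooth_boundary, ⟨fun p hp => hp.2, fun p hp => hUR hp, hb, hε, hεR, hbR'⟩,
      by nlinarith, hφ2, hφ1⟩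
  have hflux : EqOn (fun p => 2 * flux U (jetCurrent a b ε P (diffClosure U φ) φ) p)
      (fun p => areaDensity U p *
        (weight P a b ε p * boundaryFactor U P ε p * |normalDeriv U φ p| ^ 2))
      (frontier U ∩ exterior P) := fun p hp =>
    (h.areaDensity_mul_eq_flux hU.timelike_boundary h0 hp).symm
  refine ⟨IntegrableOn.congr_fun (Integrable.const_mul h.integrableOn_flux 2) hflux
      h.measurableSet_frontier,
    h.integrableOn_firstOrder, h.integrableOn_zerothOrder, fun hbox => ?_⟩
  have hbd : boundaryIntegral U (frontier U ∩ exterior P)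
      (fun p => weight P a b ε p * boundaryFactor U P ε p * |normalDeriv U φ p| ^ 2) =
      2 * ∫ p in frontier U ∩ exterior P,
        flux U (jetCurrent a b ε P (diffClosure U φ) φ) p ∂μHE[n] := by
    rw [boundaryIntegral, ← setIntegral_congr_fun h.measurableSet_frontier hflux,
      integral_const_mul]
  have hW : 0 ≤ ∫ p in U ∩ exterior P, weight P a b ε p * fP P p * |box φ p| ^ 2 :=
    setIntegral_nonneg h.measurableSet_interior fun p hp => by
      rw [h.weight_eq_sq (h.interior_subset hp)]
      have := h.confined.hf p (h.interior_subset hp)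
      positivity
  have key := h.carleman_flux hn hna hεb' hbox
  -- The pointwise argument gives the factor 1/(4a), which is weakened to 1/a.
  have hle : (∫ p in U ∩ exterior P, weight P a b ε p * fP P p * |box φ p| ^ 2) / (4 * a) ≤
      1 / a * ∫ p in U ∩ exterior P, weight P a b ε p * fP P p * |box φ p| ^ 2 := by
    rw [one_div_mul_eq_div]
    exact div_le_div_of_nonneg_left hW ha (by linarith)
  rw [hbd]
  linarith
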